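/- Let $n\ge 0$ and let $r,s\in\mathbb{C}^{\times}$ with $r\neq s$ and $r+s\neq 0$. **The algebra $U_{r,s}(\mathfrak{gl}_n)$.** Let $\epsilon_1,\dots,\epsilon_n$ be the standard orthonormal basis and $\alpha_j=\epsilon_j-\epsilon_{j+1}$. Then $U_{r,s}(\mathfrak{gl}_n)$ is the unital associative $\mathbb{C}$-algebra with generators $e_j,f_j$ $(1\le j<n)$ and $a_i^{\pm1},b_i^{\pm1}$ $(1\le i\le n)$ and relations - (R1) all $a_i^{\pm1},b_j^{\pm1}$ commute with each other, and $a_ia_i^{-1}=b_ib_i^{-1}=1$; - (R2) $a_ie_j=r^{\langle\epsilon_i,\alpha_j\rangle}e_ja_i$ and $a_if_j=r^{-\langle\epsilon_i,\alpha_j\rangle}f_ja_i$; - (R3) $b_ie_j=s^{\langle\epsilon_i,\alpha_j\rangle}e_jb_i$ and $b_if_j=s^{-\langle\epsilon_i,\alpha_j\rangle}f_jb_i$; - (R4) $[e_i,f_j]=\frac{\delta_{ij}}{r-s}(a_ib_{i+1}-a_{i+1}b_i)$; - (R5) $[e_i,e_j]=[f_i,f_j]=0$ if $|i-j|>1$;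 - (R6) $e_i^2e_{i+1}-(r+s)e_ie_{i+1}e_i+rs\,e_{i+1}e_i^2=0$ and $e_ie_{i+1}^2-(r+s)e_{i+1}e_ie_{i+1}+rs\,e_{i+1}^2e_i=0$; - (R7) $f_i^2f_{i+1}-(r^{-1}+s^{-1})f_if_{i+1}f_i+r^{-1}s^{-1}f_{i+1}f_i^2=0$ and $f_if_{i+1}^2-(r^{-1}+s^{-1})f_{i+1}f_if_{i+1}+r^{-1}s^{-1}f_{i+1}^2f_i=0$. **The algebra $U(R)$.** Let $e_{ij}$ be the matrix units of $\mathrm{End}(\mathbb{C}^n)$ and $$R^{(+)}=s\sum_{i}e_{ii}\otimes e_{ii}+rs\sum_{i<j}e_{ii}\otimes e_{jj}+\sum_{i>j}e_{ii}\otimes e_{jj}+(s-r)\sum_{i<j}e_{ij}\otimes e_{ji}.$$ Then $U(R)$ is the unital associative $\mathbb{C}$-algebra generated by $l^+_{ij}$, $l^-_{ji}$ $(1\le i\le j\le n)$ and by inverses of the diagonal elements $l^{\pm}_{ii}$, subject to $$R^{(+)}L_1^{\pm}L_2^{\pm}=L_2^{\pm}L_1^{\pm}R^{(+)},\qquad R^{(+)}L_1^{+}L_2^{-}=L_2^{-}L_1^{+}R^{(+)},$$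 where $L^{\pm}=(l^{\pm}_{ij})$ with $l^+_{ij}=l^-_{ji}=0$ for $i>j$, $L^\pm_1=L^\pm\otimes 1$ and $L^\pm_2=1\otimes L^\pm$. Thus $L^{\pm}$ are invertible triangular matrices. The Gauss generators are defined by $L^+=\mathrm{diag}(K_1^+,\dots,K_n^+)\,(E_{ij})$ with $(E_{ij})$ upper unitriangular, and $L^-=(F_{ij})\,\mathrm{diag}(K_1^-,\dots,K_n^-)$ with $(F_{ij})$ lower unitriangular; that is, $K_i^\pm=l_{ii}^\pm$, $E_{ij}=(l_{ii}^+)^{-1}l^+_{ij}$ and $F_{ij}=l^-_{ij}(l^-_{jj})^{-1}$. **Theorem.** There is an isomorphism of $\mathbb{C}$-algebras $\psi:U_{r,s}(\mathfrak{gl}_n)\to U(R)$ such that, for $1\le j<n$ and $1\le i\le n$, $$\psi(e_j)=\frac{r}{r-s}E_{j,j+1},\qquad \psi(f_j)=\frac{s}{s-r}F_{j+1,j},$$ $$\psi(a_i)=K_i^+\prod_{l=1}^{i-1}\bigl(K^+_{i-l}K^-_{i-l}\bigr)^{(-1)^l},\qquad \psi(b_i)=K_i^-\prod_{l=1}^{i-1}\bigl(K^+_{i-l}K^-_{i-l}\bigr)^{(-1)^l}.$$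 In particular $\psi(a_1)=K_1^+$ and $\psi(b_1)=K_1^-$. -/

import Mathlib

open scoped Kronecker

noncomputable section

namespace TwoParam

/-- The (0-based) index `j` of a simple root, as an element of `Fin n`. -/
def lo {n : ℕ} (j : Fin (n - 1)) : Fin n := ⟨j.val, by omega⟩

/-- The successor `j + 1` of the index of a simple root, as an element of `Fin n`. -/
def hi {n : ℕ} (j : Fin (n - 1)) : Fin n := ⟨j.val + 1, by omega⟩

/-! ### The algebra `U_{r,s}(gl_n)` -/

/-- The vectors `ε_i` of the standard orthonormal basis. -/
def eps {n : ℕ} (i : Fin n) : Fin n → ℤ := Pi.single i 1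

/-- The simple roots `α_j = ε_j - ε_{j+1}`. -/
def alpha {n : ℕ} (j : Fin (n - 1)) : Fin n → ℤ := eps (lo j) - eps (hi j)

/-- The integer `⟨ε_i, α_j⟩`. -/
def pairing {n : ℕ} (i : Fin n) (j : Fin (n - 1)) : ℤ := eps i ⬝ᵥ alpha j

/-- The generators `e_j, f_j, a_i, a_i⁻¹, b_i, b_i⁻¹`. -/
inductive ChevalleyGen (n : ℕ) : Type
  | e (j : Fin (n - 1))
  | f (j : Fin (n - 1))
  | a (i : Fin n)
  | aInv (i : Fin n)
  | b (i : Fin n)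
  | bInv (i : Fin n)

namespace ChevalleyGen

/-- The generators `a_i^{±1}`, `b_i^{±1}`. -/
def IsCartan {n : ℕ} (x : ChevalleyGen n) : Prop :=
  ∃ i, x = a i ∨ x = aInv i ∨ x = b i ∨ x = bInv i

/-- A generator, as an element of the free algebra. -/
def free {n : ℕ} (x : ChevalleyGen n) : FreeAlgebra ℂ (ChevalleyGen n) := FreeAlgebra.ι ℂ x

end ChevalleyGen

open ChevalleyGen in
/-- The defining relations R1 - R7 of `U_{r,s}(gl_n)`. -/
inductive ChevalleyRel (n : ℕ) (r s : ℂ) :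
    FreeAlgebra ℂ (ChevalleyGen n) → FreeAlgebra ℂ (ChevalleyGen n) → Prop
  | r1_comm (x y : ChevalleyGen n) (hx : x.IsCartan) (hy : y.IsCartan) :
      ChevalleyRel n r s (x.free * y.free) (y.free * x.free)
  | r1_a (i : Fin n) : ChevalleyRel n r s ((a i).free * (aInv i).free) 1
  | r1_b (i : Fin n) : ChevalleyRel n r s ((b i).free * (bInv i).free) 1
  | r2_e (i : Fin n) (j : Fin (n - 1)) :
      ChevalleyRel n r s ((a i).free * (e j).free)
        (r ^ pairing i j • ((e j).free * (a i).free))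
  | r2_f (i : Fin n) (j : Fin (n - 1)) :
      ChevalleyRel n r s ((a i).free * (f j).free)
        (r ^ (-pairing i j) • ((f j).free * (a i).free))
  | r3_e (i : Fin n) (j : Fin (n - 1)) :
      ChevalleyRel n r s ((b i).free * (e j).free)
        (s ^ pairing i j • ((e j).free * (b i).free))
  | r3_f (i : Fin n) (j : Fin (n - 1)) :
      ChevalleyRel n r s ((b i).free * (f j).free)
        (s ^ (-pairing i j) • ((f j).free * (b i).free))
  | r4 (i j : Fin (n - 1)) :
      ChevalleyRel n r s ((e i).free * (f j).free - (f j).free * (e i).free)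
        (((if i = j then 1 else 0) / (r - s)) •
          ((a (lo i)).free * (b (hi i)).free - (a (hi i)).free * (b (lo i)).free))
  | r5_e (i j : Fin (n - 1)) (h : 1 < |(i.val : ℤ) - (j.val : ℤ)|) :
      ChevalleyRel n r s ((e i).free * (e j).free - (e j).free * (e i).free) 0
  | r5_f (i j : Fin (n - 1)) (h : 1 < |(i.val : ℤ) - (j.val : ℤ)|) :
      ChevalleyRel n r s ((f i).free * (f j).free - (f j).free * (f i).free) 0
  | r6_left (i j : Fin (n - 1)) (h : j.val = i.val + 1) :
      ChevalleyRel n r s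
        ((e i).free ^ 2 * (e j).free - (r + s) • ((e i).free * (e j).free * (e i).free)
          + (r * s) • ((e j).free * (e i).free ^ 2)) 0
  | r6_right (i j : Fin (n - 1)) (h : j.val = i.val + 1) :
      ChevalleyRel n r s
        ((e i).free * (e j).free ^ 2 - (r + s) • ((e j).free * (e i).free * (e j).free)
          + (r * s) • ((e j).free ^ 2 * (e i).free)) 0
  | r7_left (i j : Fin (n - 1)) (h : j.val = i.val + 1) :
      ChevalleyRel n r s
        ((f i).free ^ 2 * (f j).free
          - (r⁻¹ + s⁻¹) • ((f i).free * (f j).free * (f i).free)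
          + (r⁻¹ * s⁻¹) • ((f j).free * (f i).free ^ 2)) 0
  | r7_right (i j : Fin (n - 1)) (h : j.val = i.val + 1) :
      ChevalleyRel n r s
        ((f i).free * (f j).free ^ 2
          - (r⁻¹ + s⁻¹) • ((f j).free * (f i).free * (f j).free)
          + (r⁻¹ * s⁻¹) • ((f j).free ^ 2 * (f i).free)) 0

/-- The two-parameter quantum group `U_{r,s}(gl_n)`. -/
abbrev Urs (n : ℕ) (r s : ℂ) : Type := RingQuot (ChevalleyRel n r s)

namespace Urs

/-- The class of a generator in `U_{r,s}(gl_n)`. -/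
def gen {n : ℕ} (r s : ℂ) (x : ChevalleyGen n) : Urs n r s :=
  RingQuot.mkAlgHom ℂ (ChevalleyRel n r s) x.free

end Urs

/-! ### The algebra `U(R)` -/

/-- The matrix `R⁽⁺⁾ ∈ End(V ⊗ V)`, `V = ℂⁿ`:
`s ∑ e_ii ⊗ e_ii + rs ∑_{i<j} e_ii ⊗ e_jj + ∑_{i>j} e_ii ⊗ e_jj + (s-r) ∑_{i<j} e_ij ⊗ e_ji`. -/
def RPlus (n : ℕ) (r s : ℂ) : Matrix (Fin n × Fin n) (Fin n × Fin n) ℂ :=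
  s • ∑ i : Fin n, Matrix.single i i (1 : ℂ) ⊗ₖ Matrix.single i i (1 : ℂ)
  + (r * s) • ∑ i : Fin n, ∑ j : Fin n,
      (if i < j then Matrix.single i i (1 : ℂ) ⊗ₖ Matrix.single j j (1 : ℂ) else 0)
  + ∑ i : Fin n, ∑ j : Fin n,
      (if j < i then Matrix.single i i (1 : ℂ) ⊗ₖ Matrix.single j j (1 : ℂ) else 0)
  + (s - r) • ∑ i : Fin n, ∑ j : Fin n,
      (if i < j then Matrix.single i j (1 : ℂ) ⊗ₖ Matrix.single j i (1 : ℂ) else 0)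

/-- The generators of `U(R)`: `lp i j` is `l⁺_{ij}` and `lm j i` is `l⁻_{ji}` for `i ≤ j`.
The invertibility of the triangular matrices `L^±`, as triangular matrices, amounts to the
invertibility of their diagonal entries; `lpInv i` and `lmInv i` are the inverses of `l⁺_{ii}`
and `l⁻_{ii}`. -/
inductive FRTGen (n : ℕ) : Type
  | lp (i j : Fin n) (h : i ≤ j)
  | lm (j i : Fin n) (h : i ≤ j)
  | lpInv (i : Fin n)
  | lmInv (i : Fin n)

/-- The upper triangular matrix `L⁺` over the free algebra. -/
def freeLp (n : ℕ) : Matrix (Fin n) (Fin n) (FreeAlgebra ℂ (FRTGen n)) :=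
  Matrix.of fun i j => if h : i ≤ j then FreeAlgebra.ι ℂ (FRTGen.lp i j h) else 0

/-- The lower triangular matrix `L⁻` over the free algebra. -/
def freeLm (n : ℕ) : Matrix (Fin n) (Fin n) (FreeAlgebra ℂ (FRTGen n)) :=
  Matrix.of fun i j => if h : j ≤ i then FreeAlgebra.ι ℂ (FRTGen.lm i j h) else 0

/-- `L_1 = L ⊗ 1`. -/
def leg1 {n : ℕ} {A : Type} [Ring A] (L : Matrix (Fin n) (Fin n) A) :
    Matrix (Fin n × Fin n) (Fin n × Fin n) A := L ⊗ₖ (1 : Matrix (Fin n) (Fin n) A)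

/-- `L_2 = 1 ⊗ L`. -/
def leg2 {n : ℕ} {A : Type} [Ring A] (L : Matrix (Fin n) (Fin n) A) :
    Matrix (Fin n × Fin n) (Fin n × Fin n) A := (1 : Matrix (Fin n) (Fin n) A) ⊗ₖ L

/-- The scalar matrix `R⁽⁺⁾` over the free algebra. -/
def freeR (n : ℕ) (r s : ℂ) :
    Matrix (Fin n × Fin n) (Fin n × Fin n) (FreeAlgebra ℂ (FRTGen n)) :=
  (RPlus n r s).map (algebraMap ℂ (FreeAlgebra ℂ (FRTGen n)))

/-- The defining relations of `U(R)`: `R⁽⁺⁾ L^±_1 L^±_2 = L^±_2 L^±_1 R⁽⁺⁾` and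
`R⁽⁺⁾ L⁺_1 L⁻_2 = L⁻_2 L⁺_1 R⁽⁺⁾`, entry by entry, and the invertibility of `L^±`. -/
inductive FRTRel (n : ℕ) (r s : ℂ) :
    FreeAlgebra ℂ (FRTGen n) → FreeAlgebra ℂ (FRTGen n) → Prop
  | pp (p q : Fin n × Fin n) :
      FRTRel n r s ((freeR n r s * leg1 (freeLp n) * leg2 (freeLp n)) p q)
        ((leg2 (freeLp n) * leg1 (freeLp n) * freeR n r s) p q)
  | mm (p q : Fin n × Fin n) :
      FRTRel n r s ((freeR n r s * leg1 (freeLm n) * leg2 (freeLm n)) p q)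
        ((leg2 (freeLm n) * leg1 (freeLm n) * freeR n r s) p q)
  | pm (p q : Fin n × Fin n) :
      FRTRel n r s ((freeR n r s * leg1 (freeLp n) * leg2 (freeLm n)) p q)
        ((leg2 (freeLm n) * leg1 (freeLp n) * freeR n r s) p q)
  | lp_inv (i : Fin n) :
      FRTRel n r s (freeLp n i i * FreeAlgebra.ι ℂ (FRTGen.lpInv i)) 1
  | inv_lp (i : Fin n) :
      FRTRel n r s (FreeAlgebra.ι ℂ (FRTGen.lpInv i) * freeLp n i i) 1
  | lm_inv (i : Fin n) :
      FRTRel n r s (freeLm n i i * FreeAlgebra.ι ℂ (FRTGen.lmInv i)) 1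
  | inv_lm (i : Fin n) :
      FRTRel n r s (FreeAlgebra.ι ℂ (FRTGen.lmInv i) * freeLm n i i) 1

/-- The FRT algebra `U(R)`. -/
abbrev UR (n : ℕ) (r s : ℂ) : Type := RingQuot (FRTRel n r s)

namespace UR

variable {n : ℕ} (r s : ℂ)

/-- The quotient map from the free algebra onto `U(R)`. -/
def mk (n : ℕ) (r s : ℂ) : FreeAlgebra ℂ (FRTGen n) →ₐ[ℂ] UR n r s :=
  RingQuot.mkAlgHom ℂ (FRTRel n r s)

/-- The matrix `L⁺` over `U(R)`. -/
def Lp (n : ℕ) (r s : ℂ) : Matrix (Fin n) (Fin n) (UR n r s) := (freeLp n).map (mk n r s)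

/-- The matrix `L⁻` over `U(R)`. -/
def Lm (n : ℕ) (r s : ℂ) : Matrix (Fin n) (Fin n) (UR n r s) := (freeLm n).map (mk n r s)

/-- The Gauss generator `K⁺_i`, a unit of `U(R)`. -/
def Kp (i : Fin n) : (UR n r s)ˣ where
  val := Lp n r s i i
  inv := mk n r s (FreeAlgebra.ι ℂ (FRTGen.lpInv i))
  val_inv := by
    simpa [Lp, mk] using RingQuot.mkAlgHom_rel ℂ (FRTRel.lp_inv (r := r) (s := s) i)
  inv_val := by
    simpa [Lp, mk] using RingQuot.mkAlgHom_rel ℂ (FRTRel.inv_lp (r := r) (s := s) i)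

/-- The Gauss generator `K⁻_i`, a unit of `U(R)`. -/
def Km (i : Fin n) : (UR n r s)ˣ where
  val := Lm n r s i i
  inv := mk n r s (FreeAlgebra.ι ℂ (FRTGen.lmInv i))
  val_inv := by
    simpa [Lm, mk] using RingQuot.mkAlgHom_rel ℂ (FRTRel.lm_inv (r := r) (s := s) i)
  inv_val := by
    simpa [Lm, mk] using RingQuot.mkAlgHom_rel ℂ (FRTRel.inv_lm (r := r) (s := s) i)

/-- The entries of the unipotent factor `E` of the Gauss decomposition `L⁺ = K⁺ E`. -/
def E (i j : Fin n) : UR n r s := ↑(Kp r s i)⁻¹ * Lp n r s i j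

/-- The entries of the unipotent factor `F` of the Gauss decomposition `L⁻ = F K⁻`. -/
def F (i j : Fin n) : UR n r s := Lm n r s i j * ↑(Km r s j)⁻¹

/-- The Gauss decomposition of `L⁺`, with `E` unipotent upper triangular. -/
theorem gauss_plus :
    Lp n r s = Matrix.diagonal (fun i => (Kp r s i : UR n r s)) * Matrix.of (E r s) ∧
      (∀ i : Fin n, E r s i i = 1) ∧ ∀ i j : Fin n, j < i → E r s i j = 0 := by
  refine ⟨?_, fun i => (Kp r s i).inv_mul, fun i j h => ?_⟩
  · ext i j
    simp [Matrix.diagonal_mul, E]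
  · simp [E, Lp, freeLp, not_le.mpr h]

/-- The Gauss decomposition of `L⁻`, with `F` unipotent lower triangular. -/
theorem gauss_minus :
    Lm n r s = Matrix.of (F r s) * Matrix.diagonal (fun i => (Km r s i : UR n r s)) ∧
      (∀ i : Fin n, F r s i i = 1) ∧ ∀ i j : Fin n, i < j → F r s i j = 0 := by
  refine ⟨?_, fun i => (Km r s i).mul_inv, fun i j h => ?_⟩
  · ext i j
    simp [Matrix.mul_diagonal, F]
  · simp [F, Lm, freeLm, not_le.mpr h]

/-- The product `∏_{l=1}^{i-1} (K⁺_{i-l} K⁻_{i-l})^{(-1)^l}`, in increasing order of `l`.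
With `i` counted from `0`, the index `l` runs over `1, …, i`. -/
def altProd (i : Fin n) : (UR n r s)ˣ :=
  (List.ofFn fun l : Fin i.val =>
    (Kp r s ⟨i.val - (l.val + 1), by omega⟩ * Km r s ⟨i.val - (l.val + 1), by omega⟩) ^
      ((-1 : ℤ) ^ (l.val + 1))).prod

end UR

end TwoParam

end

/-! Both algebras have the same description in Gauss generators, and the proof passes between the
two presentations through it. Put `P_i = ∏_{m<i} a_m b_m`, `K⁺_i = a_i P_i` and `K⁻_i = b_i P_i`.
Then `a_{i+1} b_i` and `a_i b_{i+1}` are the ratios of consecutive `K⁺` and of consecutive `K⁻`, and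
R1 - R7 give the relations collected in `QuantumGL`. Since `K⁺_i K⁻_i = P_i P_{i+1}`, the inverse of
`P_i` is the alternating product of the theorem; this is where the formulas for `ψ(a_i)` and
`ψ(b_i)` come from.

For the map from `U(R)`, matrices must be built from Chevalley generators. The entries of `L⁺` have
to obey `l_{i,m+1} = l_{im} e_m - s e_m l_{im}`, which defines `upper`; similarly `lower` for `L⁻`.
To prove the RTT relations, fix an entry `y_{jl}` of the second matrix: the relation then says that
a row operator and a column operator attached to `y_{jl}` agree on the first matrix. Both operators
obey the same recursion as `y_{jl}` itself, so by `intertwine_step` agreement spreads from the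
diagonal entries and the root vectors to all entries. The input is the commutation of `e_j` and
`f_j` with every entry of `upper` (`upper_e`, `upper_f`); `upper_e` rests on the Serre relations and
on the invertibility of `r + s`.

For the map to `U(R)`, the relations of `QuantumGL` are read off from single entries of the RTT
relations (`GaussHalf.borel`, `GaussPair.e_f`). The recursion defining `upper` also holds for `L⁺`
(`GaussHalf.succ`), so `L±` are determined by their diagonals and root vectors. The two maps are
therefore inverse to each other on generators, and no basis of either algebra is needed.

Transposing matrices and passing to the opposite algebra exchanges `r` with `s` and lower with upper
triangular matrices, so only the positive half is treated directly. Indices run over `ℕ` from `0`,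
and everything out of range is zero, which keeps the recursions free of boundary conditions. -/

namespace TwoParam
open MulOpposite

set_option linter.unusedSimpArgs false
set_option linter.unusedTactic false
set_option linter.unreachableTactic false
set_option linter.unusedVariables false

section
variable {A : Type*} [Ring A] [Algebra ℂ A]

/-! ### Entrywise form of the RTT relations

Matrices are indexed by `ℕ` and extended by zero. -/

/-- The scalar `1`, `q`, `t` according to whether `i < j`, `i = j`, `i > j`. -/
def dg (q t : ℂ) (i j : ℕ) : ℂ := if i < j then 1 else if i = j then q else t

theorem dg_ne_zero {q t : ℂ} (hq : q ≠ 0) (ht : t ≠ 0) (i j : ℕ) : dg q t i j ≠ 0 := by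
  unfold dg; split_ifs <;> simp [*]

/-- The relation `R x₁ y₂ = y₂ x₁ R`, entry by entry. -/
def RTT (r s : ℂ) (x y : ℕ → ℕ → A) : Prop := ∀ i j k l,
  dg s (r * s) j i • (x i k * y j l) + (if i < j then (s - r) • (x j k * y i l) else 0) =
    dg s (r * s) l k • (y j l * x i k) + (if l < k then (s - r) • (y j k * x i l) else 0)

/-- The relation `x₁ y₂ R⁻¹ = R⁻¹ y₂ x₁`, entry by entry. -/
def RTTInv (r s : ℂ) (x y : ℕ → ℕ → A) : Prop := ∀ i j k l,
  dg r (r * s) k l • (x i k * y j l) + (if l < k then (r - s) • (x i l * y j k) else 0) =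
    dg r (r * s) i j • (y j l * x i k) + (if i < j then (r - s) • (y i l * x j k) else 0)

theorem RTT.inv {r s : ℂ} (hr : r ≠ 0) (hs : s ≠ 0) {x y : ℕ → ℕ → A} (h : RTT r s x y) :
    RTTInv r s x y := by
  intro i j k l
  -- This is multiplication by `R⁻¹` on both sides. The coefficients are the entries of `r s R⁻¹`,
  -- which occurs twice, and `(r s)⁻¹` removes the superfluous scalar.
  linear_combination (norm := skip)
    ((r * s)⁻¹ * (dg r (r * s) i j * dg r (r * s) k l)) • h i j k l
    + ((r * s)⁻¹ * ((if i < j then r - s else 0) * dg r (r * s) k l)) • h j i k l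
    + ((r * s)⁻¹ * (dg r (r * s) i j * (if l < k then r - s else 0))) • h i j l k
    + ((r * s)⁻¹ * ((if i < j then r - s else 0) * (if l < k then r - s else 0))) • h j i l k
  rcases lt_trichotomy i j with hij | rfl | hij <;> rcases lt_trichotomy k l with hkl | rfl | hkl <;>
  simp only [dg, *, lt_irrefl, if_true, if_false, not_lt_of_gt, ne_of_lt, ne_of_gt, smul_add,
    mul_zero, zero_mul, zero_smul] <;>
  match_scalars <;> field_simp <;> ring

/-- Exchanging `r` and `s` turns the entries of `R` into those of `r s R⁻¹`, with the off-diagonal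
sign reversed accordingly. This reduces lower triangular matrices to upper triangular ones. -/
theorem RTT.transpose_op {r s : ℂ} {x y : ℕ → ℕ → A} (h : RTT r s x y) :
    RTTInv s r (fun i j => op (y j i)) (fun i j => op (x j i)) := by
  intro i j k l
  have e := congrArg op (h l k j i)
  rw [mul_comm s r]
  split_ifs at e ⊢ <;> simpa using e

theorem RTTInv.of_transpose_op {r s : ℂ} {x y : ℕ → ℕ → A}
    (h : RTTInv s r (fun i j => op (y j i)) (fun i j => op (x j i))) : RTT r s x y := by
  intro i j k l
  have e := congrArg MulOpposite.unop (h l k j i)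
  rw [mul_comm s r] at e
  split_ifs at e ⊢ <;> simpa using e

theorem RTTInv.transpose_op {r s : ℂ} {x y : ℕ → ℕ → A} (h : RTTInv r s x y) :
    RTT s r (fun i j => op (y j i)) (fun i j => op (x j i)) := by
  intro i j k l
  have e := congrArg op (h l k j i)
  rw [mul_comm s r]
  split_ifs at e ⊢ <;> simpa using e

theorem RTTInv.rtt {r s : ℂ} (hr : r ≠ 0) (hs : s ≠ 0) {x y : ℕ → ℕ → A}
    (h : RTTInv r s x y) : RTT r s x y :=
  (RTT.inv hs hr h.transpose_op).of_transpose_op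

end

noncomputable section

variable {A : Type*} [Ring A] [Algebra ℂ A]

/-! ### Half of the quantum group -/

/-- The weight of the Cartan element `K_i` on the root vector `e_j`. -/
def wt (r s : ℂ) (i j : ℕ) : ℂ := if i = j then r else if i = j + 1 then s else 1

/-- The weight of `K_{i+1} K_i⁻¹` on the root vector `e_j`. -/
def hwt (r s : ℂ) (i j : ℕ) : ℂ :=
  if i = j then s * r⁻¹ else if i = j + 1 then s⁻¹ else if i + 1 = j then r else 1

/-- The factor picked up by an entry of `upper` in column `m` when it moves past `e_j`. -/
def colWt (r s : ℂ) (j m : ℕ) : ℂ := if m = j then s else if m = j + 1 then r else 1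

/-- The relations among the Cartan elements `k i`, the ratios `h i` of consecutive ones and the
positive root vectors `e j`. -/
structure Borel (r s : ℂ) (k h e : ℕ → A) : Prop where
  k_comm : ∀ i j, k i * k j = k j * k i
  h_comm : ∀ i j, h i * k j = k j * h i
  k_h : ∀ j, k j * h j = k (j + 1)
  k_e : ∀ i j, k i * e j = wt r s i j • (e j * k i)
  h_e : ∀ i j, h i * e j = hwt r s i j • (e j * h i)
  e_comm : ∀ i j, i + 1 < j → e i * e j = e j * e i
  serre_left : ∀ i, e i * (e i * e (i + 1)) - (r + s) • (e i * (e (i + 1) * e i))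
    + (r * s) • (e (i + 1) * (e i * e i)) = 0
  serre_right : ∀ i, e i * (e (i + 1) * e (i + 1)) - (r + s) • (e (i + 1) * (e i * e (i + 1)))
    + (r * s) • (e (i + 1) * (e (i + 1) * e i)) = 0

/-- The upper triangular matrix with diagonal `k`, generated by the root vectors `e`. -/
def upper (s : ℂ) (k e : ℕ → A) (i : ℕ) : ℕ → A
  | 0 => if i = 0 then k 0 else 0
  | m + 1 => if i = m + 1 then k i else upper s k e i m * e m - s • (e m * upper s k e i m)

section
variable (s : ℂ) (k e : ℕ → A)

theorem upper_self (i : ℕ) : upper s k e i i = k i := by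
  cases i <;> simp [upper]

theorem upper_of_lt {i j : ℕ} (h : j < i) : upper s k e i j = 0 := by
  induction j with
  | zero => simp [upper, h.ne']
  | succ m ih => simp [upper, h.ne', ih (by omega)]

theorem upper_succ {i m : ℕ} (h : i ≤ m) :
    upper s k e i (m + 1) = upper s k e i m * e m - s • (e m * upper s k e i m) := by
  simp [upper, show i ≠ m + 1 by omega]

theorem upper_map {B : Type*} [Ring B] [Algebra ℂ B] (φ : A →ₐ[ℂ] B) (i j : ℕ) :
    φ (upper s k e i j) = upper s (fun i => φ (k i)) (fun i => φ (e i)) i j := by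
  induction j with
  | zero => simp only [upper]; split_ifs <;> simp
  | succ m ih => simp only [upper]; split_ifs <;> simp [ih]

/-- A matrix satisfying the recursion of `upper` equals it. -/
theorem eq_upper {x : ℕ → ℕ → A} (h0 : ∀ i j, j < i → x i j = 0) (h1 : ∀ i, x i i = k i)
    (h2 : ∀ i m, i ≤ m → x i (m + 1) = x i m * e m - s • (e m * x i m)) (i j : ℕ) :
    x i j = upper s k e i j := by
  rcases lt_or_ge j i with h | h
  · rw [h0 _ _ h, upper_of_lt _ _ _ h]
  · induction j, h using Nat.le_induction with
    | base => rw [h1, upper_self]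
    | succ m hm ih => rw [h2 _ _ hm, upper_succ _ _ _ hm, ih]

/-- An element acting on the root vectors by weights acts on `upper` by weights. -/
theorem upper_weight {c : ℕ → ℂ} (hc : ∀ m, c m ≠ 0) {z : A} (hz : ∀ i, k i * z = z * k i)
    (hw : ∀ m, c m • (z * e m) = c (m + 1) • (e m * z)) (i j : ℕ) :
    c j • (upper s k e i j * z) = c i • (z * upper s k e i j) := by
  rcases lt_or_ge j i with h | h
  · simp [upper_of_lt _ _ _ h]
  · induction j, h using Nat.le_induction with
    | base => rw [upper_self, hz]
    | succ m hm ih =>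
      rw [upper_succ _ _ _ hm]
      have := hc m
      generalize upper s k e i m = x at *
      have hw := hw m
      linear_combination (norm := skip) (-1 : ℂ) • (x * hw) + ih * e m
        - (s * c (m + 1) * (c m)⁻¹) • (e m * ih) + (s * c i * (c m)⁻¹) • (hw * x)
      simp only [mul_add, add_mul, mul_sub, sub_mul, smul_mul_assoc, mul_smul_comm, smul_smul,
        mul_assoc, smul_add, smul_sub, smul_zero, mul_zero, zero_mul]
      match_scalars <;> first | ring1 | (field_simp; ring1) | field_simp

end

/-! ### Commutation of Cartan elements and root vectors with the entries of `upper` -/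

namespace Borel
variable {r s : ℂ} {k h e : ℕ → A}

/-- The scalar `dg s (r * s) m l` is the running product of the weights of `k l`: passing from `m`
to `m + 1` multiplies it by `wt r s l m`. Hence the diagonal of `R` appears here. -/
theorem upper_k (B : Borel r s k h e) (hr : r ≠ 0) (hs : s ≠ 0) (i j l : ℕ) :
    dg s (r * s) j l • (upper s k e i j * k l) = dg s (r * s) i l • (k l * upper s k e i j) := by
  refine upper_weight s k e (c := fun m => dg s (r * s) m l)
    (fun m => dg_ne_zero hs (mul_ne_zero hr hs) _ _) (fun i => B.k_comm _ _) (fun m => ?_) i j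
  rw [B.k_e, smul_smul]
  congr 1
  simp only [wt, dg]
  split_ifs <;> first | omega | ring1

theorem upper_h (B : Borel r s k h e) (hr : r ≠ 0) (hs : s ≠ 0) (i j l : ℕ) :
    (if j = l then s⁻¹ else if j = l + 1 then r⁻¹ else 1 : ℂ) • (upper s k e i j * h l) =
      (if i = l then s⁻¹ else if i = l + 1 then r⁻¹ else 1 : ℂ) • (h l * upper s k e i j) := by
  refine upper_weight s k e (c := fun m => if m = l then s⁻¹ else if m = l + 1 then r⁻¹ else 1)
    (fun m => ?_) (fun i => (B.h_comm _ _).symm) (fun m => ?_) i j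
  · split_ifs <;> simp [hr, hs]
  rw [B.h_e, smul_smul]
  congr 1
  simp only [hwt]
  split_ifs <;> first | omega | field_simp

/-- `e_j` commutes with the entries in rows and columns up to `j - 1`. -/
theorem upper_e_of_lt (B : Borel r s k h e) {i m j : ℕ} (hm : m < j) :
    upper s k e i m * e j = e j * upper s k e i m := by
  rcases lt_or_ge m i with h | h
  · simp [upper_of_lt _ _ _ h]
  · induction m, h using Nat.le_induction with
    | base =>
      rw [upper_self, B.k_e]
      simp [wt, show i ≠ j by omega, show i ≠ j + 1 by omega]
    | succ m hi ih =>
      rw [upper_succ _ _ _ hi]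
      have ih := ih (by omega)
      have he := B.e_comm m j hm
      generalize upper s k e i m = x at *
      linear_combination (norm := skip) x * he + ih * e m - s • (he * x) - s • (e m * ih)
      simp only [mul_add, add_mul, mul_sub, sub_mul, smul_mul_assoc, mul_smul_comm, smul_smul,
        mul_assoc, smul_add, smul_sub, smul_zero, mul_zero, zero_mul]
      match_scalars <;> first | ring1 | (field_simp; ring1) | field_simp

/-- The Serre relation between an entry in column `j` and `e_j`. -/
theorem upper_serre (B : Borel r s k h e) {i j : ℕ} (hi : i ≤ j) :
    upper s k e i j * (e j * e j) - (r + s) • (e j * (upper s k e i j * e j))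
      + (r * s) • (e j * (e j * upper s k e i j)) = 0 := by
  rcases hi.eq_or_lt with rfl | hi
  -- On the diagonal the left-hand side is `T e - s e T` with `T = k e - r e k`, and `T` vanishes.
  · rw [upper_self]
    have hk := B.k_e i i
    simp only [wt, if_true] at hk
    linear_combination (norm := skip) hk * e i - s • (e i * hk)
    simp only [mul_add, add_mul, mul_sub, sub_mul, smul_mul_assoc, mul_smul_comm, smul_smul,
      mul_assoc, smul_add, smul_sub, smul_zero, mul_zero, zero_mul]
    match_scalars <;> first | ring1 | (field_simp; ring1) | field_simp
  -- Off the diagonal the entry is `x e_m - s e_m x`, where `x` lies in column `m` and commutes with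
  -- `e_{m+1}`. The claim is thus `serre_right` multiplied by `x` from the two sides.
  · obtain ⟨m, rfl⟩ : ∃ m, j = m + 1 := ⟨j - 1, by omega⟩
    rw [upper_succ _ _ _ (by omega)]
    have hc := B.upper_e_of_lt (i := i) (m := m) (j := m + 1) (by omega)
    have hS := B.serre_right m
    generalize upper s k e i m = x at *
    generalize e (m + 1) = e' at *
    generalize e m = f at *
    linear_combination (norm := skip) x * hS - s • (hS * x) 
      - s • (f * (hc * e' + e' * hc)) + (s * (r + s)) • (e' * f * hc) + (r + s) • (hc * f * e')
      - (r * s) • ((hc * e' + e' * hc) * f) 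
    simp only [mul_add, add_mul, mul_sub, sub_mul, smul_mul_assoc, mul_smul_comm, smul_smul,
      mul_assoc, smul_add, smul_sub, smul_zero, mul_zero, zero_mul]
    match_scalars <;> first | ring1 | (field_simp; ring1) | field_simp

/-- `e_j` and the entries in column `j + 1`. -/
theorem upper_e_succ (B : Borel r s k h e) {i j : ℕ} (hi : i ≤ j) :
    upper s k e i (j + 1) * e j = r • (e j * upper s k e i (j + 1)) := by
  -- For `x` in column `j`, the relation `upper_serre` factors as `(x e - s e x) e = r e (x e - s e
  -- x)`.
  have hS := B.upper_serre hi
  rw [upper_succ _ _ _ hi]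
  generalize upper s k e i j = x at *
  linear_combination (norm := skip) hS
  simp only [mul_add, add_mul, mul_sub, sub_mul, smul_mul_assoc, mul_smul_comm, smul_smul,
    mul_assoc, smul_add, smul_sub, smul_zero, mul_zero, zero_mul]
  match_scalars <;> first | ring1 | (field_simp; ring1) | field_simp

/-- The entry `x` in column `j` behaves like a root vector to the left of `e_j`: it commutes with
`e_{j+1}` and satisfies a Serre relation with `e_j`. In such a chain of three the middle element
commutes with the iterated commutator. The two Serre relations give only `r + s` times this
identity, and here `r + s` has to be inverted. -/
theorem upper_e_add_two (B : Borel r s k h e) (hr : r ≠ 0) (hrs : r + s ≠ 0) {i j : ℕ} (hi : i ≤ j) :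
    upper s k e i (j + 2) * e j = e j * upper s k e i (j + 2) := by
  have hc := B.upper_e_of_lt (i := i) (m := j) (j := j + 1) (by omega)
  have hS := B.upper_serre hi
  have hS' := B.serre_left j
  rw [upper_succ _ _ _ (by omega : i ≤ j + 1), upper_succ _ _ _ hi]
  generalize upper s k e i j = x at *
  generalize e (j + 1) = f at *
  generalize e j = g at *
  linear_combination (norm := skip) (r + s)⁻¹ • (s ^ 2 • (hS' * x) - x * hS' 
    + hS * f - s ^ 2 • (f * hS) + (r * s) • (hc * g * g) + s ^ 2 • (g * g * hc)) - s • (g * hc * g)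
  simp only [mul_add, add_mul, mul_sub, sub_mul, smul_mul_assoc, mul_smul_comm, smul_smul,
    mul_assoc, smul_add, smul_sub, smul_zero, mul_zero, zero_mul]
  match_scalars <;> first | ring1 | (field_simp; ring1) | field_simp

/-- `e_j` commutes with the entries in rows up to `j` and columns from `j + 2`. -/
theorem upper_e_of_gt (B : Borel r s k h e) (hr : r ≠ 0) (hrs : r + s ≠ 0) {i j m : ℕ}
    (hi : i ≤ j) (hm : j + 2 ≤ m) :
    upper s k e i m * e j = e j * upper s k e i m := by
  induction m, hm using Nat.le_induction with
  | base => exact B.upper_e_add_two hr hrs hi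
  | succ m hm ih =>
    rw [upper_succ _ _ _ (by omega)]
    have he := B.e_comm j m hm
    generalize upper s k e i m = x at *
    linear_combination (norm := skip) s • (he * x) - x * he + ih * e m - s • (e m * ih)
    simp only [mul_add, add_mul, mul_sub, sub_mul, smul_mul_assoc, mul_smul_comm, smul_smul,
      mul_assoc, smul_add, smul_sub, smul_zero, mul_zero, zero_mul]
    match_scalars <;> first | ring1 | (field_simp; ring1) | field_simp

/-- `e_j` commutes with the entries in rows from `j + 2`. -/
theorem upper_e_of_row_gt (B : Borel r s k h e) {i j m : ℕ} (hi : j + 2 ≤ i) :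
    upper s k e i m * e j = e j * upper s k e i m := by
  rcases lt_or_ge m i with h | h
  · simp [upper_of_lt _ _ _ h]
  · induction m, h using Nat.le_induction with
    | base =>
      rw [upper_self, B.k_e]
      simp [wt, show i ≠ j by omega, show i ≠ j + 1 by omega]
    | succ m hm ih =>
      rw [upper_succ _ _ _ hm]
      have he := B.e_comm j m (by omega)
      generalize upper s k e i m = x at *
      linear_combination (norm := skip) s • (he * x) - x * he + ih * e m - s • (e m * ih)
      simp only [mul_add, add_mul, mul_sub, sub_mul, smul_mul_assoc, mul_smul_comm, smul_smul,
        mul_assoc, smul_add, smul_sub, smul_zero, mul_zero, zero_mul]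
      match_scalars <;> first | ring1 | (field_simp; ring1) | field_simp

/-- `e_j` and the entries in row `j + 1`, off the diagonal. -/
theorem upper_e_row_succ (B : Borel r s k h e) (hr : r ≠ 0) (hs : s ≠ 0) {j m : ℕ}
    (hm : j + 2 ≤ m) :
    upper s k e (j + 1) m * e j = e j * upper s k e (j + 1) m - upper s k e j m * h j := by
  induction m, hm using Nat.le_induction with
  | base =>
    rw [upper_succ _ _ _ (le_refl (j + 1)), upper_succ _ _ _ (by omega : j ≤ j + 1),
      upper_succ _ _ _ (le_refl j), upper_self, upper_self]
    have h1 := B.k_e (j + 1) j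
    have h2 := B.k_e (j + 1) (j + 1)
    have h3 := B.k_e j j
    have h4 := B.k_e j (j + 1)
    have h7 := B.k_h j
    simp only [wt, if_true, if_false, Nat.succ_ne_self, show j ≠ j + 1 by omega,
      show j ≠ j + 1 + 1 by omega, one_smul] at h1 h2 h3 h4
    generalize e (j + 1) = f at *
    generalize e j = g at *
    generalize k (j + 1) = K at *
    linear_combination (norm := skip) h2 * g + (r - s) • (f * h1) - g * h2
      + (h3 * f + (r - s) • (g * h4) - s • (f * h3)) * h j + (r - s) • ((g * f - s • (f * g)) * h7)
    simp only [mul_add, add_mul, mul_sub, sub_mul, smul_mul_assoc, mul_smul_comm, smul_smul,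
      mul_assoc, smul_add, smul_sub, smul_zero, mul_zero, zero_mul]
    match_scalars <;> first | ring1 | (field_simp; ring1) | field_simp
  | succ m hm ih =>
    rw [upper_succ _ _ _ (by omega), upper_succ _ _ _ (by omega)]
    have he := B.e_comm j m hm
    -- For `m ≥ j + 2` the element `h j` commutes with `e m`, so the correction term `u_{jm} h_j`
    -- obeys the same column recursion as the entries.
    have hh := B.h_e j m
    simp only [hwt, show j ≠ m by omega, show j ≠ m + 1 by omega, show j + 1 ≠ m by omega,
      if_false, one_smul] at hh
    generalize upper s k e (j + 1) m = x at *
    generalize upper s k e j m = y at *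
    linear_combination (norm := skip) s • (he * x) - x * he + ih * e m - s • (e m * ih) - y * hh
    simp only [mul_add, add_mul, mul_sub, sub_mul, smul_mul_assoc, mul_smul_comm, smul_smul,
      mul_assoc, smul_add, smul_sub, smul_zero, mul_zero, zero_mul]
    match_scalars <;> first | ring1 | (field_simp; ring1) | field_simp

/-- The commutation relations of `e_j` with all entries of `upper`. -/
theorem upper_e (B : Borel r s k h e) (hr : r ≠ 0) (hs : s ≠ 0) (hrs : r + s ≠ 0) (i m j : ℕ) :
    upper s k e i m * e j = colWt r s j m • (e j * upper s k e i m)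
      + (if m = j then upper s k e i (j + 1) else 0)
      - (if i = j + 1 then upper s k e j m * h j else 0) := by
  unfold colWt
  rcases lt_or_ge m i with hi | hi
  · rw [upper_of_lt _ _ _ hi]
    rcases eq_or_ne m j with rfl | hm
    · rcases eq_or_ne i (m + 1) with rfl | hi'
      · simp [upper_self, B.k_h]
      · simp [upper_of_lt _ _ _ (show m + 1 < i by omega), hi']
    · rcases eq_or_ne i (j + 1) with rfl | hi'
      · simp [upper_of_lt _ _ _ (show m < j by omega), hm]
      · simp [hm, hi']
  rcases lt_trichotomy i (j + 1) with hij | rfl | hij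
  · rw [if_neg hij.ne]
    rcases lt_trichotomy m j with hm | rfl | hm
    · rw [B.upper_e_of_lt hm]
      simp [hm.ne, show m ≠ j + 1 by omega]
    · rw [if_pos rfl, if_pos rfl, upper_succ _ _ _ hi]
      abel
    · obtain rfl | hm : m = j + 1 ∨ j + 2 ≤ m := by omega
      · rw [B.upper_e_succ (by omega)]
        simp
      · rw [B.upper_e_of_gt hr hrs (by omega) hm]
        simp [show m ≠ j by omega, show m ≠ j + 1 by omega]
  · obtain rfl | hm : m = j + 1 ∨ j + 2 ≤ m := by omega
    · have h1 := B.k_e (j + 1) j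
      have h2 := B.k_e j j
      have h3 := B.k_h j
      have h4 := B.h_e j j
      rw [upper_succ _ _ _ le_rfl, upper_self, upper_self]
      simp only [wt, hwt, if_true, if_false, Nat.succ_ne_self] at *
      generalize e j = g at *
      generalize k (j + 1) = K at *
      linear_combination (norm := skip) h1 + h2 * h j + (r - s) • (g * h3)
      simp only [mul_add, add_mul, mul_sub, sub_mul, smul_mul_assoc, mul_smul_comm, smul_smul,
        mul_assoc, smul_add, smul_sub, smul_zero, mul_zero, zero_mul]
      match_scalars <;> first | ring1 | (field_simp; ring1) | field_simp
    · rw [B.upper_e_row_succ hr hs hm]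
      simp [show m ≠ j by omega, show m ≠ j + 1 by omega]
  · rw [B.upper_e_of_row_gt hij]
    simp [show m ≠ j by omega, show m ≠ j + 1 by omega, hij.ne']

end Borel
end

noncomputable section

variable {A : Type*} [Ring A] [Algebra ℂ A]

/-! ### Intertwining operators

The relation `RTTInv` for the entries of `x` and a fixed entry `y j l` says that a column operator
and a row operator agree on `x`. -/

/-- The operator on rows given by `y j l`. -/
def rowOp (r s : ℂ) (y : ℕ → ℕ → A) (j l : ℕ) (u : ℕ → A) (k : ℕ) : A :=
  dg r (r * s) k l • (u k * y j l) + if l < k then (r - s) • (u l * y j k) else 0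

/-- The operator on columns given by `y j l`. -/
def colOp (r s : ℂ) (y : ℕ → ℕ → A) (j l : ℕ) (v : ℕ → A) (i : ℕ) : A :=
  dg r (r * s) i j • (y j l * v i) + if i < j then (r - s) • (y i l * v j) else 0

theorem rttInv_iff {r s : ℂ} {x y : ℕ → ℕ → A} :
    RTTInv r s x y ↔
      ∀ j l i k, rowOp r s y j l (x i) k = colOp r s y j l (fun i => x i k) i :=
  ⟨fun h j l i k => h i j k l, fun h i j k l => h j l i k⟩

/-- If a row and a column operator agree on `X` for two elements, they do so for a combination
of their products. -/
theorem intertwine_step {X : ℕ → ℕ → A} {R R' Re L L' Le : (ℕ → A) → ℕ → A} (α β : ℂ)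
    (hR : ∀ i k, R (X i) k = L (fun i => X i k) i)
    (hE : ∀ i k, Re (X i) k = Le (fun i => X i k) i)
    (cR : ∀ (Y : ℕ → ℕ → A) i k, Re (fun k => L (fun i => Y i k) i) k
      = L (fun i => Re (Y i) k) i)
    (cL : ∀ (Y : ℕ → ℕ → A) i k, R (fun k => Le (fun i => Y i k) i) k
      = Le (fun i => R (Y i) k) i)
    (hR' : ∀ u k, R' u k = α • Re (R u) k + β • R (Re u) k)
    (hL' : ∀ v i, L' v i = α • L (Le v) i + β • Le (L v) i) (i k : ℕ) :
    R' (X i) k = L' (fun i => X i k) i := by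
  -- On `X` one has `Re R = Re L = L Re = L Le`, and likewise with the roles exchanged. Row
  -- operators commute with column operators, so the order of composition is reversed from one side
  -- to the other.
  rw [hR', hL']
  congr 2
  · rw [show R (X i) = fun k => L (fun i => X i k) i from funext fun k => hR i k, cR]
    congr 1
    exact funext fun i => hE i k
  · rw [show Re (X i) = fun k => Le (fun i => X i k) i from funext fun k => hE i k, cL]
    congr 1
    exact funext fun i => hR i k

/-- The operator on rows given by `e_l`. -/
def rowE (r s : ℂ) (e : ℕ → A) (l : ℕ) (u : ℕ → A) (k : ℕ) : A :=
  (colWt r s l k)⁻¹ • (u k * e l) - if k = l then s⁻¹ • u (l + 1) else 0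

/-- The operator on columns given by `e_l`. -/
def colE (s : ℂ) (h e : ℕ → A) (l : ℕ) (v : ℕ → A) (i : ℕ) : A :=
  e l * v i - if i = l + 1 then s⁻¹ • (h l * v l) else 0

/-! ### The intertwining relation for `upper` with itself -/

namespace Borel
variable {r s : ℂ} {k h e : ℕ → A}

/-- This is `upper_e` divided by the column weight, with right multiplications collected on one side
and left multiplications on the other. Moving `h l` to the left by `upper_h` produces the column
weight times `s⁻¹`, so a coefficient `s⁻¹` independent of the column remains. -/
theorem rowE_upper (B : Borel r s k h e) (hr : r ≠ 0) (hs : s ≠ 0) (hrs : r + s ≠ 0)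
    (l i m : ℕ) :
    rowE r s e l (upper s k e i) m = colE s h e l (fun i => upper s k e i m) i := by
  have h1 := B.upper_e hr hs hrs i m l
  have h2 := B.upper_h hr hs l m l
  simp only [rowE, colE, h1]
  unfold colWt
  rcases eq_or_ne i (l + 1) with rfl | hi
  · rcases lt_or_ge m l with hm | hm
    · simp [hm.ne, show m ≠ l + 1 by omega, upper_of_lt _ _ _ hm, upper_of_lt _ _ _ (show m < l + 1 by omega)]
    have h3 : upper s k e l m * h l =
        ((if m = l then s else if m = l + 1 then r else 1) * s⁻¹) • (h l * upper s k e l m) := by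
      rw [if_pos rfl] at h2
      rw [← smul_smul, ← h2]
      split_ifs <;> simp [hr, hs]
    rw [h3]
    split_ifs <;> simp only [smul_sub, smul_add, smul_smul, smul_zero] <;>
      match_scalars <;> field_simp
    all_goals simp
  · simp only [if_neg hi]
    split_ifs <;> simp only [smul_sub, smul_add, smul_smul, smul_zero] <;>
      match_scalars <;> field_simp
    all_goals simp

/-- The operator counterpart of `y_{j,l+1} = y_{jl} e_l - s e_l y_{jl}`. It holds on every row `u`,
not only on rows of `upper`; row operators multiply from the right, so the rightmost factor is
applied last. -/
theorem rowOp_upper_succ (B : Borel r s k h e) (hr : r ≠ 0) (hs : s ≠ 0) (hrs : r + s ≠ 0)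
    {j l : ℕ} (hjl : j ≤ l) (u : ℕ → A) (m : ℕ) :
    rowOp r s (upper s k e) j (l + 1) u m =
      (1 : ℂ) • rowE r s e l (rowOp r s (upper s k e) j l u) m
        + (-s) • rowOp r s (upper s k e) j l (rowE r s e l u) m := by
  have h1 := B.upper_e hr hs hrs j m l
  have h2 := B.upper_e hr hs hrs j l l
  have hj : j ≠ l + 1 := by omega
  simp only [colWt, if_true, if_neg hj, sub_zero] at h1 h2
  simp only [rowOp, rowE, colWt, dg]
  rcases (by omega : m < l ∨ m = l ∨ m = l + 1 ∨ l + 1 < m) with hm | rfl | rfl | hm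
  · simp only [hm, hm.ne, hm.not_gt, show ¬ l + 1 < m by omega, show m ≠ l + 1 by omega,
      show m < l + 1 by omega, lt_irrefl, if_true, if_false] at *
    simp only [mul_add, add_mul, mul_sub, sub_mul, smul_mul_assoc, mul_smul_comm, smul_smul,
      mul_assoc, smul_add, smul_sub, smul_zero, mul_zero, zero_mul, h2]
    match_scalars <;> first | ring1 | (field_simp; ring1) | field_simp
  · simp only [show ¬ m + 1 < m by omega, show m ≠ m + 1 by omega, show m + 1 ≠ m by omega,
      show m < m + 1 by omega, lt_irrefl, if_true, if_false] at *
    simp only [mul_add, add_mul, mul_sub, sub_mul, smul_mul_assoc, mul_smul_comm, smul_smul,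
      mul_assoc, smul_add, smul_sub, smul_zero, mul_zero, zero_mul, h2]
    match_scalars <;> first | ring1 | (field_simp; ring1) | field_simp
  · simp only [show ¬ l + 1 < l by omega, show l ≠ l + 1 by omega, show l + 1 ≠ l by omega,
      show l < l + 1 by omega, lt_irrefl, if_true, if_false, add_zero] at *
    simp only [mul_add, add_mul, mul_sub, sub_mul, smul_mul_assoc, mul_smul_comm, smul_smul,
      mul_assoc, smul_add, smul_sub, smul_zero, mul_zero, zero_mul, h2, h1]
    match_scalars <;> first | ring1 | (field_simp; ring1) | field_simp
  · simp only [show l < m by omega, show m ≠ l by omega, hm.ne', show ¬ m < l by omega,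
      hm, hm.not_gt, lt_irrefl, if_true, if_false, add_zero] at *
    simp only [mul_add, add_mul, mul_sub, sub_mul, smul_mul_assoc, mul_smul_comm, smul_smul,
      mul_assoc, smul_add, smul_sub, smul_zero, mul_zero, zero_mul, h2, h1]
    match_scalars <;> first | ring1 | (field_simp; ring1) | field_simp

/-- The same recursion for left multiplications, with composition in the order of the product. The
term with `h l` in `colE` accounts for row `l + 1`, where `e_l` acts differently. -/
theorem colOp_upper_succ (B : Borel r s k h e) (hr : r ≠ 0) (hs : s ≠ 0) (hrs : r + s ≠ 0)
    {j l : ℕ} (hjl : j ≤ l) (v : ℕ → A) (i : ℕ) :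
    colOp r s (upper s k e) j (l + 1) v i =
      (1 : ℂ) • colOp r s (upper s k e) j l (colE s h e l v) i
        + (-s) • colE s h e l (colOp r s (upper s k e) j l v) i := by
  have hj : j ≠ l + 1 := by omega
  have h1 : ∀ i x, i ≤ j → upper s k e i l * (e l * x) =
      s • (e l * (upper s k e i l * x)) + upper s k e i (l + 1) * x := fun i x hi => by
    rw [← mul_assoc, B.upper_e hr hs hrs]
    simp [colWt, add_mul, mul_assoc, show i ≠ l + 1 by omega]
  have h3 : ∀ x, upper s k e j l * (h l * x) =
      (if j = l then 1 else s : ℂ) • (h l * (upper s k e j l * x)) := fun x => by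
    have := congrArg (fun z => s • z * x) (B.upper_h hr hs j l l)
    simp only [if_true, smul_smul, smul_mul_assoc, mul_inv_cancel₀ hs, one_smul, mul_assoc] at this
    rw [this]
    congr 1
    split_ifs <;> simp [hs]
  simp only [colOp, colE, dg]
  rcases (by omega : i < j ∨ i = j ∨ (j < i ∧ i ≠ l + 1) ∨ i = l + 1) with hi | rfl | ⟨hi, hi'⟩ | rfl
  · simp only [hi, hj, show i ≠ l + 1 by omega, if_true, if_false, sub_zero]
    simp only [mul_add, add_mul, mul_sub, sub_mul, smul_mul_assoc, mul_smul_comm, smul_smul,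
      mul_assoc, smul_add, smul_sub, smul_zero, mul_zero, zero_mul, h1 j _ le_rfl, h1 i _ hi.le]
    match_scalars <;> first | ring1 | (field_simp; ring1) | field_simp
  · simp only [hj, lt_irrefl, if_true, if_false, sub_zero, add_zero]
    simp only [mul_add, add_mul, mul_sub, sub_mul, smul_mul_assoc, mul_smul_comm, smul_smul,
      mul_assoc, smul_add, smul_sub, smul_zero, mul_zero, zero_mul, h1 i _ le_rfl]
    match_scalars <;> first | ring1 | (field_simp; ring1) | field_simp
  · simp only [hi', hi.not_gt, hi.ne', if_true, if_false, sub_zero, add_zero]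
    simp only [mul_add, add_mul, mul_sub, sub_mul, smul_mul_assoc, mul_smul_comm, smul_smul,
      mul_assoc, smul_add, smul_sub, smul_zero, mul_zero, zero_mul, h1 j _ le_rfl]
    match_scalars <;> first | ring1 | (field_simp; ring1) | field_simp
  · simp only [show ¬ l + 1 < j by omega, hj.symm, show ¬ l < j by omega, if_true, if_false,
      add_zero]
    rcases eq_or_ne j l with rfl | hjl'
    · simp only [if_true] at *
      simp only [mul_add, add_mul, mul_sub, sub_mul, smul_mul_assoc, mul_smul_comm, smul_smul,
      mul_assoc, smul_add, smul_sub, smul_zero, mul_zero, zero_mul, h1 j _ le_rfl, h3]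
      match_scalars <;> first | ring1 | (field_simp; ring1) | field_simp
    · simp only [hjl', hjl'.symm, if_false] at *
      simp only [mul_add, add_mul, mul_sub, sub_mul, smul_mul_assoc, mul_smul_comm, smul_smul,
      mul_assoc, smul_add, smul_sub, smul_zero, mul_zero, zero_mul, h1 j _ le_rfl, h3]
      match_scalars <;> first | ring1 | (field_simp; ring1) | field_simp

/-- For the diagonal entry `y_{jj} = k_j` the weights in `upper_k` suffice: the two correction terms
are equal, vanish, or replace a coefficient `s` by `r`. -/
theorem rowOp_upper_self (B : Borel r s k h e) (hr : r ≠ 0) (hs : s ≠ 0) (j i m : ℕ) :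
    rowOp r s (upper s k e) j j (upper s k e i) m =
      colOp r s (upper s k e) j j (fun i => upper s k e i m) i := by
  have h1 := B.upper_k hr hs i m j
  simp only [rowOp, colOp, upper_self]
  rcases lt_or_ge m i with hi | hi
  · rcases lt_or_ge j m with hj | hj
    · simp [upper_of_lt _ _ _ hi, upper_of_lt _ _ _ (hj.trans hi), show ¬ i < j by omega]
    · rcases eq_or_lt_of_le hj with rfl | hj
      · simp [upper_of_lt _ _ _ hi, show ¬ i < m by omega]
      · simp [upper_of_lt _ _ _ hi, upper_of_lt _ _ _ hj, show ¬ j < m by omega]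
  rcases lt_trichotomy i j with hij | rfl | hij
  · rcases lt_trichotomy m j with hmj | rfl | hmj
    · simp only [dg, hij, hmj, hmj.not_gt, if_true, if_false, upper_of_lt _ _ _ hmj] at *
      simpa using h1
    · simp only [dg, hij, lt_irrefl, if_true, if_false, upper_self] at *
      linear_combination (norm := module) h1
    · simp only [dg, hij, hmj, hmj.not_gt, hmj.ne', if_true, if_false] at *
      rw [h1]
  · rcases eq_or_lt_of_le hi with rfl | hi
    · simp [upper_self]
    · simp only [dg, hi, hi.not_gt, hi.ne', lt_irrefl, if_true, if_false, upper_self] at *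
      rw [h1]
      module
  · simp only [dg, show ¬ m < j by omega, show m ≠ j by omega, show j < m by omega, hij.ne', hij.not_gt,
      if_true, if_false, upper_of_lt _ _ _ hij] at *
    simpa using h1

/-- The matrix `upper` satisfies the RTT relation. -/
theorem rttInv_upper (B : Borel r s k h e) (hr : r ≠ 0) (hs : s ≠ 0) (hrs : r + s ≠ 0) :
    RTTInv r s (upper s k e) (upper s k e) := by
  refine rttInv_iff.2 fun j l => ?_
  rcases lt_or_ge l j with h | h
  -- Here `y_{jl} = 0`. Each correction term, when present, is `(r - s) u_{il} u_{jm}`; if only one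
  -- of them is present, triangularity makes it vanish.
  · intro i m
    simp only [rowOp, colOp, upper_of_lt _ _ _ h]
    rcases lt_or_ge l m with hm | hm
    · rcases lt_or_ge i j with hi | hi
      · simp [hm, hi]
      · simp [hm, hi.not_gt, upper_of_lt _ _ _ (show l < i by omega)]
    · rcases lt_or_ge i j with hi | hi
      · simp [hi, hm.not_gt, upper_of_lt _ _ _ (show m < j by omega)]
      · simp [hm.not_gt, hi.not_gt]
  -- Agreement spreads along row `j`, from the diagonal entry to the right; each new column is a
  -- combination of products with `e_l`.
  · induction l, h using Nat.le_induction with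
    | base => exact B.rowOp_upper_self hr hs j
    | succ l hl ih =>
      refine intertwine_step 1 (-s) ih (B.rowE_upper hr hs hrs l) (fun Y i m => ?_)
        (fun Y i m => ?_) (B.rowOp_upper_succ hr hs hrs hl) (B.colOp_upper_succ hr hs hrs hl)
      · simp only [rowE, colOp]
        split_ifs <;> simp only [mul_add, add_mul, mul_sub, sub_mul, smul_mul_assoc, mul_smul_comm, smul_smul,
      mul_assoc, smul_add, smul_sub, smul_zero, mul_zero, zero_mul] <;> module
      · simp only [rowOp, colE]
        split_ifs <;> simp only [mul_add, add_mul, mul_sub, sub_mul, smul_mul_assoc, mul_smul_comm, smul_smul,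
      mul_assoc, smul_add, smul_sub, smul_zero, mul_zero, zero_mul] <;> module

end Borel
end

noncomputable section

variable {A : Type*} [Ring A] [Algebra ℂ A]

/-! ### The full quantum group -/

/-- The relations of the two-parameter quantum group in terms of the diagonal Gauss generators
`k`, `k'`, the ratios `h`, `g` of consecutive ones, and the root vectors `e`, `f`. -/
structure QuantumGL (r s : ℂ) (k k' h g e f : ℕ → A) : Prop where
  pos : Borel r s k h e
  neg : Borel s r (fun i => op (k' i)) (fun i => op (g i)) (fun i => op (f i))
  k_k' : ∀ i j, k i * k' j = k' j * k i
  k'_e : ∀ i j, k' i * e j = wt s r i j • (e j * k' i)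
  f_k : ∀ i j, f j * k i = wt r s i j • (k i * f j)
  g_e : ∀ i j, g i * e j = hwt s r i j • (e j * g i)
  k_g : ∀ i j, k i * g j = g j * k i
  e_f : ∀ i j, e i * f j - f j * e i = if i = j then (r - s)⁻¹ • (g i - h i) else 0

/-- The lower triangular matrix with diagonal `k'`, generated by the root vectors `f`. -/
def lower (r : ℂ) (k' f : ℕ → A) (i j : ℕ) : A :=
  unop (upper r (fun i => op (k' i)) (fun i => op (f i)) j i)

theorem op_lower (r : ℂ) (k' f : ℕ → A) (i j : ℕ) :
    op (lower r k' f i j) = upper r (fun i => op (k' i)) (fun i => op (f i)) j i := rfl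

theorem lower_self (r : ℂ) (k' f : ℕ → A) (i : ℕ) : lower r k' f i i = k' i := by
  simp [lower, upper_self]

theorem lower_of_lt (r : ℂ) (k' f : ℕ → A) {i j : ℕ} (h : i < j) : lower r k' f i j = 0 := by
  simp [lower, upper_of_lt _ _ _ h]

theorem lower_succ (r : ℂ) (k' f : ℕ → A) {i j : ℕ} (h : j ≤ i) :
    lower r k' f (i + 1) j = f i * lower r k' f i j - r • (lower r k' f i j * f i) := by
  simp [lower, upper_succ _ _ _ h]

theorem lower_map {B : Type*} [Ring B] [Algebra ℂ B] (φ : A →ₐ[ℂ] B) (r : ℂ) (k' f : ℕ → A)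
    (i j : ℕ) :
    φ (lower r k' f i j) = lower r (fun i => φ (k' i)) (fun i => φ (f i)) i j :=
  congrArg unop (upper_map r (fun i => op (k' i)) (fun i => op (f i)) (AlgHom.op φ) j i)

/-! ### Commutation of the negative root vectors with the entries of `upper` and `lower` -/

namespace QuantumGL
variable {r s : ℂ} {k k' h g e f : ℕ → A}

theorem lower_f (Q : QuantumGL r s k k' h g e f) (hr : r ≠ 0) (hs : s ≠ 0) (hrs : r + s ≠ 0)
    (i m j : ℕ) :
    f j * lower r k' f m i = colWt s r j m • (lower r k' f m i * f j)
      + (if m = j then lower r k' f (j + 1) i else 0)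
      - (if i = j + 1 then g j * lower r k' f m j else 0) := by
  have := congrArg unop (Q.neg.upper_e hs hr (by rwa [add_comm]) i m j)
  simp only [← op_lower] at this
  split_ifs at this ⊢ <;> simpa using this

theorem upper_k' (Q : QuantumGL r s k k' h g e f) (hr : r ≠ 0) (hs : s ≠ 0) (i j l : ℕ) :
    dg r (r * s) j l • (upper s k e i j * k' l) = dg r (r * s) i l • (k' l * upper s k e i j) := by
  refine upper_weight s k e (c := fun m => dg r (r * s) m l)
    (fun m => dg_ne_zero hr (mul_ne_zero hr hs) _ _) (fun i => Q.k_k' _ _) (fun m => ?_) i j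
  rw [Q.k'_e, smul_smul]
  congr 1
  simp only [wt, dg]
  split_ifs <;> first | omega | ring1

theorem upper_g (Q : QuantumGL r s k k' h g e f) (hr : r ≠ 0) (hs : s ≠ 0) (i j l : ℕ) :
    (if j = l then r⁻¹ else if j = l + 1 then s⁻¹ else 1 : ℂ) • (upper s k e i j * g l) =
      (if i = l then r⁻¹ else if i = l + 1 then s⁻¹ else 1 : ℂ) • (g l * upper s k e i j) := by
  refine upper_weight s k e (c := fun m => if m = l then r⁻¹ else if m = l + 1 then s⁻¹ else 1)
    (fun m => ?_) (fun i => Q.k_g _ _) (fun m => ?_) i j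
  · split_ifs <;> simp [hr, hs]
  rw [Q.g_e, smul_smul]
  congr 1
  simp only [hwt]
  split_ifs <;> first | omega | field_simp

/-- The commutation relations of `f_j` with the entries of `upper`. -/
theorem upper_f (Q : QuantumGL r s k k' h g e f) (hr : r ≠ 0) (hs : s ≠ 0) (hne : r ≠ s)
    (i m j : ℕ) :
    upper s k e i m * f j = (wt r s i j)⁻¹ • (f j * upper s k e i m)
      - (if i = j then r⁻¹ • upper s k e (j + 1) m else 0)
      + (if m = j + 1 then r⁻¹ • (upper s k e i j * g j) else 0) := by
  have hd : r - s ≠ 0 := sub_ne_zero.2 hne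
  rcases lt_or_ge m i with hi | hi
  · have h1 : (if i = j then r⁻¹ • upper s k e (j + 1) m else 0) = 0 := by
      split_ifs with h
      · rw [upper_of_lt _ _ _ (by omega), smul_zero]
      · rfl
    have h2 : (if m = j + 1 then r⁻¹ • (upper s k e i j * g j) else 0) = 0 := by
      split_ifs with h
      · rw [upper_of_lt _ _ _ (by omega), zero_mul, smul_zero]
      · rfl
    simp [h1, h2, upper_of_lt _ _ _ hi]
  induction m, hi using Nat.le_induction with
  | base =>
    have h1 : (if i = j then r⁻¹ • upper s k e (j + 1) i else 0) = 0 := by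
      split_ifs with h
      · rw [upper_of_lt _ _ _ (by omega), smul_zero]
      · rfl
    have h2 : (if i = j + 1 then r⁻¹ • (upper s k e i j * g j) else 0) = 0 := by
      split_ifs with h
      · rw [upper_of_lt _ _ _ (by omega), zero_mul, smul_zero]
      · rfl
    have hw : wt r s i j ≠ 0 := by unfold wt; split_ifs <;> simp [hr, hs]
    rw [h1, h2, upper_self, Q.f_k, smul_smul, inv_mul_cancel₀ hw]
    simp
  | succ m hi ih =>
    have hef := Q.e_f m j
    rcases eq_or_ne m j with rfl | hmj
    · have hh := Q.pos.upper_h hr hs i m m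
      have hg := Q.upper_g hr hs i m m
      have hkh := Q.pos.k_h m
      have hu := upper_of_lt s k e (show m < m + 1 by omega)
      rw [upper_succ _ _ _ hi]
      -- The new terms come from `[e_m, f_m]`. If `i = m`, both ratios commute with `k_i` and the
      -- coefficient is `(1 - s / r) / (r - s) = r⁻¹`, with `k_i h_i = k_{i+1}`. If `i < m`, then `x
      -- h = s h x` removes the contribution of `h`, while `x g = r g x` gives `r⁻¹ x g`.
      rcases eq_or_ne i m with rfl | him
      · simp only [wt, upper_self, if_true, if_false, show i ≠ i + 1 by omega] at *
        rw [hu] at ih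
        simp only [upper_self, smul_zero] at *
        generalize e i = E at *
        generalize f i = F at *
        generalize k i = K at *
        linear_combination (norm := skip) K * hef + ih * E - s • (E * ih) - (s / r) • (hef * K) -
          r⁻¹ • hkh + (s * r⁻¹ * (r - s)⁻¹) • (r • hg - s • hh)
        simp only [mul_add, add_mul, mul_sub, sub_mul, smul_mul_assoc, mul_smul_comm, smul_smul,
          mul_assoc, smul_add, smul_sub, smul_zero, mul_zero, zero_mul]
        match_scalars <;> first | ring1 | (field_simp; ring1) | field_simp
      · simp only [wt, if_true, if_false, him, show m ≠ m + 1 by omega, show i ≠ m + 1 by omega] at *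
        generalize upper s k e i m = x at *
        generalize e m = E at *
        generalize f m = F at *
        linear_combination (norm := skip) x * hef + ih * E - s • (E * ih) - s • (hef * x) + 
          (s * (r - s)⁻¹) • (hg - hh)
        simp only [mul_add, add_mul, mul_sub, sub_mul, smul_mul_assoc, mul_smul_comm, smul_smul,
          mul_assoc, smul_add, smul_sub, smul_zero, mul_zero, zero_mul]
        match_scalars <;> first | ring1 | (field_simp; ring1) | field_simp
    · rw [if_neg hmj] at hef
      rw [upper_succ _ _ _ hi, if_neg (by omega : ¬ m + 1 = j + 1)]
      have hu : (if i = j then r⁻¹ • upper s k e (j + 1) (m + 1) else 0) =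
          (if i = j then r⁻¹ • upper s k e (j + 1) m else 0) * e m
            - s • (e m * (if i = j then r⁻¹ • upper s k e (j + 1) m else 0)) := by
        split_ifs with h
        · rw [upper_succ _ _ _ (by omega)]
          simp [smul_sub, smul_comm s r⁻¹]
        · simp
      -- The correction in column `j + 1` does not propagate to column `j + 2`: `u_{ij}` commutes
      -- with `e_{j+1}`, and `g_j e_{j+1} = s e_{j+1} g_j`.
      have hv : (if m = j + 1 then r⁻¹ • (upper s k e i j * g j) else 0) * e m
            - s • (e m * (if m = j + 1 then r⁻¹ • (upper s k e i j * g j) else 0)) = 0 := by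
        split_ifs with h
        · subst h
          have h1 := Q.pos.upper_e_of_lt (i := i) (m := j) (j := j + 1) (by omega)
          have h2 := Q.g_e j (j + 1)
          simp only [hwt, if_true, if_false, show j ≠ j + 1 by omega, show j ≠ j + 1 + 1 by omega]
            at h2
          generalize upper s k e i j = x at *
          linear_combination (norm := skip) r⁻¹ • (x * h2) + (s * r⁻¹) • (h1 * g j)
          simp only [mul_add, add_mul, mul_sub, sub_mul, smul_mul_assoc, mul_smul_comm, smul_smul,
            mul_assoc, smul_add, smul_sub, smul_zero, mul_zero, zero_mul]
          match_scalars <;> first | ring1 | (field_simp; ring1) | field_simp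
        · simp
      rw [hu]
      generalize (if i = j then r⁻¹ • upper s k e (j + 1) m else 0) = U at *
      generalize (if m = j + 1 then r⁻¹ • (upper s k e i j * g j) else 0) = V at *
      generalize upper s k e i m = x at *
      linear_combination (norm := skip) x * hef + ih * e m - s • (e m * ih)
        - (s * (wt r s i j)⁻¹) • (hef * x) + hv
      simp only [mul_add, add_mul, mul_sub, sub_mul, smul_mul_assoc, mul_smul_comm, smul_smul,
        mul_assoc, smul_add, smul_sub, smul_zero, mul_zero, zero_mul]
      match_scalars <;> first | ring1 | (field_simp; ring1) | field_simp

end QuantumGL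
end

/-! ### The mixed RTT relation between `upper` and `lower` -/

noncomputable section

variable {A : Type*} [Ring A] [Algebra ℂ A]

/-- The operator on rows given by `f_j`. -/
def rowF (r : ℂ) (g f : ℕ → A) (j : ℕ) (u : ℕ → A) (k : ℕ) : A :=
  u k * f j - if k = j + 1 then r⁻¹ • (u j * g j) else 0

/-- The operator on columns given by `f_j`. -/
def colF (r s : ℂ) (f : ℕ → A) (j : ℕ) (v : ℕ → A) (i : ℕ) : A :=
  (wt r s i j)⁻¹ • (f j * v i) - if i = j then r⁻¹ • v (j + 1) else 0

namespace QuantumGL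
variable {r s : ℂ} {k k' h g e f : ℕ → A}

/-- A rearrangement of `upper_f`: right multiplications on one side, left multiplications on the
other. -/
theorem rowF_upper (Q : QuantumGL r s k k' h g e f) (hr : r ≠ 0) (hs : s ≠ 0) (hne : r ≠ s)
    (j i m : ℕ) :
    rowF r g f j (upper s k e i) m = colF r s f j (fun i => upper s k e i m) i := by
  simp only [rowF, colF, Q.upper_f hr hs hne]
  abel

theorem g_lower (Q : QuantumGL r s k k' h g e f) (hr : r ≠ 0) (hs : s ≠ 0) {j l : ℕ}
    (hl : l ≤ j) :
    g j * lower r k' f j l = (if l = j then 1 else r : ℂ) • (lower r k' f j l * g j) := by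
  have := congrArg (fun z => r • unop z) (Q.neg.upper_h hs hr l j j)
  simp only [← op_lower, if_true, if_neg (show ¬ l = j + 1 by omega), unop_smul, unop_mul,
    unop_op, smul_smul, mul_inv_cancel₀ hr, one_smul] at this
  rw [this]
  congr 1
  split_ifs <;> simp [hr]

theorem g_k'_self (Q : QuantumGL r s k k' h g e f) (j : ℕ) : g j * k' j = k' (j + 1) := by
  simpa using congrArg unop (Q.neg.k_h j)

theorem k'_g_self (Q : QuantumGL r s k k' h g e f) (j : ℕ) : k' j * g j = k' (j + 1) := by
  rw [← Q.g_k'_self]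
  simpa using congrArg unop (Q.neg.h_comm j j)

/-- The operator counterpart of `y_{j+1,l} = f_j y_{jl} - r y_{jl} f_j`, valid on every row `u`. -/
theorem rowOp_lower_succ (Q : QuantumGL r s k k' h g e f) (hr : r ≠ 0) (hs : s ≠ 0)
    (hrs : r + s ≠ 0) {j l : ℕ} (hl : l ≤ j) (u : ℕ → A) (m : ℕ) :
    rowOp r s (lower r k' f) (j + 1) l u m =
      (-r) • rowF r g f j (rowOp r s (lower r k' f) j l u) m
        + (1 : ℂ) • rowOp r s (lower r k' f) j l (rowF r g f j u) m := by
  have h1 : ∀ m, m ≠ j + 1 → f j * lower r k' f j m =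
      r • (lower r k' f j m * f j) + lower r k' f (j + 1) m := fun m hm => by
    rw [Q.lower_f hr hs hrs]
    simp [colWt, hm]
  have h2 := h1 l (by omega)
  have h3 := Q.g_lower hr hs hl
  simp only [rowOp, rowF, dg]
  rcases (by omega : m < l ∨ m = l ∨ (l < m ∧ m ≤ j) ∨ m = j + 1 ∨ j + 1 < m) with
    hm | rfl | ⟨hm, hm'⟩ | rfl | hm
  · simp only [hm, hm.not_gt, show m ≠ j + 1 by omega, show l ≠ j + 1 by omega, if_true, if_false]
    simp only [mul_add, add_mul, mul_sub, sub_mul, smul_mul_assoc, mul_smul_comm, smul_smul,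
      mul_assoc, smul_add, smul_sub, smul_zero, mul_zero, zero_mul, h2]
    match_scalars <;> first | ring1 | (field_simp; ring1) | field_simp
  · simp only [lt_irrefl, show m ≠ j + 1 by omega, if_true, if_false]
    simp only [mul_add, add_mul, mul_sub, sub_mul, smul_mul_assoc, mul_smul_comm, smul_smul,
      mul_assoc, smul_add, smul_sub, smul_zero, mul_zero, zero_mul, h2]
    match_scalars <;> first | ring1 | (field_simp; ring1) | field_simp
  · have h4 := h1 m (by omega)
    simp only [hm, hm.not_gt, hm.ne', show m ≠ j + 1 by omega, show l ≠ j + 1 by omega,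
      if_true, if_false]
    simp only [mul_add, add_mul, mul_sub, sub_mul, smul_mul_assoc, mul_smul_comm, smul_smul,
      mul_assoc, smul_add, smul_sub, smul_zero, mul_zero, zero_mul, h2, h4]
    match_scalars <;> first | ring1 | (field_simp; ring1) | field_simp
  -- In column `j + 1` the new diagonal entry `k'_{j+1}` enters; it is supplied as `k'_j g_j` by the
  -- extra term of `rowF`.
  · have h4 := Q.k'_g_self j
    simp only [show l < j + 1 by omega, show ¬ j + 1 < l by omega, show j + 1 ≠ l by omega,
      show l ≠ j + 1 by omega, show ¬ j < l by omega, lower_self,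
      lower_of_lt _ _ _ (Nat.lt_succ_self j), if_true, if_false]
    rcases eq_or_lt_of_le hl with rfl | hl
    · simp only [lt_irrefl, if_true, if_false, lower_self] at *
      simp only [mul_add, add_mul, mul_sub, sub_mul, smul_mul_assoc, mul_smul_comm, smul_smul,
      mul_assoc, smul_add, smul_sub, smul_zero, mul_zero, zero_mul, h2, h3, h4]
      match_scalars <;> first | ring1 | (field_simp; ring1) | field_simp
    · simp only [hl, hl.ne, hl.ne', if_true, if_false] at *
      simp only [mul_add, add_mul, mul_sub, sub_mul, smul_mul_assoc, mul_smul_comm, smul_smul,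
      mul_assoc, smul_add, smul_sub, smul_zero, mul_zero, zero_mul, h2, h3, h4]
      match_scalars <;> first | ring1 | (field_simp; ring1) | field_simp
  · simp only [show l < m by omega, show ¬ m < l by omega, show m ≠ l by omega,
      show m ≠ j + 1 by omega, show l ≠ j + 1 by omega, if_true, if_false,
      lower_of_lt _ _ _ hm, lower_of_lt _ _ _ (show j < m by omega)]
    simp only [mul_add, add_mul, mul_sub, sub_mul, smul_mul_assoc, mul_smul_comm, smul_smul,
      mul_assoc, smul_add, smul_sub, smul_zero, mul_zero, zero_mul, h2]
    match_scalars <;> first | ring1 | (field_simp; ring1) | field_simp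

theorem colOp_lower_succ (Q : QuantumGL r s k k' h g e f) (hr : r ≠ 0) (hs : s ≠ 0)
    (hrs : r + s ≠ 0) {j l : ℕ} (hl : l ≤ j) (v : ℕ → A) (i : ℕ) :
    colOp r s (lower r k' f) (j + 1) l v i =
      (-r) • colOp r s (lower r k' f) j l (colF r s f j v) i
        + (1 : ℂ) • colF r s f j (colOp r s (lower r k' f) j l v) i := by
  have h1 : ∀ x, f j * (lower r k' f j l * x) =
      r • (lower r k' f j l * (f j * x)) + lower r k' f (j + 1) l * x := fun x => by
    rw [← mul_assoc, Q.lower_f hr hs hrs]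
    simp [colWt, add_mul, mul_assoc, show l ≠ j + 1 by omega]
  have h2 : ∀ i x, i < j → f j * (lower r k' f i l * x) = lower r k' f i l * (f j * x) :=
    fun i x hi => by
    rw [← mul_assoc, Q.lower_f hr hs hrs]
    simp [colWt, hi.ne, show i ≠ j + 1 by omega, show l ≠ j + 1 by omega, mul_assoc]
  simp only [colOp, colF, dg, wt]
  rcases (by omega : i < j ∨ i = j ∨ i = j + 1 ∨ j + 1 < i) with hi | rfl | rfl | hi
  · have h3 := h2 i (v j) hi
    simp only [hi, hi.ne, show i < j + 1 by omega, show i ≠ j + 1 by omega, if_true, if_false]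
    simp only [mul_add, add_mul, mul_sub, sub_mul, smul_mul_assoc, mul_smul_comm, smul_smul,
      mul_assoc, smul_add, smul_sub, smul_zero, mul_zero, zero_mul, h1, h3]
    match_scalars <;> first | ring1 | (field_simp; ring1) | field_simp
  · simp only [lt_irrefl, show i < i + 1 by omega, show ¬ i + 1 < i by omega,
      show i + 1 ≠ i by omega, if_true, if_false]
    simp only [mul_add, add_mul, mul_sub, sub_mul, smul_mul_assoc, mul_smul_comm, smul_smul,
      mul_assoc, smul_add, smul_sub, smul_zero, mul_zero, zero_mul, h1]
    match_scalars <;> first | ring1 | (field_simp; ring1) | field_simp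
  · simp only [lt_irrefl, show ¬ j + 1 < j by omega, show j + 1 ≠ j by omega, if_true, if_false]
    simp only [mul_add, add_mul, mul_sub, sub_mul, smul_mul_assoc, mul_smul_comm, smul_smul,
      mul_assoc, smul_add, smul_sub, smul_zero, mul_zero, zero_mul, h1]
    match_scalars <;> first | ring1 | (field_simp; ring1) | field_simp
  · simp only [hi.not_gt, hi.ne', show ¬ i < j by omega, show i ≠ j by omega, if_true, if_false]
    simp only [mul_add, add_mul, mul_sub, sub_mul, smul_mul_assoc, mul_smul_comm, smul_smul,
      mul_assoc, smul_add, smul_sub, smul_zero, mul_zero, zero_mul, h1]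
    match_scalars <;> first | ring1 | (field_simp; ring1) | field_simp

/-- The induction descends column `l` of `lower` from its diagonal entry `k'_l`, where the weights
of `upper_k'` suffice. Each further row is reached by one `f_j`. -/
theorem rttInv_upper_lower (Q : QuantumGL r s k k' h g e f) (hr : r ≠ 0) (hs : s ≠ 0)
    (hne : r ≠ s) (hrs : r + s ≠ 0) : RTTInv r s (upper s k e) (lower r k' f) := by
  refine rttInv_iff.2 fun j l => ?_
  rcases lt_or_ge j l with h | h
  · intro i m
    simp only [rowOp, colOp, lower_of_lt _ _ _ h]
    have h1 : (if l < m then (r - s) • (upper s k e i l * lower r k' f j m) else 0) = 0 := by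
      split_ifs with hm
      · simp [lower_of_lt _ _ _ (h.trans hm)]
      · rfl
    have h2 : (if i < j then (r - s) • (lower r k' f i l * upper s k e j m) else 0) = 0 := by
      split_ifs with hi
      · simp [lower_of_lt _ _ _ (hi.trans h)]
      · rfl
    simp [h1, h2]
  · induction j, h using Nat.le_induction with
    | base =>
      intro i m
      simp only [rowOp, colOp, lower_self]
      have h1 : (if l < m then (r - s) • (upper s k e i l * lower r k' f l m) else 0) = 0 := by
        split_ifs with hm
        · simp [lower_of_lt _ _ _ hm]
        · rfl
      have h2 : (if i < l then (r - s) • (lower r k' f i l * upper s k e l m) else 0) = 0 := by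
        split_ifs with hi
        · simp [lower_of_lt _ _ _ hi]
        · rfl
      rw [h1, h2, Q.upper_k' hr hs]
    | succ j hj ih =>
      refine intertwine_step (-r) 1 ih (Q.rowF_upper hr hs hne j) (fun Y i m => ?_)
        (fun Y i m => ?_) (Q.rowOp_lower_succ hr hs hrs hj) (Q.colOp_lower_succ hr hs hrs hj)
      · simp only [rowF, colOp]
        split_ifs <;> simp only [mul_add, add_mul, mul_sub, sub_mul, smul_mul_assoc, mul_smul_comm, smul_smul,
      mul_assoc, smul_add, smul_sub, smul_zero, mul_zero, zero_mul] <;> module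
      · simp only [rowOp, colF]
        split_ifs <;> simp only [mul_add, add_mul, mul_sub, sub_mul, smul_mul_assoc, mul_smul_comm, smul_smul,
      mul_assoc, smul_add, smul_sub, smul_zero, mul_zero, zero_mul] <;> module

/-- The matrices `upper` and `lower` of a quantum group satisfy the RTT relations. -/
theorem rtt (Q : QuantumGL r s k k' h g e f) (hr : r ≠ 0) (hs : s ≠ 0) (hne : r ≠ s)
    (hrs : r + s ≠ 0) :
    RTT r s (upper s k e) (upper s k e) ∧ RTT r s (lower r k' f) (lower r k' f) ∧
      RTT r s (upper s k e) (lower r k' f) :=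
  ⟨(Q.pos.rttInv_upper hr hs hrs).rtt hr hs,
    RTTInv.of_transpose_op (Q.neg.rttInv_upper hs hr (by rwa [add_comm])),
    (Q.rttInv_upper_lower hr hs hne hrs).rtt hr hs⟩

end QuantumGL
end

noncomputable section

variable {A : Type*} [Ring A] [Algebra ℂ A]

/-! ### From the RTT relations to the quantum group -/

/-- An upper triangular matrix `x` of size `n`, extended by zero, satisfying the RTT relation, with
diagonal inverses `xi`. -/
structure GaussHalf (n : ℕ) (r s : ℂ) (x : ℕ → ℕ → A) (xi : ℕ → A) : Prop where
  rtt : RTT r s x x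
  tri : ∀ i j, j < i → x i j = 0
  inv_mul : ∀ i, i < n → xi i * x i i = 1
  mul_inv : ∀ i, i < n → x i i * xi i = 1
  zero_inv : ∀ i, n ≤ i → xi i = 0
  zero_row : ∀ i j, n ≤ i → x i j = 0
  zero_col : ∀ i j, n ≤ j → x i j = 0

/-- The root vector `e_j` of a triangular matrix. -/
def rootVec (r s : ℂ) (x : ℕ → ℕ → A) (xi : ℕ → A) (j : ℕ) : A :=
  (r / (r - s)) • (xi j * x j (j + 1))

/-- The ratio of two consecutive diagonal entries of a triangular matrix. -/
def diagRatio (x : ℕ → ℕ → A) (xi : ℕ → A) (j : ℕ) : A := xi j * x (j + 1) (j + 1)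

theorem inv_weight {u v z : A} {c : ℂ} (hc : c ≠ 0) (h1 : v * u = 1) (h2 : u * v = 1)
    (h : u * z = c • (z * u)) : v * z = c⁻¹ • (z * v) := by
  have e1 : v * (u * z) * v = z * v := by rw [← mul_assoc, h1, one_mul]
  rw [h, mul_smul_comm, smul_mul_assoc, mul_assoc, mul_assoc, h2, mul_one] at e1
  rw [← e1, smul_smul, inv_mul_cancel₀ hc, one_smul]

theorem wt_ne_zero {r s : ℂ} (hr : r ≠ 0) (hs : s ≠ 0) (i j : ℕ) : wt r s i j ≠ 0 := by
  unfold wt; split_ifs <;> simp [hr, hs]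

theorem hwt_eq {r s : ℂ} (hr : r ≠ 0) (hs : s ≠ 0) (i j : ℕ) :
    hwt r s i j = wt r s (i + 1) j * (wt r s i j)⁻¹ := by
  unfold hwt wt; split_ifs <;> first | omega | simp

namespace GaussHalf
variable {n : ℕ} {r s : ℂ} {x : ℕ → ℕ → A} {xi : ℕ → A}

theorem inv_weight (G : GaussHalf n r s x xi) {z : A} {c : ℂ} (hc : c ≠ 0) {i : ℕ}
    (h : x i i * z = c • (z * x i i)) : xi i * z = c⁻¹ • (z * xi i) := by
  rcases lt_or_ge i n with hi | hi
  · exact TwoParam.inv_weight hc (G.inv_mul i hi) (G.mul_inv i hi) h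
  · simp [G.zero_inv i hi]

theorem inv_comm (G : GaussHalf n r s x xi) {z : A} {i : ℕ}
    (h : x i i * z = z * x i i) : xi i * z = z * xi i := by
  simpa using G.inv_weight one_ne_zero (by simpa using h)

theorem eq_of_diag_mul (G : GaussHalf n r s x xi) {i : ℕ} (hi : i < n) {z w : A}
    (h : x i i * z = x i i * w) : z = w := by
  simpa [← mul_assoc, G.inv_mul i hi] using congrArg (fun t => xi i * t) h

theorem diag_comm (G : GaussHalf n r s x xi) (hr : r ≠ 0) (hs : s ≠ 0) (i j : ℕ) :
    x i i * x j j = x j j * x i i := by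
  wlog hij : i < j generalizing i j
  · rcases eq_or_lt_of_le (not_lt.1 hij) with rfl | h
    · rfl
    · exact (this j i h).symm
  have h := G.rtt i j i j
  simp only [G.tri j i hij, zero_mul, smul_zero, ite_self, if_neg hij.not_gt, add_zero] at h
  exact smul_right_injective A (dg_ne_zero hs (mul_ne_zero hr hs) j i) h

/-- The diagonal entries act on the superdiagonal ones by weights. -/
theorem diag_super (G : GaussHalf n r s x xi) (hr : r ≠ 0) (hs : s ≠ 0) (i j : ℕ) :
    x i i * x j (j + 1) = wt r s i j • (x j (j + 1) * x i i) := by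
  have h := G.rtt i j i (j + 1)
  have h1 : (if i < j then (s - r) • (x j i * x i (j + 1)) else 0) = 0 := by
    split_ifs with h
    · simp [G.tri j i h]
    · rfl
  have h2 : (if j + 1 < i then (s - r) • (x j i * x i (j + 1)) else 0) = 0 := by
    split_ifs with h
    · simp [G.tri i (j + 1) h]
    · rfl
  rw [h1, h2, add_zero, add_zero] at h
  have e : dg s (r * s) (j + 1) i = dg s (r * s) j i * wt r s i j := by
    simp only [wt, dg]
    split_ifs <;> first | omega | ring1
  rw [e, ← smul_smul] at h
  exact smul_right_injective A (dg_ne_zero hs (mul_ne_zero hr hs) j i) h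

theorem diag_inv_comm (G : GaussHalf n r s x xi) (hr : r ≠ 0) (hs : s ≠ 0) (i j : ℕ) :
    x i i * xi j = xi j * x i i :=
  (G.inv_comm (G.diag_comm hr hs j i)).symm

theorem inv_inv_comm (G : GaussHalf n r s x xi) (hr : r ≠ 0) (hs : s ≠ 0) (i j : ℕ) :
    xi i * xi j = xi j * xi i :=
  G.inv_comm (G.diag_inv_comm hr hs i j)

theorem diag_e (G : GaussHalf n r s x xi) (hr : r ≠ 0) (hs : s ≠ 0) (i j : ℕ) :
    x i i * rootVec r s x xi j = wt r s i j • (rootVec r s x xi j * x i i) := by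
  simp only [rootVec, mul_smul_comm, smul_mul_assoc]
  rw [← mul_assoc, G.diag_inv_comm hr hs, mul_assoc, G.diag_super hr hs, mul_smul_comm, mul_assoc,
    smul_comm]

theorem inv_e (G : GaussHalf n r s x xi) (hr : r ≠ 0) (hs : s ≠ 0) (i j : ℕ) :
    xi i * rootVec r s x xi j = (wt r s i j)⁻¹ • (rootVec r s x xi j * xi i) :=
  G.inv_weight (wt_ne_zero hr hs i j) (G.diag_e hr hs i j)

theorem diag_mul_e (G : GaussHalf n r s x xi) (j : ℕ) :
    x j j * rootVec r s x xi j = (r / (r - s)) • x j (j + 1) := by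
  rcases lt_or_ge j n with h | h
  · rw [rootVec, mul_smul_comm, ← mul_assoc, G.mul_inv j h, one_mul]
  · simp [G.zero_row _ _ h]

theorem e_of_le (G : GaussHalf n r s x xi) {j : ℕ} (h : n ≤ j) : rootVec r s x xi j = 0 := by
  simp [rootVec, G.zero_inv _ h]

theorem e_comm (G : GaussHalf n r s x xi) (hr : r ≠ 0) (hs : s ≠ 0) (i j : ℕ) (hij : i + 1 < j) :
    rootVec r s x xi i * rootVec r s x xi j = rootVec r s x xi j * rootVec r s x xi i := by
  have h := G.rtt i j (i + 1) (j + 1)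
  simp only [dg, show i < j by omega, show ¬ j < i by omega, show j ≠ i by omega,
    show ¬ j + 1 < i + 1 by omega, show ¬ j + 1 = i + 1 by omega, if_true, if_false,
    G.tri j (i + 1) hij, zero_mul, smul_zero, add_zero] at h
  have h := smul_right_injective A (mul_ne_zero hr hs) h
  have h1 : xi j * x i (i + 1) = x i (i + 1) * xi j := by
    simpa [wt, show j ≠ i by omega, show j ≠ i + 1 by omega] using
      G.inv_weight (wt_ne_zero hr hs j i) (G.diag_super hr hs j i)
  have h2 : xi i * x j (j + 1) = x j (j + 1) * xi i := by
    simpa [wt, show i ≠ j by omega, show i ≠ j + 1 by omega] using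
      G.inv_weight (wt_ne_zero hr hs i j) (G.diag_super hr hs i j)
  have h3 := G.inv_inv_comm hr hs i j
  simp only [rootVec, smul_mul_assoc, mul_smul_comm]
  congr 2
  generalize x i (i + 1) = X at *
  generalize x j (j + 1) = Y at *
  linear_combination (norm := noncomm_ring) -(xi i * h1 * Y) + h3 * X * Y + xi j * xi i * h
    + xi j * h2 * X

/-- Each column is obtained from the previous one by the action of a root vector. -/
theorem succ (G : GaussHalf n r s x xi) (hr : r ≠ 0) (hs : s ≠ 0) (hne : r ≠ s) {i m : ℕ}
    (hi : i ≤ m) :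
    x i (m + 1) = x i m * rootVec r s x xi m - s • (rootVec r s x xi m * x i m) := by
  have hd : r - s ≠ 0 := sub_ne_zero.2 hne
  have h1 := G.diag_mul_e m
  have h2 := G.diag_e hr hs m m
  simp only [wt, if_true] at h2
  rcases eq_or_lt_of_le hi with rfl | hi
  · linear_combination (norm := skip) (-(r - s) / r) • h1 - (s / r) • h2
    simp only [mul_add, add_mul, mul_sub, sub_mul, smul_mul_assoc, mul_smul_comm, smul_smul,
      mul_assoc, smul_add, smul_sub, smul_zero, mul_zero, zero_mul]
    match_scalars <;> first | ring1 | (field_simp; ring1) | field_simp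
  -- This entry expresses `x_{mm} x_{i,m+1}` through the commutator of `x_{im}` and `x_{m,m+1} = ((r
  -- - s) / r) x_{mm} e_m`. The second entry, `x_{mm} x_{im} = s x_{im} x_{mm}`, brings `x_{mm}` to
  -- the front, where it is cancelled.
  · have h3 := G.rtt i m m (m + 1)
    have h4 := G.rtt m i m m
    simp only [dg, hi, hi.ne, hi.ne', hi.not_gt, lt_irrefl, show ¬ m + 1 < m by omega,
      show m + 1 ≠ m by omega, if_true, if_false, add_zero, one_smul] at h3 h4
    rcases lt_or_ge m n with hm | hm
    · apply G.eq_of_diag_mul hm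
      generalize rootVec r s x xi m = E at *
      generalize x m (m + 1) = X at *
      linear_combination (norm := skip) (s - r)⁻¹ • h3 - h4 * E - s • (x i m * h1) + s • (h1 * x i m)
      have hd' : s - r ≠ 0 := sub_ne_zero.2 hne.symm
      simp only [mul_add, add_mul, mul_sub, sub_mul, smul_mul_assoc, mul_smul_comm, smul_smul,
      mul_assoc, smul_add, smul_sub, smul_zero, mul_zero, zero_mul]
      match_scalars <;> field_simp <;> ring
    · simp [G.zero_col i (m + 1) (by omega), G.e_of_le hm]

/-- The `s`-commutator of two neighbouring root vectors is, up to the diagonal factor, the entry two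
steps above the diagonal. The Serre relations thereby become quadratic relations between matrix
entries. -/
theorem smul_add_two (G : GaussHalf n r s x xi) (hr : r ≠ 0) (hs : s ≠ 0) (hne : r ≠ s) (i : ℕ) :
    x i i * (rootVec r s x xi i * rootVec r s x xi (i + 1)
      - s • (rootVec r s x xi (i + 1) * rootVec r s x xi i)) = (r / (r - s)) • x i (i + 2) := by
  have h3 := G.diag_mul_e i
  have h4 := G.succ hr hs hne (Nat.le_succ i)
  have h5 := G.diag_e hr hs i (i + 1)
  simp only [wt, show i ≠ i + 1 by omega, show i ≠ i + 2 by omega, if_false, one_smul,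
    Nat.succ_eq_add_one, add_assoc, one_add_one_eq_two] at h4 h5
  generalize rootVec r s x xi (i + 1) = E' at *
  generalize rootVec r s x xi i = E at *
  linear_combination (norm := skip) h3 * E' - s • (h5 * E) - s • (E' * h3) - (r / (r - s)) • h4
  simp only [mul_add, add_mul, mul_sub, sub_mul, smul_mul_assoc, mul_smul_comm, smul_smul,
      mul_assoc, smul_add, smul_sub, smul_zero, mul_zero, zero_mul]
  match_scalars <;> first | ring1 | (field_simp; ring1) | field_simp

/-- With `D = E E' - s E' E` the claim is `E D = r D E`. Both `E` and `D` become entries of row `i`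
after multiplication by `x_{ii}`, so two such factors are inserted, and the RTT relation between
`x_{i,i+1}` and `x_{i,i+2}` finishes the proof. -/
theorem serre_left (G : GaussHalf n r s x xi) (hr : r ≠ 0) (hs : s ≠ 0) (hne : r ≠ s) (i : ℕ)
    (hi : i < n) {E E' : A} (hE : E = rootVec r s x xi i) (hE' : E' = rootVec r s x xi (i + 1)) :
    E * (E * E') - (r + s) • (E * (E' * E)) + (r * s) • (E' * (E * E)) = 0 := by
  have h1 := G.rtt i i (i + 2) (i + 1)
  have h3 := G.diag_mul_e i
  have h5 := G.diag_e hr hs i (i + 1)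
  have h6 := G.diag_e hr hs i i
  have hD := G.smul_add_two hr hs hne i
  rw [← hE, ← hE'] at hD
  rw [← hE'] at h5
  rw [← hE] at h3 h6
  simp only [dg, wt, lt_irrefl, show i + 1 < i + 2 by omega, show i ≠ i + 1 by omega,
    show i ≠ i + 1 + 1 by omega, if_true, if_false, add_zero, one_smul] at h1 h5 h6
  have hDK : x i i * (E * E' - s • (E' * E)) = r • ((E * E' - s • (E' * E)) * x i i) := by
    linear_combination (norm := skip) h6 * E' + r • (E * h5) - s • (h5 * E) - s • (E' * h6)
    simp only [mul_add, add_mul, mul_sub, sub_mul, smul_mul_assoc, mul_smul_comm, smul_smul,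
      mul_assoc, smul_add, smul_sub, smul_zero, mul_zero, zero_mul]
    match_scalars <;> first | ring1 | (field_simp; ring1) | field_simp
  apply G.eq_of_diag_mul hi
  apply G.eq_of_diag_mul hi
  generalize hα : r / (r - s) = α at *
  generalize hDD : E * E' - s • (E' * E) = D at *
  have hS : E * (E * E') - (r + s) • (E * (E' * E)) + (r * s) • (E' * (E * E)) =
      E * D - r • (D * E) := by
    rw [← hDD]
    simp only [mul_add, add_mul, mul_sub, sub_mul, smul_mul_assoc, mul_smul_comm, smul_smul,
      mul_assoc, smul_add, smul_sub, smul_zero, mul_zero, zero_mul]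
    module
  rw [hS]
  clear hS hDD
  generalize x i (i + 2) = Z at *
  generalize x i (i + 1) = X at *
  generalize x i i = K at *
  linear_combination (norm := skip) (-r) • (K * hDK * E) - (r ^ 2) • (hD * (K * E))
    - (r ^ 2 * α) • (Z * h3) + K * h6 * D + r • (h3 * (K * D)) + (r * α) • (X * hD)
    - (r * α ^ 2) • h1
  simp only [mul_add, add_mul, mul_sub, sub_mul, smul_mul_assoc, mul_smul_comm, smul_smul,
      mul_assoc, smul_add, smul_sub, smul_zero, mul_zero, zero_mul]
  match_scalars <;> first | ring1 | (field_simp; ring1) | field_simp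

/-- Here the claim is `D E' = r E' D` for the same `D`. It comes from the RTT relation between the
two entries `x_{i,i+2}` and `x_{i+1,i+2}` of one column. -/
theorem serre_right (G : GaussHalf n r s x xi) (hr : r ≠ 0) (hs : s ≠ 0) (hne : r ≠ s) (i : ℕ)
    (hi : i + 1 < n) {E E' : A} (hE : E = rootVec r s x xi i)
    (hE' : E' = rootVec r s x xi (i + 1)) :
    E * (E' * E') - (r + s) • (E' * (E * E')) + (r * s) • (E' * (E' * E)) = 0 := by
  have h1 := G.rtt i (i + 1) (i + 2) (i + 2)
  have h2 := G.rtt (i + 1) i (i + 1) (i + 2)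
  have h3 := G.diag_mul_e (i + 1)
  have h5 := G.diag_e hr hs i (i + 1)
  have hD := G.smul_add_two hr hs hne i
  rw [← hE, ← hE'] at hD
  rw [← hE'] at h3 h5
  simp only [dg, wt, lt_irrefl, show i < i + 1 by omega, show ¬ i + 1 < i by omega,
    show i + 1 ≠ i by omega, show ¬ i + 2 < i + 1 by omega, show i + 2 ≠ i + 1 by omega,
    show i ≠ i + 1 by omega,
    show i ≠ i + 1 + 1 by omega, if_true, if_false, add_zero, one_smul] at h1 h2 h5
  have hZ : x i (i + 2) * E' = r • (E' * x i (i + 2)) := by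
    apply G.eq_of_diag_mul hi
    generalize x i (i + 2) = Z at *
    generalize x (i + 1) (i + 1) = K at *
    linear_combination (norm := skip) h2 * E' + (r * s) • (Z * h3) - r • (h3 * Z)
      + (r / (r - s)) • h1
    simp only [mul_add, add_mul, mul_sub, sub_mul, smul_mul_assoc, mul_smul_comm, smul_smul,
      mul_assoc, smul_add, smul_sub, smul_zero, mul_zero, zero_mul]
    match_scalars <;> first | ring1 | (field_simp; ring1) | field_simp
  apply G.eq_of_diag_mul (show i < n by omega)
  generalize hα : r / (r - s) = α at *
  linear_combination (norm := skip) α • hZ + hD * E' - r • (E' * hD)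
    - r • (h5 * (E * E' - s • (E' * E)))
  simp only [mul_add, add_mul, mul_sub, sub_mul, smul_mul_assoc, mul_smul_comm, smul_smul,
      mul_assoc, smul_add, smul_sub, smul_zero, mul_zero, zero_mul]
  match_scalars <;> first | ring1 | (field_simp; ring1) | field_simp

theorem borel (G : GaussHalf n r s x xi) (hr : r ≠ 0) (hs : s ≠ 0) (hne : r ≠ s) :
    Borel r s (fun i => x i i) (diagRatio x xi) (rootVec r s x xi) where
  k_comm := G.diag_comm hr hs
  h_comm i j := by
    simp only [diagRatio]
    rw [mul_assoc, G.diag_comm hr hs, ← mul_assoc, ← G.diag_inv_comm hr hs, mul_assoc]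
  k_h j := by
    simp only [diagRatio]
    rcases lt_or_ge j n with h | h
    · rw [← mul_assoc, G.mul_inv j h, one_mul]
    · simp [G.zero_row _ _ h, G.zero_row (j + 1) _ (by omega)]
  k_e := G.diag_e hr hs
  h_e i j := by
    simp only [diagRatio]
    rw [mul_assoc, G.diag_e hr hs, mul_smul_comm, ← mul_assoc, G.inv_e hr hs, smul_mul_assoc,
      smul_smul, hwt_eq hr hs, mul_assoc]
  e_comm := G.e_comm hr hs
  serre_left i := by
    rcases lt_or_ge i n with hi | hi
    · exact G.serre_left hr hs hne i hi rfl rfl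
    · simp [G.e_of_le hi]
  serre_right i := by
    rcases lt_or_ge (i + 1) n with hi | hi
    · exact G.serre_right hr hs hne i hi rfl rfl
    · simp [G.e_of_le hi]

/-- Consequently the diagonal and the root vectors determine the whole matrix; this makes the
composite on `U(R)` the identity. -/
theorem eq_upper (G : GaussHalf n r s x xi) (hr : r ≠ 0) (hs : s ≠ 0) (hne : r ≠ s) (i j : ℕ) :
    x i j = upper s (fun i => x i i) (rootVec r s x xi) i j :=
  TwoParam.eq_upper _ _ _ G.tri (fun _ => rfl) (fun _ _ h => G.succ hr hs hne h) i j

end GaussHalf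
end

/-! ### Pairs of triangular matrices and the commutator of opposite root vectors -/

noncomputable section

variable {A : Type*} [Ring A] [Algebra ℂ A]

/-- A pair of triangular matrices satisfying all RTT relations. -/
structure GaussPair (n : ℕ) (r s : ℂ) (x y : ℕ → ℕ → A) (xi yi : ℕ → A) : Prop where
  pos : GaussHalf n r s x xi
  neg : GaussHalf n s r (fun i j => op (y j i)) (fun i => op (yi i))
  rtt : RTT r s x y

/-- The root vector `f_j` of a lower triangular matrix. -/
def negRootVec (r s : ℂ) (y : ℕ → ℕ → A) (yi : ℕ → A) (j : ℕ) : A :=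
  (s / (s - r)) • (y (j + 1) j * yi j)

/-- The ratio of two consecutive diagonal entries of a lower triangular matrix. -/
def negDiagRatio (y : ℕ → ℕ → A) (yi : ℕ → A) (j : ℕ) : A := y (j + 1) (j + 1) * yi j

/-- The diagonal entries of `y` act by weights on the superdiagonal entries of `x`. -/
theorem RTT.diag_super {r s : ℂ} (hr : r ≠ 0) (hs : s ≠ 0) {x y : ℕ → ℕ → A} (h : RTT r s x y)
    (hy : ∀ i j, i < j → y i j = 0) (i j : ℕ) :
    y i i * x j (j + 1) = wt s r i j • (x j (j + 1) * y i i) := by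
  have h := h j i (j + 1) i
  have h1 : (if j < i then (s - r) • (x i (j + 1) * y j i) else 0) = 0 := by
    split_ifs with h
    · simp [hy j i h]
    · rfl
  have h2 : (if i < j + 1 then (s - r) • (y i (j + 1) * x j i) else 0) = 0 := by
    split_ifs with h
    · simp [hy i (j + 1) h]
    · rfl
  rw [h1, h2, add_zero, add_zero] at h
  have e : dg s (r * s) i j = dg s (r * s) i (j + 1) * wt s r i j := by
    simp only [wt, dg]
    split_ifs <;> first | omega | ring1
  rw [e, ← smul_smul] at h
  exact (smul_right_injective A (dg_ne_zero hs (mul_ne_zero hr hs) i (j + 1)) h).symm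

namespace GaussPair
variable {n : ℕ} {r s : ℂ} {x y : ℕ → ℕ → A} {xi yi : ℕ → A}

theorem tri_neg (G : GaussPair n r s x y xi yi) (i j : ℕ) (h : i < j) : y i j = 0 :=
  op_injective (G.neg.tri j i h)

theorem rtt_op (G : GaussPair n r s x y xi yi) (hr : r ≠ 0) (hs : s ≠ 0) :
    RTT s r (fun i j => op (y j i)) (fun i j => op (x j i)) :=
  (G.rtt.inv hr hs).transpose_op

theorem neg_inv_mul (G : GaussPair n r s x y xi yi) (i : ℕ) (h : i < n) : yi i * y i i = 1 :=
  op_injective (G.neg.mul_inv i h)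

theorem neg_mul_inv (G : GaussPair n r s x y xi yi) (i : ℕ) (h : i < n) : y i i * yi i = 1 :=
  op_injective (G.neg.inv_mul i h)

theorem diag_diag (G : GaussPair n r s x y xi yi) (hr : r ≠ 0) (hs : s ≠ 0) (i j : ℕ) :
    x i i * y j j = y j j * x i i := by
  have h := G.rtt i j i j
  have h1 : (if i < j then (s - r) • (x j i * y i j) else 0) = 0 := by
    split_ifs with h
    · simp [G.tri_neg i j h]
    · rfl
  have h2 : (if j < i then (s - r) • (y j i * x i j) else 0) = 0 := by
    split_ifs with h
    · simp [G.tri_neg j i h]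
    · rfl
  rw [h1, h2, add_zero, add_zero] at h
  exact smul_right_injective A (dg_ne_zero hs (mul_ne_zero hr hs) j i) h

theorem neg_diag_super (G : GaussPair n r s x y xi yi) (hr : r ≠ 0) (hs : s ≠ 0) (i j : ℕ) :
    y i i * x j (j + 1) = wt s r i j • (x j (j + 1) * y i i) :=
  G.rtt.diag_super hr hs G.tri_neg i j

theorem diag_neg_super (G : GaussPair n r s x y xi yi) (hr : r ≠ 0) (hs : s ≠ 0) (i j : ℕ) :
    y (j + 1) j * x i i = wt r s i j • (x i i * y (j + 1) j) := by
  have := (G.rtt_op hr hs).diag_super hs hr (fun i j h => congrArg op (G.pos.tri j i h)) i j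
  simpa using congrArg unop this

theorem neg_inv_weight (G : GaussPair n r s x y xi yi) {z : A} {c : ℂ} (hc : c ≠ 0) {i : ℕ}
    (h : y i i * z = c • (z * y i i)) : yi i * z = c⁻¹ • (z * yi i) := by
  rcases lt_or_ge i n with hi | hi
  · exact TwoParam.inv_weight hc (G.neg_inv_mul i hi) (G.neg_mul_inv i hi) h
  · rw [show yi i = 0 from op_injective (G.neg.zero_inv i hi)]
    simp

theorem diag_negInv (G : GaussPair n r s x y xi yi) (hr : r ≠ 0) (hs : s ≠ 0) (i j : ℕ) :
    x i i * yi j = yi j * x i i := by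
  simpa using (G.neg_inv_weight one_ne_zero (i := j) (z := x i i)
    (by simpa using (G.diag_diag hr hs i j).symm)).symm

theorem inv_negInv (G : GaussPair n r s x y xi yi) (hr : r ≠ 0) (hs : s ≠ 0) (i j : ℕ) :
    xi i * yi j = yi j * xi i :=
  G.pos.inv_comm (G.diag_negInv hr hs i j)

theorem inv_neg_diag (G : GaussPair n r s x y xi yi) (hr : r ≠ 0) (hs : s ≠ 0) (i j : ℕ) :
    xi i * y j j = y j j * xi i :=
  G.pos.inv_comm (G.diag_diag hr hs i j)

theorem neg_diag_e (G : GaussPair n r s x y xi yi) (hr : r ≠ 0) (hs : s ≠ 0) (i j : ℕ) :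
    y i i * rootVec r s x xi j = wt s r i j • (rootVec r s x xi j * y i i) := by
  simp only [rootVec, mul_smul_comm, smul_mul_assoc]
  rw [← mul_assoc, ← G.inv_neg_diag hr hs, mul_assoc, G.neg_diag_super hr hs, mul_smul_comm,
    mul_assoc, smul_comm]

/-- The commutator of the root vectors. -/
theorem e_f (G : GaussPair n r s x y xi yi) (hr : r ≠ 0) (hs : s ≠ 0) (hne : r ≠ s) (i j : ℕ) :
    rootVec r s x xi i * negRootVec r s y yi j - negRootVec r s y yi j * rootVec r s x xi i =
      if i = j then (r - s)⁻¹ • (negDiagRatio y yi i - diagRatio x xi i) else 0 := by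
  have hd : r - s ≠ 0 := sub_ne_zero.2 hne
  have hd' : s - r ≠ 0 := sub_ne_zero.2 hne.symm
  have h0 := G.rtt i (j + 1) (i + 1) j
  have h1 := G.neg_inv_weight (wt_ne_zero hs hr j i) (G.neg_diag_super hr hs j i)
  have h2 : y (j + 1) j * xi i = (wt r s i j)⁻¹ • (xi i * y (j + 1) j) := by
    have hw := wt_ne_zero hr hs i j
    have := G.pos.inv_weight (i := i) (z := y (j + 1) j) (inv_ne_zero hw)
      (by rw [G.diag_neg_super hr hs, smul_smul, inv_mul_cancel₀ hw, one_smul])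
    rw [this, inv_inv, smul_smul, inv_mul_cancel₀ hw, one_smul]
  have h3 := G.inv_negInv hr hs i j
  -- Moving the diagonal inverses to the two ends turns the commutator into a weighted commutator of
  -- `x_{i,i+1}` and `y_{j+1,j}`, which the RTT entry `h0` controls.
  have hc : rootVec r s x xi i * negRootVec r s y yi j - negRootVec r s y yi j * rootVec r s x xi i =
      (r / (r - s) * (s / (s - r))) • (xi i * (x i (i + 1) * y (j + 1) j
        - ((wt s r j i)⁻¹ * (wt r s i j)⁻¹) • (y (j + 1) j * x i (i + 1))) * yi j) := by
    simp only [rootVec, negRootVec]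
    generalize wt s r j i = c at *
    generalize wt r s i j = d at *
    generalize x i (i + 1) = X at *
    generalize y (j + 1) j = Y at *
    linear_combination (norm := skip) (r / (r - s) * (s / (s - r))) • (Y * h3 * X)
      - (r / (r - s) * (s / (s - r)) * c⁻¹) • (h2 * X * yi j)
      - (r / (r - s) * (s / (s - r))) • (Y * xi i * h1)
    simp only [mul_add, add_mul, mul_sub, sub_mul, smul_mul_assoc, mul_smul_comm, smul_smul,
      mul_assoc, smul_add, smul_sub, smul_zero, mul_zero, zero_mul]
    module
  rw [hc]
  clear hc h1 h2 h3
  -- For `i ≠ j` the correction terms of `h0` vanish, by triangularity of `x` or by their index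
  -- condition. For `i = j` both survive and give the Cartan part.
  have hz : i ≠ j → x i (i + 1) * y (j + 1) j
        - ((wt s r j i)⁻¹ * (wt r s i j)⁻¹) • (y (j + 1) j * x i (i + 1)) = 0 := by
    intro hij
    rcases (by omega : (i < j ∧ j ≠ i + 1) ∨ j = i + 1 ∨ i = j + 1 ∨ (j + 1 < i)) with
      ⟨hij, hij'⟩ | rfl | rfl | hij
    · simp only [wt, dg, show ¬ j + 1 < i by omega, show j + 1 ≠ i by omega, show ¬ j < i + 1 by omega,
        hij', hij.ne, hij.ne', show i ≠ j + 1 by omega, show i < j + 1 by omega,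
        show ¬ i + 1 = j by omega, show i + 1 < j by omega,
        G.pos.tri (j + 1) (i + 1) (by omega), zero_mul, smul_zero, if_true, if_false] at *
      linear_combination (norm := skip) (r * s)⁻¹ • h0
      match_scalars <;> first | ring1 | (field_simp; ring1) | field_simp
    · simp only [wt, dg, show ¬ i + 1 + 1 < i by omega, show i + 1 + 1 ≠ i by omega, lt_irrefl,
        show i + 1 ≠ i by omega, show i ≠ i + 1 by omega, show i ≠ i + 1 + 1 by omega,
        show i < i + 1 + 1 by omega,
        G.pos.tri (i + 1 + 1) (i + 1) (by omega), zero_mul, smul_zero, if_true, if_false] at *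
      linear_combination (norm := skip) (r * s)⁻¹ • h0
      match_scalars <;> first | ring1 | (field_simp; ring1) | field_simp
    · simp only [wt, dg, show j < j + 1 + 1 by omega, lt_irrefl, show j ≠ j + 1 by omega,
        show j ≠ j + 1 + 1 by omega, show j + 1 ≠ j by omega,
        G.pos.tri (j + 1) j (by omega), mul_zero, smul_zero, if_true, if_false] at *
      linear_combination (norm := skip) s⁻¹ • h0
      match_scalars <;> first | ring1 | (field_simp; ring1) | field_simp
    · simp only [wt, dg, hij, show j < i + 1 by omega, show ¬ i < j + 1 by omega, hij.ne',
        show ¬ j = i by omega, show i ≠ j by omega, show j ≠ i + 1 by omega,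
        G.pos.tri i j (by omega), mul_zero, smul_zero, if_true, if_false] at *
      linear_combination (norm := skip) h0
      match_scalars <;> first | ring1 | (field_simp; ring1) | field_simp
  rcases eq_or_ne i j with rfl | hij
  swap
  · rw [hz hij, if_neg hij]
    simp
  clear hz
  rw [if_pos rfl]
  simp only [negDiagRatio, diagRatio]
  rcases lt_or_ge i n with hi | hi
  swap
  · rw [G.pos.zero_inv i hi, show yi i = 0 from op_injective (G.neg.zero_inv i hi)]
    simp
  have h4 := G.pos.inv_mul i hi
  have h5 := G.neg_mul_inv i hi
  have h9 := G.diag_diag hr hs i (i + 1)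
  simp only [wt, dg, lt_irrefl, show ¬ i + 1 < i by omega, show i + 1 ≠ i by omega,
    show i < i + 1 by omega, if_true, if_false, one_smul] at *
  generalize y (i + 1) (i + 1) = kp at *
  generalize x (i + 1) (i + 1) = k at *
  generalize x i i = k0 at *
  generalize y i i = kp0 at *
  generalize xi i = a at *
  generalize yi i = b at *
  generalize x i (i + 1) = X at *
  generalize y (i + 1) i = Y at *
  have h11 : a * (kp * k0 - k * kp0) * b = kp * b - a * k := by
    linear_combination (norm := noncomm_ring) -(a * h9 * b) + h4 * (kp * b) - (a * k) * h5
  -- The normalisations of the root vectors are such that `r / (r - s) * (s / (s - r)) * (r * s)⁻¹ *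
  -- (s - r) = (r - s)⁻¹`.
  linear_combination (norm := skip)
    (r / (r - s) * (s / (s - r)) * (r * s)⁻¹) • (a * h0 * b) + (r - s)⁻¹ • h11
  simp only [mul_add, add_mul, mul_sub, sub_mul, smul_mul_assoc, mul_smul_comm, smul_smul,
      mul_assoc, smul_add, smul_sub, smul_zero, mul_zero, zero_mul]
  match_scalars <;> first | ring1 | (field_simp; ring1) | field_simp

theorem quantumGL (G : GaussPair n r s x y xi yi) (hr : r ≠ 0) (hs : s ≠ 0) (hne : r ≠ s) :
    QuantumGL r s (fun i => x i i) (fun i => y i i) (diagRatio x xi) (negDiagRatio y yi)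
      (rootVec r s x xi) (negRootVec r s y yi) where
  pos := G.pos.borel hr hs hne
  neg := G.neg.borel hs hr hne.symm
  k_k' := G.diag_diag hr hs
  k'_e := G.neg_diag_e hr hs
  f_k i j := by
    simp only [negRootVec, mul_smul_comm, smul_mul_assoc]
    rw [mul_assoc, ← G.diag_negInv hr hs, ← mul_assoc, G.diag_neg_super hr hs, smul_mul_assoc,
      mul_assoc, smul_comm]
  g_e i j := by
    have h1 := G.neg_inv_weight (wt_ne_zero hs hr i j) (G.neg_diag_e hr hs i j)
    simp only [negDiagRatio]
    rw [mul_assoc, h1, mul_smul_comm, ← mul_assoc, G.neg_diag_e hr hs, smul_mul_assoc,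
      smul_smul, hwt_eq hs hr, mul_assoc, mul_comm]
  k_g i j := by
    simp only [negDiagRatio]
    rw [← mul_assoc, G.diag_diag hr hs, mul_assoc, G.diag_negInv hr hs, mul_assoc]
  e_f := G.e_f hr hs hne

theorem eq_lower (G : GaussPair n r s x y xi yi) (hr : r ≠ 0) (hs : s ≠ 0) (hne : r ≠ s) (i j : ℕ) :
    y i j = lower r (fun i => y i i) (negRootVec r s y yi) i j :=
  congrArg unop (G.neg.eq_upper hs hr hne.symm j i)

end GaussPair
end

noncomputable section

/-! ### Entries of the matrix relations -/

theorem RPlus_apply (n : ℕ) (r s : ℂ) (i j k l : Fin n) :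
    RPlus n r s (i, j) (k, l) = (if k = i ∧ l = j then dg s (r * s) j i else 0)
      + (if k = j ∧ l = i then (if i < j then s - r else 0) else 0) := by
  have e1 : ∀ (p : Fin n → Fin n → Prop) [∀ a b, Decidable (p a b)],
      (∑ a, ∑ b, if p a b then Matrix.kronecker (Matrix.single a a (1 : ℂ))
        (Matrix.single b b (1 : ℂ)) else 0) (i, j) (k, l) =
      if k = i ∧ l = j then (if p i j then 1 else 0) else 0 := by
    intro p _
    simp only [Matrix.sum_apply]
    rw [Finset.sum_eq_single i, Finset.sum_eq_single j]
    · by_cases hp : p i j <;> by_cases h1 : k = i <;> by_cases h2 : l = j <;>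
        simp [hp, h1, h2, Matrix.kroneckerMap_apply, Matrix.single_apply, @eq_comm _ i k,
          @eq_comm _ j l]
    · intro b _ hb
      split_ifs <;> simp [Matrix.kroneckerMap_apply, Matrix.single_apply, hb]
    · simp
    · intro a _ ha
      refine Finset.sum_eq_zero fun b _ => ?_
      split_ifs <;> simp [Matrix.kroneckerMap_apply, Matrix.single_apply, ha]
    · simp
  have e2 : (∑ a : Fin n, ∑ b : Fin n, if a < b then Matrix.kronecker (Matrix.single a b (1 : ℂ))
        (Matrix.single b a (1 : ℂ)) else 0) (i, j) (k, l) =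
      if k = j ∧ l = i then (if i < j then 1 else 0) else 0 := by
    simp only [Matrix.sum_apply]
    rw [Finset.sum_eq_single i, Finset.sum_eq_single j]
    · by_cases hp : i < j <;> by_cases h1 : k = j <;> by_cases h2 : l = i <;>
        simp [hp, h1, h2, Matrix.kroneckerMap_apply, Matrix.single_apply, @eq_comm _ i l,
          @eq_comm _ j k]
    · intro b _ hb
      split_ifs <;> simp [Matrix.kroneckerMap_apply, Matrix.single_apply, hb]
    · simp
    · intro a _ ha
      refine Finset.sum_eq_zero fun b _ => ?_
      split_ifs <;> simp [Matrix.kroneckerMap_apply, Matrix.single_apply, ha]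
    · simp
  have e0 : (∑ a : Fin n, Matrix.kronecker (Matrix.single a a (1 : ℂ))
        (Matrix.single a a (1 : ℂ))) (i, j) (k, l) =
      if k = i ∧ l = j then (if i = j then 1 else 0) else 0 := by
    simp only [Matrix.sum_apply]
    rw [Finset.sum_eq_single i]
    · by_cases h1 : k = i <;> by_cases h2 : l = j <;> by_cases hp : i = j <;>
        simp [hp, h1, h2, Matrix.kroneckerMap_apply, Matrix.single_apply, @eq_comm _ i k,
          @eq_comm _ i l]
      all_goals clear e1 e2; grind
    · intro a _ ha
      simp [Matrix.kroneckerMap_apply, Matrix.single_apply, ha]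
    · simp
  simp only [RPlus, Matrix.add_apply, Matrix.smul_apply]
  erw [e0, e1 (fun a b => a < b), e1 (fun a b => b < a), e2]
  simp only [dg, Fin.lt_def, Fin.ext_iff]
  rcases lt_trichotomy (i : ℕ) j with h | h | h
  · simp only [h, h.not_gt, h.ne, h.ne', if_true, if_false]
    split_ifs <;> simp
  · simp only [h, lt_irrefl, if_true, if_false]
    split_ifs <;> simp
  · simp only [h, h.not_gt, h.ne, h.ne', if_true, if_false]
    split_ifs <;> simp

variable {B : Type} [Ring B] {n : ℕ}

theorem leg1_mul_leg2_apply (L M : Matrix (Fin n) (Fin n) B) (i j k l : Fin n) :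
    (leg1 L * leg2 M) (i, j) (k, l) = L i k * M j l := by
  simp [leg1, leg2, Matrix.mul_apply, Fintype.sum_prod_type, Matrix.kroneckerMap_apply,
    Matrix.one_apply]

theorem leg2_mul_leg1_apply (L M : Matrix (Fin n) (Fin n) B) (i j k l : Fin n) :
    (leg2 M * leg1 L) (i, j) (k, l) = M j l * L i k := by
  simp [leg1, leg2, Matrix.mul_apply, Fintype.sum_prod_type, Matrix.kroneckerMap_apply,
    Matrix.one_apply]

variable [Algebra ℂ B]

theorem R_mul_legs_apply (r s : ℂ) (L M : Matrix (Fin n) (Fin n) B) (i j k l : Fin n) :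
    ((RPlus n r s).map (algebraMap ℂ B) * leg1 L * leg2 M) (i, j) (k, l) =
      dg s (r * s) j i • (L i k * M j l) + if i < j then (s - r) • (L j k * M i l) else 0 := by
  rw [Matrix.mul_assoc, Matrix.mul_apply]
  simp only [Fintype.sum_prod_type, leg1_mul_leg2_apply, Matrix.map_apply, RPlus_apply, map_add,
    add_mul, Finset.sum_add_distrib]
  congr 1
  · rw [Finset.sum_eq_single i, Finset.sum_eq_single j]
    · simp [Algebra.smul_def]
    · intro b _ hb; simp [hb]
    · simp
    · intro a _ ha; simp [ha]
    · simp
  · rw [Finset.sum_eq_single j, Finset.sum_eq_single i]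
    · split_ifs <;> simp [Algebra.smul_def] at *
    · intro b _ hb; simp [hb]
    · simp
    · intro a _ ha; simp [ha]
    · simp

theorem legs_mul_R_apply (r s : ℂ) (L M : Matrix (Fin n) (Fin n) B) (i j k l : Fin n) :
    (leg2 M * leg1 L * (RPlus n r s).map (algebraMap ℂ B)) (i, j) (k, l) =
      dg s (r * s) l k • (M j l * L i k) + if l < k then (s - r) • (M j k * L i l) else 0 := by
  rw [Matrix.mul_apply]
  simp only [Fintype.sum_prod_type, leg2_mul_leg1_apply, Matrix.map_apply, RPlus_apply, map_add,
    mul_add, Finset.sum_add_distrib]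
  congr 1
  · rw [Finset.sum_eq_single k, Finset.sum_eq_single l]
    · simp [Algebra.smul_def, Algebra.commutes]
    · intro b _ hb; simp [hb.symm]
    · simp
    · intro a _ ha; simp [ha.symm]
    · simp
  · rw [Finset.sum_eq_single l, Finset.sum_eq_single k]
    · split_ifs <;> simp [Algebra.smul_def, -map_sub, ← Algebra.commutes] at *
    · intro b _ hb; simp [hb.symm]
    · simp
    · intro a _ ha; simp [ha.symm]
    · simp

/-! ### The algebra `U(R)` -/

section
variable {B : Type} [Ring B]

/-- Extension of a finite matrix by zero. -/
def ext0 (M : Matrix (Fin n) (Fin n) B) (i j : ℕ) : B :=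
  if h : i < n ∧ j < n then M ⟨i, h.1⟩ ⟨j, h.2⟩ else 0

theorem ext0_val (M : Matrix (Fin n) (Fin n) B) (i j : Fin n) : ext0 M i j = M i j := by
  simp [ext0]

end

/-- Each of the four products involves all of `i`, `j`, `k`, `l`, so every term vanishes as soon as
one index is out of range. -/
theorem rtt_ext0 {r s : ℂ} {L M : Matrix (Fin n) (Fin n) B}
    (h : ∀ i j k l : Fin n,
      dg s (r * s) j i • (L i k * M j l) + (if i < j then (s - r) • (L j k * M i l) else 0) =
        dg s (r * s) l k • (M j l * L i k) + if l < k then (s - r) • (M j k * L i l) else 0) :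
    RTT r s (ext0 L) (ext0 M) := by
  intro i j k l
  by_cases hi : i < n
  swap
  · simp [ext0, hi]
  by_cases hj : j < n
  swap
  · simp [ext0, hj]
  by_cases hk : k < n
  swap
  · simp [ext0, hk]
  by_cases hl : l < n
  swap
  · simp [ext0, hl]
  simpa [ext0, hi, hj, hk, hl] using h ⟨i, hi⟩ ⟨j, hj⟩ ⟨k, hk⟩ ⟨l, hl⟩

namespace UR
variable (r s : ℂ)

theorem mk_freeLp (i j : Fin n) : mk n r s (freeLp n i j) = Lp n r s i j := rfl

theorem mk_freeLm (i j : Fin n) : mk n r s (freeLm n i j) = Lm n r s i j := rfl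

/-- The zero-extended inverses of the diagonal entries of `L⁺`. -/
def KpInv (n : ℕ) (i : ℕ) : UR n r s := if h : i < n then ↑(Kp r s ⟨i, h⟩)⁻¹ else 0

/-- The zero-extended inverses of the diagonal entries of `L⁻`. -/
def KmInv (n : ℕ) (i : ℕ) : UR n r s := if h : i < n then ↑(Km r s ⟨i, h⟩)⁻¹ else 0

theorem rtt_pp : RTT r s (ext0 (Lp n r s)) (ext0 (Lp n r s)) := by
  refine rtt_ext0 fun i j k l => ?_
  have h := RingQuot.mkAlgHom_rel ℂ (FRTRel.pp (r := r) (s := s) (i, j) (k, l))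
  rw [freeR, R_mul_legs_apply, legs_mul_R_apply] at h
  change mk n r s _ = mk n r s _ at h
  split_ifs at h ⊢ <;> simpa [mk_freeLp] using h

theorem rtt_mm : RTT r s (ext0 (Lm n r s)) (ext0 (Lm n r s)) := by
  refine rtt_ext0 fun i j k l => ?_
  have h := RingQuot.mkAlgHom_rel ℂ (FRTRel.mm (r := r) (s := s) (i, j) (k, l))
  rw [freeR, R_mul_legs_apply, legs_mul_R_apply] at h
  change mk n r s _ = mk n r s _ at h
  split_ifs at h ⊢ <;> simpa [mk_freeLm] using h

theorem rtt_pm : RTT r s (ext0 (Lp n r s)) (ext0 (Lm n r s)) := by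
  refine rtt_ext0 fun i j k l => ?_
  have h := RingQuot.mkAlgHom_rel ℂ (FRTRel.pm (r := r) (s := s) (i, j) (k, l))
  rw [freeR, R_mul_legs_apply, legs_mul_R_apply] at h
  change mk n r s _ = mk n r s _ at h
  split_ifs at h ⊢ <;> simpa [mk_freeLm, mk_freeLp] using h

theorem gaussPair (hr : r ≠ 0) (hs : s ≠ 0) :
    GaussPair n r s (ext0 (Lp n r s)) (ext0 (Lm n r s)) (KpInv r s n) (KmInv r s n) where
  pos :=
    { rtt := rtt_pp r s
      tri := fun i j h => by
        unfold ext0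
        split_ifs with hij
        · simp [Lp, freeLp, h.not_ge]
        · rfl
      inv_mul := fun i h => by
        simp only [KpInv, ext0, h, and_self, dif_pos]
        exact (Kp r s ⟨i, h⟩).inv_mul
      mul_inv := fun i h => by
        simp only [KpInv, ext0, h, and_self, dif_pos]
        exact (Kp r s ⟨i, h⟩).mul_inv
      zero_inv := fun i h => by simp [KpInv, h.not_gt]
      zero_row := fun i j h => by simp [ext0, h.not_gt]
      zero_col := fun i j h => by simp [ext0, h.not_gt] }
  neg :=
    { rtt := ((rtt_mm r s).inv hr hs).transpose_op
      tri := fun i j h => by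
        rw [op_eq_zero_iff]
        unfold ext0
        split_ifs with hij
        · simp [Lm, freeLm, h.not_ge]
        · rfl
      inv_mul := fun i h => by
        rw [← op_mul, op_eq_one_iff]
        simp only [KmInv, ext0, h, and_self, dif_pos]
        exact (Km r s ⟨i, h⟩).mul_inv
      mul_inv := fun i h => by
        rw [← op_mul, op_eq_one_iff]
        simp only [KmInv, ext0, h, and_self, dif_pos]
        exact (Km r s ⟨i, h⟩).inv_mul
      zero_inv := fun i h => by simp [KmInv, h.not_gt]
      zero_row := fun i j h => by simp [ext0, h.not_gt]
      zero_col := fun i j h => by simp [ext0, h.not_gt] }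
  rtt := rtt_pm r s

end UR

end

noncomputable section

/-! ### The algebra `U_{r,s}(gl_n)` in terms of Gauss generators -/

section
variable {A : Type*} [Ring A]

/-- The product of the `a m * b m` for `m < i`. -/
def cartanProd (a b : ℕ → A) : ℕ → A
  | 0 => 1
  | i + 1 => cartanProd a b i * (a i * b i)

theorem cartanProd_comm {a b : ℕ → A} {z : A} (ha : ∀ i, a i * z = z * a i)
    (hb : ∀ i, b i * z = z * b i) (i : ℕ) : cartanProd a b i * z = z * cartanProd a b i := by
  induction i with
  | zero => simp [cartanProd]
  | succ i ih =>
    rw [cartanProd, mul_assoc, mul_assoc, hb, ← mul_assoc (a i), ha, mul_assoc z, ← mul_assoc, ih,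
      mul_assoc]

variable [Algebra ℂ A]

/-- The weight of `a_i` on `e_j`. -/
def awt (r : ℂ) (i j : ℕ) : ℂ := if i = j then r else if i = j + 1 then r⁻¹ else 1

theorem awt_ne_zero {r : ℂ} (hr : r ≠ 0) (i j : ℕ) : awt r i j ≠ 0 := by
  unfold awt; split_ifs <;> simp [hr]

/-- The relations among `a i`, `b i`, `e j` in `U_{r,s}(gl_n)`, extended by zero. -/
structure ChevalleyHalf (r s : ℂ) (a b e : ℕ → A) : Prop where
  a_a : ∀ i j, a i * a j = a j * a i
  a_b : ∀ i j, a i * b j = b j * a i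
  b_b : ∀ i j, b i * b j = b j * b i
  a_e : ∀ i j, a i * e j = awt r i j • (e j * a i)
  b_e : ∀ i j, b i * e j = awt s i j • (e j * b i)
  e_comm : ∀ i j, i + 1 < j → e i * e j = e j * e i
  serre_left : ∀ i, e i * (e i * e (i + 1)) - (r + s) • (e i * (e (i + 1) * e i))
    + (r * s) • (e (i + 1) * (e i * e i)) = 0
  serre_right : ∀ i, e i * (e (i + 1) * e (i + 1)) - (r + s) • (e (i + 1) * (e i * e (i + 1)))
    + (r * s) • (e (i + 1) * (e (i + 1) * e i)) = 0

namespace ChevalleyHalf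
variable {r s : ℂ} {a b e : ℕ → A}

theorem prod_a (C : ChevalleyHalf r s a b e) (i j : ℕ) :
    cartanProd a b i * a j = a j * cartanProd a b i :=
  cartanProd_comm (fun m => C.a_a m j) (fun m => (C.a_b j m).symm) i

theorem prod_b (C : ChevalleyHalf r s a b e) (i j : ℕ) :
    cartanProd a b i * b j = b j * cartanProd a b i :=
  cartanProd_comm (fun m => C.a_b m j) (fun m => C.b_b m j) i

theorem prod_prod (C : ChevalleyHalf r s a b e) (i j : ℕ) :
    cartanProd a b i * cartanProd a b j = cartanProd a b j * cartanProd a b i :=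
  cartanProd_comm (fun m => (C.prod_a j m).symm) (fun m => (C.prod_b j m).symm) i

/-- Only the factors `a_j b_j` and `a_{j+1} b_{j+1}` act nontrivially on `e_j`, with weights `r s`
and `(r s)⁻¹`. They cancel unless the product stops between them. -/
theorem prod_e (C : ChevalleyHalf r s a b e) (hr : r ≠ 0) (hs : s ≠ 0) (i j : ℕ) :
    cartanProd a b i * e j = (if i = j + 1 then r * s else 1 : ℂ) • (e j * cartanProd a b i) := by
  induction i with
  | zero => simp [cartanProd]
  | succ i ih =>
    rw [cartanProd, mul_assoc, mul_assoc, C.b_e, mul_smul_comm, ← mul_assoc (a i), C.a_e,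
      smul_mul_assoc, mul_smul_comm, mul_smul_comm, mul_assoc, ← mul_assoc, ih, smul_mul_assoc,
      smul_smul, smul_smul]
    simp only [mul_assoc]
    congr 1
    simp only [awt]
    split_ifs <;> first | omega | field_simp

/-- The product is passed as a separate `P` so that the result also applies in the opposite algebra,
where `P` is the image of the original product and equals the new one only by commutativity
(`Chevalley.op_prod`). -/
theorem borel (C : ChevalleyHalf r s a b e) (hr : r ≠ 0) (hs : s ≠ 0) {P : ℕ → A}
    (hP : ∀ i, P i = cartanProd a b i) :
    Borel r s (fun i => a i * P i) (fun i => a (i + 1) * b i) e where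
  k_comm i j := by
    simp only [hP]
    linear_combination (norm := noncomm_ring) a i * C.prod_a i j * cartanProd a b j
      + C.a_a i j * cartanProd a b i * cartanProd a b j + a j * a i * C.prod_prod i j
      - a j * C.prod_a j i * cartanProd a b i
  h_comm i j := by
    simp only [hP]
    linear_combination (norm := noncomm_ring) -(a (i + 1) * C.a_b j i * cartanProd a b j)
      + C.a_a (i + 1) j * b i * cartanProd a b j - a j * a (i + 1) * C.prod_b j i
      - a j * C.prod_a j (i + 1) * b i
  k_h j := by
    simp only [hP, cartanProd]
    linear_combination (norm := noncomm_ring) a j * C.prod_a j (j + 1) * b j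
      + C.a_a j (j + 1) * cartanProd a b j * b j - a (j + 1) * C.prod_a j j * b j
  k_e i j := by
    simp only [hP]
    rw [mul_assoc, C.prod_e hr hs, mul_smul_comm, ← mul_assoc, C.a_e, smul_mul_assoc, smul_smul,
      mul_assoc]
    congr 1
    simp only [awt, wt]
    split_ifs <;> first | omega | field_simp
  h_e i j := by
    rw [mul_assoc, C.b_e, mul_smul_comm, ← mul_assoc, C.a_e, smul_mul_assoc, smul_smul, mul_assoc]
    congr 1
    simp only [awt, hwt]
    split_ifs <;> first | omega | field_simp
  e_comm := C.e_comm
  serre_left := C.serre_left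
  serre_right := C.serre_right

end ChevalleyHalf

/-- The relations of `U_{r,s}(gl_n)`, extended by zero. -/
structure Chevalley (r s : ℂ) (a b e f : ℕ → A) : Prop where
  pos : ChevalleyHalf r s a b e
  neg : ChevalleyHalf s r (fun i => op (b i)) (fun i => op (a i)) (fun i => op (f i))
  e_f : ∀ i j, e i * f j - f j * e i =
    if i = j then (r - s)⁻¹ • (a i * b (i + 1) - a (i + 1) * b i) else 0

namespace Chevalley
variable {r s : ℂ} {a b e f : ℕ → A}

theorem op_prod (C : Chevalley r s a b e f) (i : ℕ) :
    op (cartanProd a b i) = cartanProd (fun i => op (b i)) (fun i => op (a i)) i := by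
  induction i with
  | zero => rfl
  | succ i ih =>
    rw [cartanProd, cartanProd, ← ih, ← op_mul, ← op_mul]
    congr 1
    rw [← mul_assoc, C.pos.prod_a, mul_assoc, C.pos.prod_b, ← mul_assoc]

theorem quantumGL (C : Chevalley r s a b e f) (hr : r ≠ 0) (hs : s ≠ 0) :
    QuantumGL r s (fun i => a i * cartanProd a b i) (fun i => b i * cartanProd a b i)
      (fun i => a (i + 1) * b i) (fun i => a i * b (i + 1)) e f where
  pos := C.pos.borel hr hs fun _ => rfl
  neg := by
    have h := C.neg.borel hs hr (P := fun i => op (cartanProd a b i)) C.op_prod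
    convert h using 2 with i i
    · rw [← op_mul, C.pos.prod_b]
    · rfl
  k_k' i j := by
    linear_combination (norm := noncomm_ring) a i * C.pos.prod_b i j * cartanProd a b j
      + C.pos.a_b i j * cartanProd a b i * cartanProd a b j + b j * a i * C.pos.prod_prod i j
      - b j * C.pos.prod_a j i * cartanProd a b i
  k'_e i j := by
    rw [mul_assoc, C.pos.prod_e hr hs, mul_smul_comm, ← mul_assoc, C.pos.b_e, smul_mul_assoc,
      smul_smul, mul_assoc]
    congr 1
    simp only [awt, wt]
    split_ifs <;> first | omega | field_simp
  f_k i j := by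
    have h1 := C.neg.prod_e hs hr i j
    have h2 := C.neg.b_e i j
    rw [← C.op_prod] at h1
    have h1 := congrArg unop h1
    have h2 := congrArg unop h2
    simp only [unop_mul, unop_smul, unop_op] at h1 h2
    rw [← mul_assoc, h2, smul_mul_assoc, mul_assoc, h1, mul_smul_comm, smul_smul, mul_assoc]
    congr 1
    simp only [awt, wt]
    split_ifs <;> first | omega | field_simp
  g_e i j := by
    rw [mul_assoc, C.pos.b_e, mul_smul_comm, ← mul_assoc, C.pos.a_e, smul_mul_assoc, smul_smul,
      mul_assoc]
    congr 1
    simp only [awt, hwt]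
    split_ifs <;> first | omega | field_simp
  k_g i j := by
    linear_combination (norm := noncomm_ring) a i * C.pos.prod_a i j * b (j + 1)
      + a i * a j * C.pos.prod_b i (j + 1) + C.pos.a_a i j * b (j + 1) * cartanProd a b i 
      + a j * C.pos.a_b i (j + 1) * cartanProd a b i
  e_f := C.e_f

end Chevalley
end

/-! ### Relations in `U_{r,s}(gl_n)` -/

namespace Urs
variable {n : ℕ} (r s : ℂ)

/-- The zero-extended generators `e_j`. -/
def eN (n : ℕ) (j : ℕ) : Urs n r s := if h : j < n - 1 then gen r s (.e ⟨j, h⟩) else 0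
/-- The zero-extended generators `f_j`. -/
def fN (n : ℕ) (j : ℕ) : Urs n r s := if h : j < n - 1 then gen r s (.f ⟨j, h⟩) else 0
/-- The zero-extended generators `a_i`. -/
def aN (n : ℕ) (i : ℕ) : Urs n r s := if h : i < n then gen r s (.a ⟨i, h⟩) else 0
/-- The zero-extended generators `b_i`. -/
def bN (n : ℕ) (i : ℕ) : Urs n r s := if h : i < n then gen r s (.b ⟨i, h⟩) else 0

theorem gen_comm (x y : ChevalleyGen n) (hx : x.IsCartan) (hy : y.IsCartan) :
    gen r s x * gen r s y = gen r s y * gen r s x := by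
  simpa [gen] using RingQuot.mkAlgHom_rel ℂ (ChevalleyRel.r1_comm (r := r) (s := s) x y hx hy)

theorem pairing_eq (i : Fin n) (j : Fin (n - 1)) :
    pairing i j = (if (i : ℕ) = j then 1 else 0) - (if (i : ℕ) = j + 1 then 1 else 0) := by
  simp [pairing, alpha, eps, lo, hi, Pi.single_apply, Fin.ext_iff, @eq_comm ℕ j i, @eq_comm ℕ (j + 1) i]

theorem zpow_pairing {r : ℂ} (hr : r ≠ 0) (i : Fin n) (j : Fin (n - 1)) :
    r ^ pairing i j = awt r i j := by
  rw [pairing_eq]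
  simp only [awt]
  split_ifs <;> first | omega | simp

theorem chevalley (hr : r ≠ 0) (hs : s ≠ 0) :
    Chevalley r s (aN r s n) (bN r s n) (eN r s n) (fN r s n) := by
  have h1 : ∀ i j, aN r s n i * aN r s n j = aN r s n j * aN r s n i := fun i j => by
    unfold aN
    split_ifs
    · exact gen_comm r s _ _ ⟨_, .inl rfl⟩ ⟨_, .inl rfl⟩
    all_goals simp
  have h2 : ∀ i j, aN r s n i * bN r s n j = bN r s n j * aN r s n i := fun i j => by
    unfold aN bN
    split_ifs
    · exact gen_comm r s _ _ ⟨_, .inl rfl⟩ ⟨_, .inr (.inr (.inl rfl))⟩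
    all_goals simp
  have h3 : ∀ i j, bN r s n i * bN r s n j = bN r s n j * bN r s n i := fun i j => by
    unfold bN
    split_ifs
    · exact gen_comm r s _ _ ⟨_, .inr (.inr (.inl rfl))⟩ ⟨_, .inr (.inr (.inl rfl))⟩
    all_goals simp
  refine ⟨⟨h1, h2, h3, fun i j => ?_, fun i j => ?_, fun i j hij => ?_, fun i => ?_, fun i => ?_⟩,
    ⟨fun i j => congrArg op (h3 j i), fun i j => congrArg op (h2 j i),
      fun i j => congrArg op (h1 j i), fun i j => ?_, fun i j => ?_, fun i j hij => ?_,
      fun i => ?_, fun i => ?_⟩, fun i j => ?_⟩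
  · unfold aN eN
    split_ifs with h h'
    · have := RingQuot.mkAlgHom_rel ℂ (ChevalleyRel.r2_e (r := r) (s := s) ⟨i, h⟩ ⟨j, h'⟩)
      rw [zpow_pairing hr] at this
      simpa [gen] using this
    all_goals simp
  · unfold bN eN
    split_ifs with h h'
    · have := RingQuot.mkAlgHom_rel ℂ (ChevalleyRel.r3_e (r := r) (s := s) ⟨i, h⟩ ⟨j, h'⟩)
      rw [zpow_pairing hs] at this
      simpa [gen] using this
    all_goals simp
  · unfold eN
    split_ifs with h h'
    · have := RingQuot.mkAlgHom_rel ℂ (ChevalleyRel.r5_e (r := r) (s := s) ⟨i, h⟩ ⟨j, h'⟩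
        (by simp only; rw [lt_abs]; omega))
      simpa [gen, sub_eq_zero] using this
    all_goals simp
  · unfold eN
    by_cases h : i + 1 < n - 1
    · have := RingQuot.mkAlgHom_rel ℂ (ChevalleyRel.r6_left (r := r) (s := s) ⟨i, by omega⟩
        ⟨i + 1, h⟩ rfl)
      simpa [gen, h, show i < n - 1 by omega, pow_two, mul_assoc] using this
    · simp [h]
  · unfold eN
    by_cases h : i + 1 < n - 1
    · have := RingQuot.mkAlgHom_rel ℂ (ChevalleyRel.r6_right (r := r) (s := s) ⟨i, by omega⟩
        ⟨i + 1, h⟩ rfl)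
      simpa [gen, h, show i < n - 1 by omega, pow_two, mul_assoc] using this
    · simp [h]
  · refine congrArg op (?_ : fN r s n j * bN r s n i = awt s i j • (bN r s n i * fN r s n j))
    unfold bN fN
    split_ifs with h' h
    · have := RingQuot.mkAlgHom_rel ℂ (ChevalleyRel.r3_f (r := r) (s := s) ⟨i, h⟩ ⟨j, h'⟩)
      rw [zpow_neg, zpow_pairing hs] at this
      simp only [map_mul, map_smul] at this
      simp only [gen, this, smul_smul, mul_inv_cancel₀ (awt_ne_zero hs i j), one_smul]
    all_goals simp
  · refine congrArg op (?_ : fN r s n j * aN r s n i = awt r i j • (aN r s n i * fN r s n j))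
    unfold aN fN
    split_ifs with h' h
    · have := RingQuot.mkAlgHom_rel ℂ (ChevalleyRel.r2_f (r := r) (s := s) ⟨i, h⟩ ⟨j, h'⟩)
      rw [zpow_neg, zpow_pairing hr] at this
      simp only [map_mul, map_smul] at this
      simp only [gen, this, smul_smul, mul_inv_cancel₀ (awt_ne_zero hr i j), one_smul]
    all_goals simp
  · refine congrArg op (?_ : fN r s n j * fN r s n i = fN r s n i * fN r s n j)
    unfold fN
    split_ifs with h h'
    · have := RingQuot.mkAlgHom_rel ℂ (ChevalleyRel.r5_f (r := r) (s := s) ⟨j, h⟩ ⟨i, h'⟩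
        (by simp only; rw [lt_abs]; omega))
      simpa [gen, sub_eq_zero] using this
    all_goals simp
  · refine congrArg op (?_ : fN r s n (i + 1) * fN r s n i * fN r s n i
      - (s + r) • (fN r s n i * fN r s n (i + 1) * fN r s n i)
      + (s * r) • (fN r s n i * fN r s n i * fN r s n (i + 1)) = 0)
    unfold fN
    by_cases h : i + 1 < n - 1
    · have := RingQuot.mkAlgHom_rel ℂ (ChevalleyRel.r7_left (r := r) (s := s) ⟨i, by omega⟩
        ⟨i + 1, h⟩ rfl)
      simp only [map_mul, map_smul, map_add, map_sub, map_pow, map_zero, pow_two] at this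
      simp only [gen, h, show i < n - 1 by omega, dif_pos]
      -- The factor `r s` turns the coefficients `1`, `r⁻¹ + s⁻¹`, `r⁻¹ s⁻¹` into `r s`, `r + s`,
      -- `1`: the Serre relation of the positive half read backwards.
      linear_combination (norm := skip) (r * s) • this
      simp only [mul_assoc]
      match_scalars <;> field_simp <;> ring
    · simp [h]
  · refine congrArg op (?_ : fN r s n (i + 1) * fN r s n (i + 1) * fN r s n i
      - (s + r) • (fN r s n (i + 1) * fN r s n i * fN r s n (i + 1))
      + (s * r) • (fN r s n i * fN r s n (i + 1) * fN r s n (i + 1)) = 0)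
    unfold fN
    by_cases h : i + 1 < n - 1
    · have := RingQuot.mkAlgHom_rel ℂ (ChevalleyRel.r7_right (r := r) (s := s) ⟨i, by omega⟩
        ⟨i + 1, h⟩ rfl)
      simp only [map_mul, map_smul, map_add, map_sub, map_pow, map_zero, pow_two] at this
      simp only [gen, h, show i < n - 1 by omega, dif_pos]
      linear_combination (norm := skip) (r * s) • this
      simp only [mul_assoc]
      match_scalars <;> field_simp <;> ring
    · simp [h]
  · unfold eN fN aN bN
    by_cases hi : i < n - 1
    swap
    -- Both Cartan products contain a factor of index `i + 1 ≥ n`, hence vanish together with `e_i`.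
    · simp [hi, show ¬ i + 1 < n by omega]
    by_cases hj : j < n - 1
    swap
    · simp [hj, show i ≠ j by omega]
    have := RingQuot.mkAlgHom_rel ℂ (ChevalleyRel.r4 (r := r) (s := s) ⟨i, hi⟩ ⟨j, hj⟩)
    simp only [map_mul, map_smul, map_sub, Fin.mk.injEq] at this
    simp only [gen, hi, hj, dif_pos, this, show i < n by omega, show i + 1 < n by omega, lo,
      TwoParam.hi]
    split_ifs with h
    · subst h
      simp
    · simp

end Urs
end

noncomputable section

/-! ### Alternating products -/

/-- The alternating product `u (i-1) ^ (-ε) * u (i-2) ^ ε * ⋯`. -/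
def altPow {G : Type*} [Group G] (u : ℕ → G) (i : ℕ) (ε : ℤ) : G :=
  (List.ofFn fun l : Fin i => u (i - (l + 1)) ^ (ε * (-1) ^ ((l : ℕ) + 1))).prod

section
variable {G : Type*} [Group G] {u : ℕ → G}

theorem altPow_zero (ε : ℤ) : altPow u 0 ε = 1 := by simp [altPow]

theorem altPow_succ (i : ℕ) (ε : ℤ) : altPow u (i + 1) ε = u i ^ (-ε) * altPow u i (-ε) := by
  simp only [altPow, List.ofFn_succ, List.prod_cons]
  congr 1
  · simp
  · congr 2
    funext l
    simp only [Fin.val_succ]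
    congr 1
    · congr 1; omega
    · ring

theorem altPow_commute {z : G} (hz : ∀ i, Commute z (u i)) (i : ℕ) (ε : ℤ) :
    Commute z (altPow u i ε) := by
  refine Commute.list_prod_right _ _ fun y hy => ?_
  obtain ⟨l, rfl⟩ := List.mem_ofFn.1 hy
  exact (hz _).zpow_right _

theorem altPow_mul_neg (hu : ∀ i j, Commute (u i) (u j)) (i : ℕ) (ε : ℤ) :
    altPow u i ε * altPow u i (-ε) = 1 := by
  induction i generalizing ε with
  | zero => simp [altPow_zero]
  | succ i ih =>
    have hc : Commute (u i ^ ε) (altPow u i (-ε)) :=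
      altPow_commute (fun j => (hu i j).zpow_left ε) i (-ε)
    rw [altPow_succ, altPow_succ, neg_neg, mul_assoc, ← mul_assoc (altPow u i (-ε)), ← hc.eq,
      mul_assoc, zpow_neg, inv_mul_cancel_left]
    simpa using ih (-ε)

/-- With `u_i = K⁺_i K⁻_i` this is the recursion `P_i P_{i+1} = K⁺_i K⁻_i` for the inverses of the
`P_i`. Together with the value `1` at `i = 0` it is all that is used about alternating products
afterwards. -/
theorem altPow_succ_mul (hu : ∀ i j, Commute (u i) (u j)) (i : ℕ) :
    altPow u (i + 1) 1 * altPow u i 1 * u i = 1 := by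
  have := altPow_mul_neg hu i (-1)
  rw [neg_neg] at this
  rw [altPow_succ, mul_assoc (u i ^ (-1 : ℤ)), this]
  simp

end

/-! ### The homomorphism from `U_{r,s}(gl_n)` to `U(R)` -/

namespace UR
variable {n : ℕ} (r s : ℂ)

/-- The product `K⁺_i K⁻_i`, extended by `1`. -/
def KK (n : ℕ) (i : ℕ) : (UR n r s)ˣ := if h : i < n then Kp r s ⟨i, h⟩ * Km r s ⟨i, h⟩ else 1

theorem altProd_eq (i : Fin n) : altProd r s i = altPow (KK r s n) i 1 := by
  unfold altProd altPow
  congr 2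
  funext l
  simp [KK, show (i : ℕ) - (l + 1) < n by omega]

theorem ext0_Lp_diag {i : ℕ} (h : i < n) : ext0 (Lp n r s) i i = Kp r s ⟨i, h⟩ := by
  simp only [ext0, h, and_self, dif_pos]
  rfl

theorem ext0_Lm_diag {i : ℕ} (h : i < n) : ext0 (Lm n r s) i i = Km r s ⟨i, h⟩ := by
  simp only [ext0, h, and_self, dif_pos]
  rfl

variable {r s}

theorem Kp_commute_Kp (hr : r ≠ 0) (hs : s ≠ 0) (i j : Fin n) :
    Commute (Kp r s i) (Kp r s j) := by
  ext
  have := (gaussPair r s hr hs (n := n)).pos.diag_comm hr hs i j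
  rwa [ext0_Lp_diag r s i.2, ext0_Lp_diag r s j.2] at this

theorem Kp_commute_Km (hr : r ≠ 0) (hs : s ≠ 0) (i j : Fin n) :
    Commute (Kp r s i) (Km r s j) := by
  ext
  have := (gaussPair r s hr hs (n := n)).diag_diag hr hs i j
  rwa [ext0_Lp_diag r s i.2, ext0_Lm_diag r s j.2] at this

theorem Km_commute_Km (hr : r ≠ 0) (hs : s ≠ 0) (i j : Fin n) :
    Commute (Km r s i) (Km r s j) := by
  ext
  have := congrArg unop ((gaussPair r s hr hs (n := n)).neg.diag_comm hs hr j i)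
  simp only [unop_mul, unop_op] at this
  rwa [ext0_Lm_diag r s i.2, ext0_Lm_diag r s j.2] at this

theorem commute_KK {z : (UR n r s)ˣ} (hp : ∀ i, Commute z (Kp r s i))
    (hm : ∀ i, Commute z (Km r s i)) (i : ℕ) : Commute z (KK r s n i) := by
  unfold KK
  split_ifs
  · exact (hp _).mul_right (hm _)
  · exact Commute.one_right _

theorem commute_altProd {z : (UR n r s)ˣ} (hp : ∀ i, Commute z (Kp r s i))
    (hm : ∀ i, Commute z (Km r s i)) (i : Fin n) : Commute z (altProd r s i) := by
  rw [altProd_eq]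
  exact altPow_commute (commute_KK hp hm) _ _

theorem Kp_commute_altProd (hr : r ≠ 0) (hs : s ≠ 0) (i j : Fin n) :
    Commute (Kp r s i) (altProd r s j) :=
  commute_altProd (Kp_commute_Kp hr hs i) (Kp_commute_Km hr hs i) j

theorem Km_commute_altProd (hr : r ≠ 0) (hs : s ≠ 0) (i j : Fin n) :
    Commute (Km r s i) (altProd r s j) :=
  commute_altProd (fun j => (Kp_commute_Km hr hs j i).symm) (Km_commute_Km hr hs i) j

theorem KK_commute_KK (hr : r ≠ 0) (hs : s ≠ 0) (i j : ℕ) :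
    Commute (KK r s n i) (KK r s n j) :=
  commute_KK (fun k => (commute_KK (Kp_commute_Kp hr hs k) (Kp_commute_Km hr hs k) i).symm)
    (fun k => (commute_KK (fun j => (Kp_commute_Km hr hs j k).symm)
      (Km_commute_Km hr hs k) i).symm) j

theorem altProd_zero (h : 0 < n) : altProd r s (⟨0, h⟩ : Fin n) = 1 := by
  rw [altProd_eq, altPow_zero]

theorem altProd_succ (hr : r ≠ 0) (hs : s ≠ 0) {i : ℕ} (h : i + 1 < n) :
    altProd r s ⟨i + 1, h⟩ * altProd r s ⟨i, by omega⟩ *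
      (Kp r s ⟨i, by omega⟩ * Km r s ⟨i, by omega⟩) = 1 := by
  have := altPow_succ_mul (KK_commute_KK (n := n) hr hs) i
  rw [altProd_eq, altProd_eq]
  simpa [KK, show i < n by omega] using this

/-- The image of `a_i`. -/
def aU (r s : ℂ) (i : Fin n) : (UR n r s)ˣ := Kp r s i * altProd r s i

/-- The image of `b_i`. -/
def bU (r s : ℂ) (i : Fin n) : (UR n r s)ˣ := Km r s i * altProd r s i

theorem commute_aU {z : (UR n r s)ˣ} (hp : ∀ i, Commute z (Kp r s i))
    (hm : ∀ i, Commute z (Km r s i)) (i : Fin n) : Commute z (aU r s i) :=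
  (hp i).mul_right (commute_altProd hp hm i)

theorem commute_bU {z : (UR n r s)ˣ} (hp : ∀ i, Commute z (Kp r s i))
    (hm : ∀ i, Commute z (Km r s i)) (i : Fin n) : Commute z (bU r s i) :=
  (hm i).mul_right (commute_altProd hp hm i)

theorem aU_commute_aU (hr : r ≠ 0) (hs : s ≠ 0) (i j : Fin n) : Commute (aU r s i) (aU r s j) :=
  commute_aU (fun k => (commute_aU (Kp_commute_Kp hr hs k) (Kp_commute_Km hr hs k) i).symm)
    (fun k => (commute_aU (fun j => (Kp_commute_Km hr hs j k).symm)
      (Km_commute_Km hr hs k) i).symm) j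

theorem aU_commute_bU (hr : r ≠ 0) (hs : s ≠ 0) (i j : Fin n) : Commute (aU r s i) (bU r s j) :=
  commute_bU (fun k => (commute_aU (Kp_commute_Kp hr hs k) (Kp_commute_Km hr hs k) i).symm)
    (fun k => (commute_aU (fun j => (Kp_commute_Km hr hs j k).symm)
      (Km_commute_Km hr hs k) i).symm) j

theorem bU_commute_bU (hr : r ≠ 0) (hs : s ≠ 0) (i j : Fin n) : Commute (bU r s i) (bU r s j) :=
  commute_bU (fun k => (commute_bU (Kp_commute_Kp hr hs k) (Kp_commute_Km hr hs k) i).symm)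
    (fun k => (commute_bU (fun j => (Kp_commute_Km hr hs j k).symm)
      (Km_commute_Km hr hs k) i).symm) j

/-- `a_i b_{i+1} = K⁻_{i+1} (K⁻_i)⁻¹`. -/
theorem aU_mul_bU_succ (hr : r ≠ 0) (hs : s ≠ 0) {i : ℕ} (h : i + 1 < n) :
    aU r s ⟨i, by omega⟩ * bU r s ⟨i + 1, h⟩ =
      Km r s ⟨i + 1, h⟩ * (Km r s ⟨i, by omega⟩)⁻¹ := by
  have h1 := altProd_succ hr hs h
  rw [(aU_commute_bU hr hs _ _).eq, eq_mul_inv_iff_mul_eq, aU, bU, mul_assoc, mul_assoc, mul_assoc,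
    ← mul_assoc (Kp r s _), (Kp_commute_altProd hr hs _ _).eq, mul_assoc, ← mul_assoc (altProd r s _),
    h1, mul_one]

/-- `a_{i+1} b_i = (K⁺_i)⁻¹ K⁺_{i+1}`. -/
theorem aU_succ_mul_bU (hr : r ≠ 0) (hs : s ≠ 0) {i : ℕ} (h : i + 1 < n) :
    aU r s ⟨i + 1, h⟩ * bU r s ⟨i, by omega⟩ =
      (Kp r s ⟨i, by omega⟩)⁻¹ * Kp r s ⟨i + 1, h⟩ := by
  have h1 := altProd_succ hr hs h
  have h2 := ((Kp_commute_Kp hr hs ⟨i, by omega⟩ ⟨i + 1, h⟩).mul_right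
    (Kp_commute_altProd hr hs ⟨i, by omega⟩ ⟨i + 1, h⟩)).eq
  have h3 := ((Kp_commute_altProd hr hs ⟨i, by omega⟩ ⟨i, by omega⟩).mul_left
    (Km_commute_altProd hr hs (⟨i, by omega⟩ : Fin n) ⟨i, by omega⟩)).eq
  rw [eq_inv_mul_iff_mul_eq, aU, bU, ← mul_assoc, h2, mul_assoc, ← mul_assoc (Kp r s ⟨i, _⟩), h3,
    mul_assoc, ← mul_assoc (altProd r s ⟨i + 1, _⟩), h1, mul_one]

end UR

end

/-! ### The Chevalley relations in `U(R)` -/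

noncomputable section

theorem weight_mul {A : Type*} [Ring A] [Algebra ℂ A] {u v z : A} {c d : ℂ}
    (hu : u * z = c • (z * u)) (hv : v * z = d • (z * v)) :
    u * v * z = (c * d) • (z * (u * v)) := by
  rw [mul_assoc, hv, mul_smul_comm, ← mul_assoc, hu, smul_mul_assoc, smul_smul, mul_assoc,
    mul_comm]

namespace UR
variable {n : ℕ} {r s : ℂ}

/-- The image of `e_j`. -/
def eU (r s : ℂ) (j : Fin (n - 1)) : UR n r s := (r / (r - s)) • E r s (lo j) (hi j)

/-- The image of `f_j`. -/
def fU (r s : ℂ) (j : Fin (n - 1)) : UR n r s := (s / (s - r)) • F r s (hi j) (lo j)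

theorem rootVec_eq (j : Fin (n - 1)) :
    rootVec r s (ext0 (Lp n r s)) (KpInv r s n) j = eU r s j := by
  have := j.2
  simp only [rootVec, eU, E, KpInv, ext0, lo, hi, show (j : ℕ) < n by omega,
    show (j : ℕ) + 1 < n by omega, and_self, dif_pos]

theorem negRootVec_eq (j : Fin (n - 1)) :
    negRootVec r s (ext0 (Lm n r s)) (KmInv r s n) j = fU r s j := by
  have := j.2
  simp only [negRootVec, fU, F, KmInv, ext0, lo, hi, show (j : ℕ) < n by omega,
    show (j : ℕ) + 1 < n by omega, and_self, dif_pos]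

theorem rootVec_of_le {j : ℕ} (h : n - 1 ≤ j) :
    rootVec r s (ext0 (Lp n r s)) (KpInv r s n) j = 0 := by
  simp [rootVec, ext0, show ¬ j + 1 < n by omega]

theorem negRootVec_of_le {j : ℕ} (h : n - 1 ≤ j) :
    negRootVec r s (ext0 (Lm n r s)) (KmInv r s n) j = 0 := by
  simp [negRootVec, ext0, show ¬ j + 1 < n by omega]

theorem quantumGL (hr : r ≠ 0) (hs : s ≠ 0) (hne : r ≠ s) :
    QuantumGL r s (fun i => ext0 (Lp n r s) i i) (fun i => ext0 (Lm n r s) i i)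
      (diagRatio (ext0 (Lp n r s)) (KpInv r s n)) (negDiagRatio (ext0 (Lm n r s)) (KmInv r s n))
      (rootVec r s (ext0 (Lp n r s)) (KpInv r s n))
      (negRootVec r s (ext0 (Lm n r s)) (KmInv r s n)) :=
  (gaussPair r s hr hs).quantumGL hr hs hne

theorem Kp_e (hr : r ≠ 0) (hs : s ≠ 0) (hne : r ≠ s) (i : Fin n) (j : Fin (n - 1)) :
    (Kp r s i : UR n r s) * eU r s j = wt r s i j • (eU r s j * Kp r s i) := by
  have := (quantumGL (n := n) hr hs hne).pos.k_e i j
  rwa [rootVec_eq, ext0_Lp_diag r s i.2] at this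

theorem Km_e (hr : r ≠ 0) (hs : s ≠ 0) (hne : r ≠ s) (i : Fin n) (j : Fin (n - 1)) :
    (Km r s i : UR n r s) * eU r s j = wt s r i j • (eU r s j * Km r s i) := by
  have := (quantumGL (n := n) hr hs hne).k'_e i j
  rwa [rootVec_eq, ext0_Lm_diag r s i.2] at this

theorem Kp_f (hr : r ≠ 0) (hs : s ≠ 0) (hne : r ≠ s) (i : Fin n) (j : Fin (n - 1)) :
    (Kp r s i : UR n r s) * fU r s j = (wt r s i j)⁻¹ • (fU r s j * Kp r s i) := by
  have := (quantumGL (n := n) hr hs hne).f_k i j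
  rw [negRootVec_eq, ext0_Lp_diag r s i.2] at this
  rw [this, smul_smul, inv_mul_cancel₀ (wt_ne_zero hr hs _ _), one_smul]

theorem Km_f (hr : r ≠ 0) (hs : s ≠ 0) (hne : r ≠ s) (i : Fin n) (j : Fin (n - 1)) :
    (Km r s i : UR n r s) * fU r s j = (wt s r i j)⁻¹ • (fU r s j * Km r s i) := by
  have := congrArg unop ((quantumGL (n := n) hr hs hne).neg.k_e i j)
  simp only [unop_mul, unop_smul, unop_op] at this
  rw [negRootVec_eq, ext0_Lm_diag r s i.2] at this
  rw [this, smul_smul, inv_mul_cancel₀ (wt_ne_zero hs hr _ _), one_smul]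

/-- Weights are multiplicative, so the recursion `altProd_succ` for the products forces the same
recursion for their weights `q`, where `c` and `d` are the weights of `K⁺` and `K⁻`. -/
theorem altProd_weight (hr : r ≠ 0) (hs : s ≠ 0) {z : UR n r s} {c d q : ℕ → ℂ}
    (hq : ∀ i, q i ≠ 0) (hp : ∀ i : Fin n, (Kp r s i : UR n r s) * z = c i • (z * Kp r s i))
    (hm : ∀ i : Fin n, (Km r s i : UR n r s) * z = d i • (z * Km r s i))
    (h0 : q 0 = 1) (hsucc : ∀ i, q (i + 1) * q i * (c i * d i) = 1) (i : Fin n) :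
    (altProd r s i : UR n r s) * z = q i • (z * altProd r s i) := by
  obtain ⟨i, hi⟩ := i
  induction i with
  | zero => rw [altProd_zero]; simp [h0]
  | succ i ih =>
    have h1 := weight_mul (ih (by omega)) (weight_mul (hp ⟨i, by omega⟩) (hm ⟨i, by omega⟩))
    have h2 := eq_inv_of_mul_eq_one_left
      ((mul_assoc _ _ _).symm.trans (altProd_succ (n := n) hr hs hi))
    rw [h2]
    set v := altProd r s (⟨i, by omega⟩ : Fin n) * (Kp r s ⟨i, by omega⟩ * Km r s ⟨i, by omega⟩)
    have hc : q i * (c i * d i) ≠ 0 := fun h => by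
      have := hsucc i
      rw [mul_assoc, h, mul_zero] at this
      exact zero_ne_one this
    have h3 := TwoParam.inv_weight hc v.inv_mul v.mul_inv h1
    rw [h3]
    congr 1
    rw [eq_comm]
    exact eq_inv_of_mul_eq_one_left (by rw [← mul_assoc]; exact hsucc i)

/-- The product `K⁺_i K⁻_i` has weight `r s` on `e_j` for `i = j` and `i = j + 1`, and weight `1`
otherwise. The recursion started at `1` therefore departs from `1` only at `i = j + 1`. -/
theorem altProd_e (hr : r ≠ 0) (hs : s ≠ 0) (hne : r ≠ s) (i : Fin n) (j : Fin (n - 1)) :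
    (altProd r s i : UR n r s) * eU r s j =
      (if (i : ℕ) = j + 1 then (r * s)⁻¹ else 1 : ℂ) • (eU r s j * altProd r s i) := by
  refine altProd_weight hr hs (q := fun i => if i = j + 1 then (r * s)⁻¹ else 1)
    (c := fun i => wt r s i j) (d := fun i => wt s r i j)
    (fun i => ?_) (fun i => Kp_e hr hs hne i j) (fun i => Km_e hr hs hne i j) (by simp)
    (fun i => ?_) i
  · split_ifs <;> simp [hr, hs]
  · simp only [wt]
    split_ifs <;> first | omega | field_simp

theorem altProd_f (hr : r ≠ 0) (hs : s ≠ 0) (hne : r ≠ s) (i : Fin n) (j : Fin (n - 1)) :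
    (altProd r s i : UR n r s) * fU r s j =
      (if (i : ℕ) = j + 1 then r * s else 1 : ℂ) • (fU r s j * altProd r s i) := by
  refine altProd_weight hr hs (q := fun i => if i = j + 1 then r * s else 1)
    (c := fun i => (wt r s i j)⁻¹) (d := fun i => (wt s r i j)⁻¹)
    (fun i => ?_) (fun i => Kp_f hr hs hne i j) (fun i => Km_f hr hs hne i j) (by simp)
    (fun i => ?_) i
  · split_ifs <;> simp [hr, hs]
  · simp only [wt]
    split_ifs <;> first | omega | field_simp

/-- The images of the generators of `U_{r,s}(gl_n)`. -/
def ofChevalleyGen (r s : ℂ) : ChevalleyGen n → UR n r s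
  | .e j => eU r s j
  | .f j => fU r s j
  | .a i => aU r s i
  | .aInv i => ↑(aU r s i)⁻¹
  | .b i => bU r s i
  | .bInv i => ↑(bU r s i)⁻¹

theorem ofChevalleyGen_commute (hr : r ≠ 0) (hs : s ≠ 0) (x y : ChevalleyGen n)
    (hx : x.IsCartan) (hy : y.IsCartan) :
    Commute (ofChevalleyGen r s x) (ofChevalleyGen r s y) := by
  have aa := aU_commute_aU (n := n) hr hs
  have ab := aU_commute_bU (n := n) hr hs
  have ba := fun i j => (ab j i).symm
  have bb := bU_commute_bU (n := n) hr hs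
  have key : ∀ u v : (UR n r s)ˣ, Commute u v → Commute (u : UR n r s) v :=
    fun u v h => congrArg Units.val h.eq
  obtain ⟨i, hi⟩ := hx
  obtain ⟨j, hj⟩ := hy
  rcases hi with rfl | rfl | rfl | rfl <;> rcases hj with rfl | rfl | rfl | rfl <;>
    apply key <;> simp only [Commute.inv_left_iff, Commute.inv_right_iff, aa, ab, ba, bb]

/-- The relations of `U_{r,s}(gl_n)` hold in `U(R)`. -/
theorem lift_chevalleyRel (hr : r ≠ 0) (hs : s ≠ 0) (hne : r ≠ s) {x y : FreeAlgebra ℂ (ChevalleyGen n)}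
    (h : ChevalleyRel n r s x y) :
    FreeAlgebra.lift ℂ (ofChevalleyGen r s) x = FreeAlgebra.lift ℂ (ofChevalleyGen r s) y := by
  have Q := quantumGL (n := n) hr hs hne
  have hv : ∀ x : ChevalleyGen n, FreeAlgebra.lift ℂ (ofChevalleyGen r s) x.free =
    ofChevalleyGen r s x := fun x => FreeAlgebra.lift_ι_apply _ _
  cases h <;> simp only [map_mul, map_smul, map_sub, map_add, map_pow, map_one, map_zero, hv,
    ofChevalleyGen]
  case r1_comm x y hx hy => exact ofChevalleyGen_commute hr hs x y hx hy
  case r1_a i => exact (aU r s i).mul_inv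
  case r1_b i => exact (bU r s i).mul_inv
  case r2_e i j =>
    rw [Urs.zpow_pairing hr, aU, Units.val_mul, weight_mul (Kp_e hr hs hne i j) (altProd_e hr hs hne i j)]
    congr 1
    simp only [wt, awt]
    split_ifs <;> first | omega | field_simp
  case r2_f i j =>
    rw [zpow_neg, Urs.zpow_pairing hr, aU, Units.val_mul, weight_mul (Kp_f hr hs hne i j) (altProd_f hr hs hne i j)]
    congr 1
    simp only [wt, awt]
    split_ifs <;> first | omega | field_simp
  case r3_e i j =>
    rw [Urs.zpow_pairing hs, bU, Units.val_mul, weight_mul (Km_e hr hs hne i j) (altProd_e hr hs hne i j)]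
    congr 1
    simp only [wt, awt]
    split_ifs <;> first | omega | field_simp
  case r3_f i j =>
    rw [zpow_neg, Urs.zpow_pairing hs, bU, Units.val_mul, weight_mul (Km_f hr hs hne i j) (altProd_f hr hs hne i j)]
    congr 1
    simp only [wt, awt]
    split_ifs <;> first | omega | field_simp
  case r4 i j =>
    have h1 := Q.e_f i j
    rw [rootVec_eq, negRootVec_eq] at h1
    rw [h1]
    rcases eq_or_ne i j with rfl | hij
    swap
    · simp [hij, Fin.val_ne_of_ne hij]
    have hi := i.2
    have h2 := congrArg Units.val (aU_mul_bU_succ (n := n) hr hs (i := i) (by omega))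
    have h3 := congrArg Units.val (aU_succ_mul_bU (n := n) hr hs (i := i) (by omega))
    simp only [Units.val_mul] at h2 h3
    simp only [if_true, one_div]
    congr 2
    · rw [negDiagRatio, ext0_Lm_diag r s (show (i : ℕ) + 1 < n by omega), KmInv,
        dif_pos (show (i : ℕ) < n by omega)]
      exact h2.symm
    · rw [diagRatio, ext0_Lp_diag r s (show (i : ℕ) + 1 < n by omega), KpInv,
        dif_pos (show (i : ℕ) < n by omega)]
      exact h3.symm
  case r5_e i j h =>
    rw [lt_abs] at h
    rw [sub_eq_zero, ← rootVec_eq, ← rootVec_eq]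
    rcases h with h | h
    · exact (Q.pos.e_comm j i (by omega)).symm
    · exact Q.pos.e_comm i j (by omega)
  case r5_f i j h =>
    rw [lt_abs] at h
    rw [sub_eq_zero, ← negRootVec_eq, ← negRootVec_eq]
    rcases h with h | h
    · exact congrArg unop (Q.neg.e_comm j i (by omega))
    · exact (congrArg unop (Q.neg.e_comm i j (by omega))).symm
  case r6_left i j h =>
    have := Q.pos.serre_left i
    rw [← h, rootVec_eq, rootVec_eq] at this
    simpa only [pow_two, mul_assoc] using this
  case r6_right i j h =>
    have := Q.pos.serre_right i
    rw [← h, rootVec_eq, rootVec_eq] at this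
    simpa only [pow_two, mul_assoc] using this
  case r7_left i j h =>
    have := congrArg unop (Q.neg.serre_left i)
    simp only [unop_add, unop_sub, unop_mul, unop_smul, unop_op, unop_zero] at this
    rw [← h, negRootVec_eq, negRootVec_eq] at this
    linear_combination (norm := skip) (r⁻¹ * s⁻¹) • this
    simp only [mul_assoc, pow_two]
    match_scalars <;> field_simp <;> ring
  case r7_right i j h =>
    have := congrArg unop (Q.neg.serre_right i)
    simp only [unop_add, unop_sub, unop_mul, unop_smul, unop_op, unop_zero] at this
    rw [← h, negRootVec_eq, negRootVec_eq] at this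
    linear_combination (norm := skip) (r⁻¹ * s⁻¹) • this
    simp only [mul_assoc, pow_two]
    match_scalars <;> field_simp <;> ring

/-- The homomorphism `U_{r,s}(gl_n) → U(R)`. -/
def ofUrs (hr : r ≠ 0) (hs : s ≠ 0) (hne : r ≠ s) : Urs n r s →ₐ[ℂ] UR n r s :=
  RingQuot.liftAlgHom ℂ ⟨FreeAlgebra.lift ℂ (ofChevalleyGen r s),
    fun _ _ h => lift_chevalleyRel hr hs hne h⟩

theorem ofUrs_gen (hr : r ≠ 0) (hs : s ≠ 0) (hne : r ≠ s) (x : ChevalleyGen n) :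
    ofUrs hr hs hne (Urs.gen r s x) = ofChevalleyGen r s x := by
  simp [ofUrs, Urs.gen, ChevalleyGen.free]

end UR

end

noncomputable section

/-! ### The homomorphism from `U(R)` to `U_{r,s}(gl_n)` -/

namespace Urs
variable {n : ℕ} (r s : ℂ)

/-- The product of the `a_m b_m` for `m < i`. -/
def prodN (n i : ℕ) : Urs n r s := cartanProd (aN r s n) (bN r s n) i

/-- The image of `K⁺_i`. -/
def kpN (n i : ℕ) : Urs n r s := aN r s n i * prodN r s n i

/-- The image of `K⁻_i`. -/
def kmN (n i : ℕ) : Urs n r s := bN r s n i * prodN r s n i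

theorem aN_val (i : Fin n) : aN r s n i = gen r s (.a i) := by simp [aN]

theorem bN_val (i : Fin n) : bN r s n i = gen r s (.b i) := by simp [bN]

theorem eN_val (j : Fin (n - 1)) : eN r s n j = gen r s (.e j) := by simp [eN]

theorem fN_val (j : Fin (n - 1)) : fN r s n j = gen r s (.f j) := by simp [fN]

theorem gen_a_mul_inv (i : Fin n) : gen r s (.a i) * gen r s (.aInv i) = 1 := by
  simpa [gen] using RingQuot.mkAlgHom_rel ℂ (ChevalleyRel.r1_a (r := r) (s := s) i)

theorem gen_b_mul_inv (i : Fin n) : gen r s (.b i) * gen r s (.bInv i) = 1 := by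
  simpa [gen] using RingQuot.mkAlgHom_rel ℂ (ChevalleyRel.r1_b (r := r) (s := s) i)

theorem isUnit_aN {i : ℕ} (h : i < n) : IsUnit (aN r s n i) := by
  rw [aN, dif_pos h]
  refine isUnit_iff_exists.2 ⟨_, gen_a_mul_inv r s _, ?_⟩
  rw [gen_comm r s _ _ ⟨_, .inr (.inl rfl)⟩ ⟨_, .inl rfl⟩, gen_a_mul_inv]

theorem isUnit_bN {i : ℕ} (h : i < n) : IsUnit (bN r s n i) := by
  rw [bN, dif_pos h]
  refine isUnit_iff_exists.2 ⟨_, gen_b_mul_inv r s _, ?_⟩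
  rw [gen_comm r s _ _ ⟨_, .inr (.inr (.inr rfl))⟩ ⟨_, .inr (.inr (.inl rfl))⟩, gen_b_mul_inv]

theorem isUnit_prodN {i : ℕ} (h : i ≤ n) : IsUnit (prodN r s n i) := by
  induction i with
  | zero => exact isUnit_one
  | succ i ih => exact (ih (by omega)).mul ((isUnit_aN r s h).mul (isUnit_bN r s h))

theorem isUnit_kpN {i : ℕ} (h : i < n) : IsUnit (kpN r s n i) :=
  (isUnit_aN r s h).mul (isUnit_prodN r s h.le)

theorem isUnit_kmN {i : ℕ} (h : i < n) : IsUnit (kmN r s n i) :=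
  (isUnit_bN r s h).mul (isUnit_prodN r s h.le)

theorem quantumGL (hr : r ≠ 0) (hs : s ≠ 0) :
    QuantumGL r s (kpN r s n) (kmN r s n) (fun i => aN r s n (i + 1) * bN r s n i)
      (fun i => aN r s n i * bN r s n (i + 1)) (eN r s n) (fN r s n) :=
  (chevalley r s hr hs).quantumGL hr hs

/-- The images of the generators of `U(R)`. -/
def ofFRTGen : FRTGen n → Urs n r s
  | .lp i j _ => upper s (kpN r s n) (eN r s n) i j
  | .lm i j _ => lower r (kmN r s n) (fN r s n) i j
  | .lpInv i => Ring.inverse (kpN r s n i)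
  | .lmInv i => Ring.inverse (kmN r s n i)

theorem lift_freeLp (i j : Fin n) :
    FreeAlgebra.lift ℂ (ofFRTGen r s) (freeLp n i j) = upper s (kpN r s n) (eN r s n) i j := by
  simp only [freeLp, Matrix.of_apply]
  split_ifs with h
  · exact FreeAlgebra.lift_ι_apply _ _
  · rw [map_zero, upper_of_lt _ _ _ (not_le.1 h)]

theorem lift_freeLm (i j : Fin n) :
    FreeAlgebra.lift ℂ (ofFRTGen r s) (freeLm n i j) = lower r (kmN r s n) (fN r s n) i j := by
  simp only [freeLm, Matrix.of_apply]
  split_ifs with h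
  · exact FreeAlgebra.lift_ι_apply _ _
  · rw [map_zero, lower_of_lt _ _ _ (not_le.1 h)]

variable {r s}

/-- The relations of `U(R)` hold in `U_{r,s}(gl_n)`. -/
theorem lift_frtRel (hr : r ≠ 0) (hs : s ≠ 0) (hne : r ≠ s) (hrs : r + s ≠ 0)
    {x y : FreeAlgebra ℂ (FRTGen n)} (h : FRTRel n r s x y) :
    FreeAlgebra.lift ℂ (ofFRTGen r s) x = FreeAlgebra.lift ℂ (ofFRTGen r s) y := by
  obtain ⟨hpp, hmm, hpm⟩ := (quantumGL (n := n) r s hr hs).rtt hr hs hne hrs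
  cases h
  case pp p q =>
    obtain ⟨i, j⟩ := p
    obtain ⟨k, l⟩ := q
    have := hpp i j k l
    rw [freeR, R_mul_legs_apply, legs_mul_R_apply]
    simp only [Fin.lt_def]
    split_ifs at this ⊢ <;> simpa [lift_freeLp] using this
  case mm p q =>
    obtain ⟨i, j⟩ := p
    obtain ⟨k, l⟩ := q
    have := hmm i j k l
    rw [freeR, R_mul_legs_apply, legs_mul_R_apply]
    simp only [Fin.lt_def]
    split_ifs at this ⊢ <;> simpa [lift_freeLm] using this
  case pm p q =>
    obtain ⟨i, j⟩ := p
    obtain ⟨k, l⟩ := q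
    have := hpm i j k l
    rw [freeR, R_mul_legs_apply, legs_mul_R_apply]
    simp only [Fin.lt_def]
    split_ifs at this ⊢ <;> simpa [lift_freeLp, lift_freeLm] using this
  case lp_inv i =>
    rw [map_mul, lift_freeLp, upper_self, FreeAlgebra.lift_ι_apply, map_one]
    exact Ring.mul_inverse_cancel _ (isUnit_kpN r s i.2)
  case inv_lp i =>
    rw [map_mul, lift_freeLp, upper_self, FreeAlgebra.lift_ι_apply, map_one]
    exact Ring.inverse_mul_cancel _ (isUnit_kpN r s i.2)
  case lm_inv i =>
    rw [map_mul, lift_freeLm, lower_self, FreeAlgebra.lift_ι_apply, map_one]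
    exact Ring.mul_inverse_cancel _ (isUnit_kmN r s i.2)
  case inv_lm i =>
    rw [map_mul, lift_freeLm, lower_self, FreeAlgebra.lift_ι_apply, map_one]
    exact Ring.inverse_mul_cancel _ (isUnit_kmN r s i.2)

/-- The homomorphism `U(R) → U_{r,s}(gl_n)`. -/
def ofUR (hr : r ≠ 0) (hs : s ≠ 0) (hne : r ≠ s) (hrs : r + s ≠ 0) : UR n r s →ₐ[ℂ] Urs n r s :=
  RingQuot.liftAlgHom ℂ ⟨FreeAlgebra.lift ℂ (ofFRTGen r s),
    fun _ _ h => lift_frtRel hr hs hne hrs h⟩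

section
variable (hr : r ≠ 0) (hs : s ≠ 0) (hne : r ≠ s) (hrs : r + s ≠ 0)

theorem ofUR_mk (x : FreeAlgebra ℂ (FRTGen n)) :
    ofUR hr hs hne hrs (UR.mk n r s x) = FreeAlgebra.lift ℂ (ofFRTGen r s) x := by
  simp [ofUR, UR.mk]

theorem ofUR_Lp (i j : Fin n) :
    ofUR hr hs hne hrs (UR.Lp n r s i j) = upper s (kpN r s n) (eN r s n) i j := by
  rw [← UR.mk_freeLp, ofUR_mk, lift_freeLp]

theorem ofUR_Lm (i j : Fin n) :
    ofUR hr hs hne hrs (UR.Lm n r s i j) = lower r (kmN r s n) (fN r s n) i j := by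
  rw [← UR.mk_freeLm, ofUR_mk, lift_freeLm]

theorem ofUR_Kp (i : Fin n) : ofUR hr hs hne hrs (UR.Kp r s i) = kpN r s n i :=
  (ofUR_Lp hr hs hne hrs i i).trans (upper_self _ _ _ _)

theorem ofUR_Km (i : Fin n) : ofUR hr hs hne hrs (UR.Km r s i) = kmN r s n i :=
  (ofUR_Lm hr hs hne hrs i i).trans (lower_self _ _ _ _)

/-- By the recursions `K⁺_i K⁻_i = P_i P_{i+1}` and `altProd_succ`, both sequences being determined
by their value `1` at `i = 0`, the alternating product goes to the inverse of `P_i`. Hence `K⁺_i`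
times it goes to `a_i`. -/
theorem ofUR_altProd (i : Fin n) :
    prodN r s n i * ofUR hr hs hne hrs (UR.altProd r s i) = 1 := by
  set φ := ofUR (n := n) hr hs hne hrs
  have C := (chevalley (n := n) r s hr hs).pos
  have hu : ∀ (u : (UR n r s)ˣ) (p : Urs n r s), φ u * p = 1 ↔ p * φ u = 1 := fun u p =>
    (Units.mul_eq_one_iff_inv_eq (u := Units.map (φ : UR n r s →* Urs n r s) u)).trans
      (eq_comm.trans Units.mul_eq_one_iff_eq_inv.symm)
  obtain ⟨i, hi⟩ := i
  induction i with
  | zero => rw [UR.altProd_zero]; simp [prodN, cartanProd]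
  | succ i ih =>
    have h1 := congrArg (fun u : (UR n r s)ˣ => φ u) (UR.altProd_succ (n := n) hr hs hi)
    simp only [Units.val_mul, map_mul, Units.val_one, map_one] at h1
    rw [ofUR_Kp, ofUR_Km] at h1
    have h2 := (hu _ _).2 (ih (by omega))
    have h3 : kpN r s n i * kmN r s n i = prodN r s n i * prodN r s n (i + 1) := by
      have ha := C.prod_a i i
      have hb := C.prod_b i i
      simp only [kpN, kmN, prodN, cartanProd] at *
      linear_combination (norm := noncomm_ring) -(ha * bN r s n i * cartanProd (aN r s n) (bN r s n) i)
        - cartanProd (aN r s n) (bN r s n) i * (ha * bN r s n i)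
        - cartanProd (aN r s n) (bN r s n) i * aN r s n i * hb
    dsimp only at h1 h2
    rw [h3, mul_assoc, ← mul_assoc (φ (UR.altProd r s (⟨i, _⟩ : Fin n))), h2, one_mul] at h1
    exact (hu _ _).1 h1

theorem ofUR_aU (i : Fin n) : ofUR hr hs hne hrs (UR.aU r s i) = gen r s (.a i) := by
  rw [UR.aU, Units.val_mul, map_mul, ofUR_Kp, kpN, mul_assoc, ofUR_altProd, mul_one, aN_val]

theorem ofUR_bU (i : Fin n) : ofUR hr hs hne hrs (UR.bU r s i) = gen r s (.b i) := by
  rw [UR.bU, Units.val_mul, map_mul, ofUR_Km, kmN, mul_assoc, ofUR_altProd, mul_one, bN_val]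

/-- With `K = K⁺_j`, the superdiagonal entry is `K e - s e K` and `e K = r⁻¹ K e`, so `E_{j,j+1}`
goes to `(1 - s / r) e`. This is what fixes the normalisation `r / (r - s)`. -/
theorem ofUR_eU (j : Fin (n - 1)) : ofUR hr hs hne hrs (UR.eU r s j) = gen r s (.e j) := by
  have h1 : ofUR hr hs hne hrs ((UR.Kp r s (lo j))⁻¹ : (UR n r s)ˣ) * kpN r s n j = 1 := by
    have := ofUR_Kp hr hs hne hrs (lo j)
    rw [lo] at this
    rw [← this, ← map_mul]
    exact (congrArg _ (Units.inv_mul _)).trans (map_one _)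
  have h2 := (quantumGL (n := n) r s hr hs).pos.k_e j j
  have hd : r - s ≠ 0 := sub_ne_zero.2 hne
  rw [UR.eU, UR.E, map_smul, map_mul, ofUR_Lp]
  simp only [lo, hi] at h1 ⊢
  rw [upper_succ _ _ _ le_rfl, upper_self]
  simp only [wt, if_true, eN_val] at h2 ⊢
  generalize ofUR hr hs hne hrs _ = v at *
  have h3 : gen r s (.e j) * kpN r s n j = r⁻¹ • (kpN r s n j * gen r s (.e j)) := by
    rw [h2, smul_smul, inv_mul_cancel₀ hr, one_smul]
  rw [h3, mul_sub, mul_smul_comm, mul_smul_comm, ← mul_assoc, h1, one_mul]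
  match_scalars
  field_simp

theorem ofUR_fU (j : Fin (n - 1)) : ofUR hr hs hne hrs (UR.fU r s j) = gen r s (.f j) := by
  have h1 : kmN r s n j * ofUR hr hs hne hrs ((UR.Km r s (lo j))⁻¹ : (UR n r s)ˣ) = 1 := by
    have := ofUR_Km hr hs hne hrs (lo j)
    rw [lo] at this
    rw [← this, ← map_mul]
    exact (congrArg _ (Units.mul_inv _)).trans (map_one _)
  have h2 := congrArg unop ((quantumGL (n := n) r s hr hs).neg.k_e j j)
  simp only [unop_mul, unop_smul, unop_op] at h2
  have hd : s - r ≠ 0 := sub_ne_zero.2 hne.symm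
  rw [UR.fU, UR.F, map_smul, map_mul, ofUR_Lm]
  simp only [lo, hi] at h1 ⊢
  rw [lower_succ _ _ _ le_rfl, lower_self]
  simp only [wt, if_true, fN_val] at h2 ⊢
  generalize ofUR hr hs hne hrs _ = v at *
  have h3 : kmN r s n j * gen r s (.f j) = s⁻¹ • (gen r s (.f j) * kmN r s n j) := by
    rw [h2, smul_smul, inv_mul_cancel₀ hs, one_smul]
  rw [h3, sub_mul, smul_mul_assoc, smul_mul_assoc, mul_assoc, h1, mul_one]
  match_scalars
  field_simp

/-! ### The two homomorphisms are inverse to each other -/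

theorem ofUR_comp_ofUrs :
    (ofUR hr hs hne hrs).comp (UR.ofUrs (n := n) hr hs hne) = AlgHom.id ℂ _ := by
  have key : ∀ (u : (UR n r s)ˣ) (x y : Urs n r s), ofUR hr hs hne hrs u = x → x * y = 1 →
      ofUR hr hs hne hrs ↑u⁻¹ = y := fun u x y h hxy => by
    subst h
    exact left_inv_eq_right_inv (by rw [← map_mul, u.inv_mul, map_one]) hxy
  refine RingQuot.ringQuot_ext' ℂ _ _ (FreeAlgebra.hom_ext (funext fun x => ?_))
  change ofUR hr hs hne hrs (UR.ofUrs hr hs hne (gen r s x)) = gen r s x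
  rw [UR.ofUrs_gen]
  cases x with
  | e j => exact ofUR_eU hr hs hne hrs j
  | f j => exact ofUR_fU hr hs hne hrs j
  | a i => exact ofUR_aU hr hs hne hrs i
  | aInv i => exact key _ _ _ (ofUR_aU hr hs hne hrs i) (gen_a_mul_inv r s i)
  | b i => exact ofUR_bU hr hs hne hrs i
  | bInv i => exact key _ _ _ (ofUR_bU hr hs hne hrs i) (gen_b_mul_inv r s i)

theorem ofUrs_prodN (i : Fin n) :
    UR.ofUrs hr hs hne (prodN r s n i) = ↑(UR.altProd r s i)⁻¹ := by
  obtain ⟨i, hi⟩ := i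
  induction i with
  | zero => rw [UR.altProd_zero]; simp [prodN, cartanProd]
  | succ i ih =>
    have h1 := UR.altProd_succ (n := n) hr hs hi
    have h2 := UR.Km_commute_altProd hr hs (⟨i, by omega⟩ : Fin n) ⟨i, by omega⟩
    have h3 := UR.Kp_commute_altProd hr hs (⟨i, by omega⟩ : Fin n) ⟨i, by omega⟩
    have ha := aN_val r s (⟨i, by omega⟩ : Fin n)
    have hb := bN_val r s (⟨i, by omega⟩ : Fin n)
    have hp := ih (by omega)
    dsimp only at ha hb hp
    have e : prodN r s n (i + 1) = prodN r s n i * (aN r s n i * bN r s n i) := rfl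
    change UR.ofUrs hr hs hne (prodN r s n (i + 1)) = _
    rw [e, map_mul, map_mul, hp, ha, hb, UR.ofUrs_gen, UR.ofUrs_gen]
    simp only [UR.ofChevalleyGen]
    rw [← Units.val_mul, ← Units.val_mul]
    congr 1
    rw [eq_comm, inv_eq_iff_mul_eq_one, ← h1, UR.aU, UR.bU, h2.eq, ← mul_assoc (_ * _),
      mul_assoc (UR.Kp r s _), (h3.mul_right h3).eq]
    group

theorem ofUrs_kpN (i : Fin n) : UR.ofUrs hr hs hne (kpN r s n i) = UR.Kp r s i := by
  rw [kpN, map_mul, ofUrs_prodN, aN_val, UR.ofUrs_gen, UR.ofChevalleyGen, UR.aU,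
    ← Units.val_mul, mul_inv_cancel_right]

theorem ofUrs_kmN (i : Fin n) : UR.ofUrs hr hs hne (kmN r s n i) = UR.Km r s i := by
  rw [kmN, map_mul, ofUrs_prodN, bN_val, UR.ofUrs_gen, UR.ofChevalleyGen, UR.bU,
    ← Units.val_mul, mul_inv_cancel_right]

theorem ofUrs_kpN_eq (i : ℕ) : UR.ofUrs hr hs hne (kpN r s n i) = ext0 (UR.Lp n r s) i i := by
  by_cases h : i < n
  · rw [UR.ext0_Lp_diag r s h]
    exact ofUrs_kpN hr hs hne ⟨i, h⟩
  · simp [kpN, aN, ext0, h]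

theorem ofUrs_kmN_eq (i : ℕ) : UR.ofUrs hr hs hne (kmN r s n i) = ext0 (UR.Lm n r s) i i := by
  by_cases h : i < n
  · rw [UR.ext0_Lm_diag r s h]
    exact ofUrs_kmN hr hs hne ⟨i, h⟩
  · simp [kmN, bN, ext0, h]

theorem ofUrs_eN (j : ℕ) : UR.ofUrs hr hs hne (eN r s n j) =
    rootVec r s (ext0 (UR.Lp n r s)) (UR.KpInv r s n) j := by
  by_cases h : j < n - 1
  · rw [eN, dif_pos h, UR.ofUrs_gen]
    exact (UR.rootVec_eq ⟨j, h⟩).symm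
  · rw [eN, dif_neg h, map_zero, UR.rootVec_of_le (not_lt.1 h)]

theorem ofUrs_fN (j : ℕ) : UR.ofUrs hr hs hne (fN r s n j) =
    negRootVec r s (ext0 (UR.Lm n r s)) (UR.KmInv r s n) j := by
  by_cases h : j < n - 1
  · rw [fN, dif_pos h, UR.ofUrs_gen]
    exact (UR.negRootVec_eq ⟨j, h⟩).symm
  · rw [fN, dif_neg h, map_zero, UR.negRootVec_of_le (not_lt.1 h)]

/-- A homomorphism carries `upper` to the matrix built from the images of its data, here the
diagonal and root vectors of `L⁺`; by `GaussHalf.eq_upper` that matrix is `L⁺`. -/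
theorem ofUrs_upper (i j : Fin n) :
    UR.ofUrs hr hs hne (upper s (kpN r s n) (eN r s n) i j) = UR.Lp n r s i j := by
  rw [upper_map]
  simp only [ofUrs_kpN_eq, ofUrs_eN]
  rw [← ext0_val (UR.Lp n r s) i j]
  exact ((UR.gaussPair r s hr hs).pos.eq_upper hr hs hne i j).symm

theorem ofUrs_lower (i j : Fin n) :
    UR.ofUrs hr hs hne (lower r (kmN r s n) (fN r s n) i j) = UR.Lm n r s i j := by
  rw [lower_map]
  simp only [ofUrs_kmN_eq, ofUrs_fN]
  rw [← ext0_val (UR.Lm n r s) i j]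
  exact ((UR.gaussPair r s hr hs).eq_lower hr hs hne i j).symm

theorem ofUrs_comp_ofUR :
    (UR.ofUrs (n := n) hr hs hne).comp (ofUR hr hs hne hrs) = AlgHom.id ℂ _ := by
  have key : ∀ (u : (UR n r s)ˣ) (x : Urs n r s), UR.ofUrs hr hs hne x = u → IsUnit x →
      UR.ofUrs hr hs hne (Ring.inverse x) = ↑u⁻¹ := fun u x h hx => by
    refine left_inv_eq_right_inv (a := (u : UR n r s)) ?_ u.mul_inv
    rw [← h, ← map_mul, Ring.inverse_mul_cancel _ hx, map_one]
  refine RingQuot.ringQuot_ext' ℂ _ _ (FreeAlgebra.hom_ext (funext fun x => ?_))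
  change UR.ofUrs hr hs hne (ofUR hr hs hne hrs (UR.mk n r s (FreeAlgebra.ι ℂ x))) =
    UR.mk n r s (FreeAlgebra.ι ℂ x)
  rw [ofUR_mk, FreeAlgebra.lift_ι_apply]
  cases x with
  | lp i j h =>
    refine (ofUrs_upper hr hs hne i j).trans ?_
    simp [UR.Lp, freeLp, h]
  | lm i j h =>
    refine (ofUrs_lower hr hs hne i j).trans ?_
    simp [UR.Lm, freeLm, h]
  | lpInv i => exact key _ _ (ofUrs_kpN hr hs hne i) (isUnit_kpN r s i.2)
  | lmInv i => exact key _ _ (ofUrs_kmN hr hs hne i) (isUnit_kmN r s i.2)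

end
end Urs

end

end TwoParam

theorem mainTheorem4 (n : ℕ) (r s : ℂ) (hr : r ≠ 0) (hs : s ≠ 0) (hrs : r ≠ s)
    (hrs' : r + s ≠ 0) :
    ∃ ψ : TwoParam.Urs n r s ≃ₐ[ℂ] TwoParam.UR n r s,
      (∀ j : Fin (n - 1), ψ (TwoParam.Urs.gen r s (.e j)) =
        (r / (r - s)) • TwoParam.UR.E r s (TwoParam.lo j) (TwoParam.hi j)) ∧
      (∀ j : Fin (n - 1), ψ (TwoParam.Urs.gen r s (.f j)) =
        (s / (s - r)) • TwoParam.UR.F r s (TwoParam.hi j) (TwoParam.lo j)) ∧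
      (∀ i : Fin n, ψ (TwoParam.Urs.gen r s (.a i)) =
        ((TwoParam.UR.Kp r s i * TwoParam.UR.altProd r s i : (TwoParam.UR n r s)ˣ) :
          TwoParam.UR n r s)) ∧
      (∀ i : Fin n, ψ (TwoParam.Urs.gen r s (.b i)) =
        ((TwoParam.UR.Km r s i * TwoParam.UR.altProd r s i : (TwoParam.UR n r s)ˣ) :
          TwoParam.UR n r s)) :=
  ⟨AlgEquiv.ofAlgHom (TwoParam.UR.ofUrs hr hs hrs) (TwoParam.Urs.ofUR hr hs hrs hrs')
      (TwoParam.Urs.ofUrs_comp_ofUR hr hs hrs hrs') (TwoParam.Urs.ofUR_comp_ofUrs hr hs hrs hrs'),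
    fun j => TwoParam.UR.ofUrs_gen hr hs hrs (.e j), fun j => TwoParam.UR.ofUrs_gen hr hs hrs (.f j),
    fun i => TwoParam.UR.ofUrs_gen hr hs hrs (.a i), fun i => TwoParam.UR.ofUrs_gen hr hs hrs (.b i)⟩
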